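/- Let $V$ be an $n$-dimensional real vector space, $\Gamma\subset V$ a lattice of rank $n$, $\Gamma^*\subset V^*$ the dual lattice, and $V_{\mathbb C}=V\otimes\mathbb C$. Let $\Delta\subset\Gamma^*$ be a finite set which spans $V^*$ and lies in an open half space $\{\alpha : \langle\alpha,v\rangle>0\}$ for some $v\in V$, and let $\mathcal A$ be the arrangement of the hyperplanes $\alpha=0$, $\alpha\in\Delta$. Let $M^{\Gamma\mathcal A}$ be the ring of meromorphic functions on $V_{\mathbb C}$ generated by the functions $c\,e^{\xi}$ ($c\in\mathbb C$, $\xi\in\Gamma^*$) and $1/(1-ue^{\alpha})$ ($\alpha\in\Delta$, $u\in\mathbb C^*$). We use the following notions. * **Expansion.** Each $F\in M^{\Gamma\mathcal A}$ can be written as $F=\sum_{\xi\in I}c_\xi e^\xi\big/\prod_{k=1}^R(1-u_ke^{\beta_k})$ with $I\subset\Gamma^*$ finite, $c_\xi\in\mathbb C$, $u_k\in\mathbb C^*$, $\beta_k\in\Delta$; its expansion is the formal series $r^+(F)=\big(\sum_{\xi\in I} c_\xi e^\xi\big)\prod_{k=1}^R\sum_{m\ge0}u_k^me^{m\beta_k}$,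 and $\operatorname{Coeff}(r^+(F),\lambda)$ is the coefficient of $e^\lambda$ in it. * **The set $\Box(F)$.** $\Box(F)$ is the set of $\mu\in V^*$ such that for every $v\in V$ the function $s\mapsto e^{s\langle\mu,v\rangle}F(z_0+sv)$ remains bounded as $s\to+\infty$ ($s$ real), where $z_0\in V_{\mathbb C}$ is an arbitrary point which is not a pole of $F$ (the set does not depend on it). $\Box(F)^0$ is its interior. * **Total residue.** Let $R_{\mathcal A}$ be the ring of rational functions on $V_{\mathbb C}$ with poles along the hyperplanes of $\mathcal A$, let $\mathcal B(\Delta)$ be the set of subsets of $\Delta$ that are bases of $V^*$, put $f_\sigma=\prod_{\alpha\in\sigma}\alpha^{-1}$ for $\sigma\in\mathcal B(\Delta)$, and let $S_{\mathcal A}$ be the complex span of the $f_\sigma$. Then $R_{\mathcal A}=\big(\sum_{v\in V_{\mathbb C}}\partial_vR_{\mathcal A}\big)\oplus S_{\mathcal A}$, and $\operatorname{Tres}:R_{\mathcal A}\to S_{\mathcal A}$ is the corresponding projection. If $P$ is holomorphic near $0$ and $\beta_1,\dots,\beta_R\in\Delta$, then $\operatorname{Tres}(P/\prod_i\beta_i):=\operatorname{Tres}(P_{[R-n]}/\prod_i\beta_i)$,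 where $P_{[k]}$ is the homogeneous component of degree $k$ of the Taylor expansion of $P$ at $0$ ($0$ if $k<0$). * **Reduced set of poles.** This is a finite set $\mathrm{RSP}(F,\Gamma)\subset V_{\mathbb C}$, no two distinct elements of which differ by an element of $2\pi i\Gamma$, such that every $q\in V_{\mathbb C}$ for which $\operatorname{Tres}\big(F(q-z)G(q-z)\big)\ne0$ for some entire function $G$ belongs to $2\pi i\Gamma+\mathrm{RSP}(F,\Gamma)$. For $\lambda\in\Gamma^*$ put $$s[F,\Gamma](\lambda)=\sum_{p\in\mathrm{RSP}(F,\Gamma)}\operatorname{Tres}\big(e^{\langle\lambda,z-p\rangle}F(p-z)\big)\in S_{\mathcal A}.$$ * **Big chambers and the Jeffrey–Kirwan functional.** For a finite set $\nu\subset V^*$ let $C(\nu)=\sum_{\alpha\in\nu}\mathbb R_{\ge0}\alpha$. A big chamber is a connected component of the complement in $V^*$ of the union of the cones $C(\nu)$, $\nu\subset\Delta$, $|\nu|<n$. For a big chamber $\mathfrak c$, $J\langle\mathfrak c,\cdot\rangle_{\mathrm{vol}_{\Gamma^*}}$ is the linear functional on $S_{\mathcal A}$ such that $J\langle\mathfrak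 c,f_\sigma\rangle_{\mathrm{vol}_{\Gamma^*}}=\mathrm{vol}_{\Gamma^*}(\sigma)^{-1}$ if $\mathfrak c\subset C(\sigma)$ and $0$ if $\mathfrak c\cap C(\sigma)=\emptyset$ (one of the two always holds), for all $\sigma\in\mathcal B(\Delta)$. Here $\mathrm{vol}_{\Gamma^*}$ is the translation-invariant measure on $V^*$ giving volume $1$ to the parallelepiped spanned by a basis of $\Gamma^*$, and $\mathrm{vol}_{\Gamma^*}(\sigma)$ is the volume of $\sum_{\alpha\in\sigma}[0,1]\alpha$. **Theorem.** Let $F\in M^{\Gamma\mathcal A}$ and $\lambda\in\Gamma^*$. For every reduced set of poles of $F$ and every big chamber $\mathfrak c$ with $(\lambda+\Box(F)^0)\cap\mathfrak c\neq\emptyset$, $$\operatorname{Coeff}(r^+(F),\lambda)=J\big\langle\mathfrak c,\,s[F,\Gamma](\lambda)\big\rangle_{\mathrm{vol}_{\Gamma^*}}.$$ -/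

import Mathlib

open scoped BigOperators

namespace JKResidue

noncomputable section

/-! Throughout, `V` is a finite-dimensional real vector space and `StrongDual ℝ V` is its dual
`V*`.  The auxiliary norm on `V` only provides the topology. -/

/-- The complexification of `V`, realised as the space of real linear maps `V* → ℂ`; it is a complex
normed space of complex dimension `dim V`. -/
def Cx (V : Type*) [NormedAddCommGroup V] [NormedSpace ℝ V] : Type _ :=
  StrongDual ℝ V →L[ℝ] ℂ

instance (V : Type*) [NormedAddCommGroup V] [NormedSpace ℝ V] : NormedAddCommGroup (Cx V) :=
  inferInstanceAs (NormedAddCommGroup (StrongDual ℝ V →L[ℝ] ℂ))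

instance (V : Type*) [NormedAddCommGroup V] [NormedSpace ℝ V] : NormedSpace ℂ (Cx V) :=
  inferInstanceAs (NormedSpace ℂ (StrongDual ℝ V →L[ℝ] ℂ))

section Basic

variable {V : Type*} [NormedAddCommGroup V] [NormedSpace ℝ V]

/-- The pairing `⟨α, z⟩` of a linear form `α ∈ V*` with a point `z` of the complexification, as a
complex linear form in `z`. -/
def pair (α : StrongDual ℝ V) : Cx V →L[ℂ] ℂ where
  toFun := fun z => (show StrongDual ℝ V →L[ℝ] ℂ from z) α
  map_add' := fun _ _ => rfl
  map_smul' := fun _ _ => rfl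
  cont := (ContinuousLinearMap.apply ℝ ℂ α).continuous

/-- The inclusion of `V` in its complexification. -/
def ofReal (v : V) : Cx V :=
  (Complex.ofRealCLM.comp (NormedSpace.inclusionInDoubleDual ℝ V v) : StrongDual ℝ V →L[ℝ] ℂ)

theorem pair_ofReal (α : StrongDual ℝ V) (v : V) : pair α (ofReal v) = (α v : ℂ) := rfl

/-- The points `2πiγ`, `γ ∈ Γ`. -/
def period (γ : V) : Cx V :=
  (2 * (Real.pi : ℂ) * Complex.I) • ofReal γ

/-- The dual lattice `Γ*`: the linear forms that take integral values on `Γ`. -/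
def dualLattice (Γ : Submodule ℤ V) : Submodule ℤ (StrongDual ℝ V) where
  carrier := {α | ∀ γ ∈ Γ, ∃ k : ℤ, α γ = k}
  zero_mem' := fun _ _ => ⟨0, by simp⟩
  add_mem' := by
    intro a b ha hb γ hγ
    obtain ⟨k, hk⟩ := ha γ hγ
    obtain ⟨l, hl⟩ := hb γ hγ
    exact ⟨k + l, by simp [hk, hl]⟩
  smul_mem' := by
    intro m a ha γ hγ
    obtain ⟨k, hk⟩ := ha γ hγ
    exact ⟨m * k, by simp [hk]⟩

/-! ### Entire and meromorphic functions on the complexification -/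

variable (V) in
/-- The algebra of entire functions on the complexification of `V`. -/
def Entire : Subalgebra ℂ (Cx V → ℂ) where
  carrier := {f | AnalyticOnNhd ℂ f Set.univ}
  mul_mem' := fun hf hg => AnalyticOnNhd.mul hf hg
  add_mem' := fun hf hg => AnalyticOnNhd.add hf hg
  algebraMap_mem' := fun _ => analyticOnNhd_const

instance : IsDomain (Entire V) := by
  have : NoZeroDivisors (Entire V) := by
    constructor
    rintro ⟨f, hf⟩ ⟨g, hg⟩ h
    have h' : ∀ z, f z * g z = 0 := fun z => congrFun (congrArg Subtype.val h) z
    by_cases hz : ∃ z, f z ≠ 0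
    · obtain ⟨z, hz⟩ := hz
      right
      have hc : ContinuousAt f z := (hf z (Set.mem_univ z)).continuousAt
      have hg0 : g = fun _ => 0 := by
        refine AnalyticOnNhd.eq_of_eventuallyEq (𝕜 := ℂ) (z₀ := z) hg analyticOnNhd_const ?_
        filter_upwards [hc.eventually_ne hz] with w hw
        exact (mul_eq_zero.mp (h' w)).resolve_left hw
      exact Subtype.ext hg0
    · left
      push Not at hz
      exact Subtype.ext (funext hz)
  exact NoZeroDivisors.to_isDomain _

variable (V) in
/-- The field of meromorphic functions on the complexification of `V`: on a finite-dimensional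
complex vector space these are the quotients of entire functions. -/
abbrev Mer : Type _ := FractionRing (Entire V)

/-- An entire function, seen as a meromorphic function. -/
def toMer (f : Entire V) : Mer V := algebraMap (Entire V) (Mer V) f

/-- `F` is holomorphic at `z` (that is, `z` is not a pole of `F`) with value `w` there. -/
def HasValueAt (F : Mer V) (z : Cx V) (w : ℂ) : Prop :=
  ∃ a b : Entire V, b.1 z ≠ 0 ∧ F * toMer b = toMer a ∧ w = a.1 z / b.1 z

/-- `z` is a pole of `F` (or a point of indeterminacy). -/
def IsPole (F : Mer V) (z : Cx V) : Prop := ¬ ∃ w, HasValueAt F z w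

open Classical in
/-- The value of a meromorphic function at a point which is not a pole (and `0` at a pole). -/
def valueAt (F : Mer V) (z : Cx V) : ℂ :=
  if h : ∃ w, HasValueAt F z w then h.choose else 0

/-- The linear form `z ↦ ⟨α, z⟩`, as an entire function. -/
def linForm (α : StrongDual ℝ V) : Entire V :=
  ⟨fun z => pair α z, fun z _ => (pair α).analyticAt z⟩

/-- The exponential `z ↦ exp ⟨ξ, z⟩`. -/
def expForm (ξ : StrongDual ℝ V) : Entire V :=
  ⟨fun z => Complex.exp (pair ξ z), fun z _ => ((pair ξ).analyticAt z).cexp⟩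

/-- The shifted exponential `z ↦ exp ⟨ξ, z - p⟩`. -/
def expFormShift (ξ : StrongDual ℝ V) (p : Cx V) : Entire V :=
  ⟨fun z => Complex.exp (pair ξ (z - p)), fun z _ =>
    (AnalyticAt.comp (g := pair ξ) (f := fun z => z - p) ((pair ξ).analyticAt _)
      (analyticAt_id.sub analyticAt_const)).cexp⟩

/-- The substitution `f ↦ (z ↦ f (p - z))` on entire functions. -/
def entireReflect (p : Cx V) : Entire V →+* Entire V where
  toFun f := ⟨fun z => f.1 (p - z), fun z (_ : z ∈ Set.univ) =>
    (f.2 (p - z) (Set.mem_univ _)).comp (analyticAt_const.sub analyticAt_id)⟩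
  map_one' := rfl
  map_mul' _ _ := rfl
  map_zero' := rfl
  map_add' _ _ := rfl

theorem entireReflect_injective (p : Cx V) : Function.Injective (entireReflect p) := by
  intro f g h
  refine Subtype.ext (funext fun z => ?_)
  have h1 := congrFun (congrArg Subtype.val h) (p - z)
  simpa only [entireReflect, RingHom.coe_mk, MonoidHom.coe_mk, OneHom.coe_mk,
    sub_sub_cancel] using h1

/-- The substitution `F ↦ (z ↦ F (p - z))` on meromorphic functions. -/
def reflect (p : Cx V) : Mer V →+* Mer V :=
  IsFractionRing.map (entireReflect_injective p)

/-- The directional derivative `∂_v f` of an entire function. -/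
def entireDeriv (v : Cx V) (f : Entire V) : Entire V :=
  ⟨fun z => fderiv ℂ f.1 z v, fun z hz =>
    ((ContinuousLinearMap.apply ℂ ℂ v).analyticAt (fderiv ℂ f.1 z)).comp
      (AnalyticOnNhd.fderiv f.2 z hz)⟩

/-! ### The ring of exponential fractions and expansions -/

/-- The function `g[α, u] = 1 / (1 - u e^α)`. -/
def geom (α : StrongDual ℝ V) (u : ℂ) : Mer V :=
  (toMer (1 - u • expForm α))⁻¹

/-- The ring `M^{ΓΔ}` of meromorphic functions generated by the functions `c e^ξ`, with `c ∈ ℂ` and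
`ξ ∈ Γ*`, and the functions `1 / (1 - u e^α)` with `α ∈ Δ` and `u ∈ ℂ`, `u ≠ 0`. -/
def expRing (Γ : Submodule ℤ V) (Δ : Finset (StrongDual ℝ V)) : Subalgebra ℂ (Mer V) :=
  Algebra.adjoin ℂ
    ({f | ∃ ξ ∈ dualLattice Γ, f = toMer (expForm ξ)} ∪
      {f | ∃ α ∈ Δ, ∃ u : ℂ, u ≠ 0 ∧ f = geom α u})

/-- The formal series `Θ`, given by its coefficients, is the expansion
`(∑ c_ξ e^ξ) ∏ₖ (∑ₘ uₖ^m e^{m βₖ})` coming from a presentation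
`F = (∑ c_ξ e^ξ) / ∏ₖ (1 - uₖ e^{βₖ})` with `βₖ ∈ Δ`. -/
def IsExpansion (Γ : Submodule ℤ V) (Δ : Finset (StrongDual ℝ V)) (F : Mer V)
    (Θ : dualLattice Γ → ℂ) : Prop :=
  ∃ (c : dualLattice Γ →₀ ℂ) (R : ℕ) (u : Fin R → ℂ) (β : Fin R → StrongDual ℝ V),
    (∀ k, u k ≠ 0 ∧ β k ∈ Δ) ∧
    F = toMer (c.sum fun ξ a => a • expForm (ξ : StrongDual ℝ V)) * ∏ k, geom (β k) (u k) ∧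
    ∀ lam : dualLattice Γ,
      Θ lam = c.sum fun ξ a =>
        ∑ᶠ (m : Fin R → ℕ) (_ : (ξ : StrongDual ℝ V) + ∑ k, m k • β k = lam),
          a * ∏ k, u k ^ m k

open Classical in
/-- The expansion `r⁺(F)`, as the family of its coefficients: `rPlus Γ Δ F lam` is the coefficient
of `e^lam`. -/
def rPlus (Γ : Submodule ℤ V) (Δ : Finset (StrongDual ℝ V)) (F : Mer V) : dualLattice Γ → ℂ :=
  if h : ∃ Θ, IsExpansion Γ Δ F Θ then h.choose else 0

/-- The set `Box(z₀, F)` of those `μ ∈ V*` such that, for every `v ∈ V`, the function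
`s ↦ e^{s⟨μ, v⟩} F(z₀ + s v)` remains bounded as the real number `s` tends to `+∞`. -/
def box (z₀ : Cx V) (F : Mer V) : Set (StrongDual ℝ V) :=
  {μ | ∀ v : V,
    (fun s : ℝ => (Real.exp (s * μ v) : ℂ) * valueAt F (z₀ + (s : ℂ) • ofReal v))
      =O[Filter.atTop] (fun _ : ℝ => (1 : ℝ))}

/-! ### Total residues -/

/-- The ring `R_A` of rational functions with poles along the hyperplanes `α = 0`, `α ∈ Δ`. -/
def ratRing (Δ : Finset (StrongDual ℝ V)) : Subalgebra ℂ (Mer V) :=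
  Algebra.adjoin ℂ
    ({f | ∃ α : StrongDual ℝ V, f = toMer (linForm α)} ∪
      {f | ∃ α ∈ Δ, f = (toMer (linForm α))⁻¹})

/-- The set `B(Δ)` of the subsets of `Δ` that are bases of `V*`. -/
def IsBasisSubset (Δ σ : Finset (StrongDual ℝ V)) : Prop :=
  σ ⊆ Δ ∧ LinearIndependent ℝ (fun α : σ => (α : StrongDual ℝ V)) ∧
    Submodule.span ℝ (σ : Set (StrongDual ℝ V)) = ⊤

/-- The simple fraction `f_σ = 1 / ∏_{α ∈ σ} α`. -/
def simpleFraction (σ : Finset (StrongDual ℝ V)) : Mer V :=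
  ∏ α ∈ σ, (toMer (linForm α))⁻¹

/-- The space `S_A` of simple elements, spanned by the `f_σ` with `σ ∈ B(Δ)`. -/
def simpleSpace (Δ : Finset (StrongDual ℝ V)) : Submodule ℂ (Mer V) :=
  Submodule.span ℂ {f | ∃ σ, IsBasisSubset Δ σ ∧ f = simpleFraction σ}

/-- The simple fraction `f_σ`, `σ ∈ B(Δ)`, as an element of `S_A`. -/
def simpleElt (Δ σ : Finset (StrongDual ℝ V)) (hσ : IsBasisSubset Δ σ) : simpleSpace Δ :=
  ⟨simpleFraction σ, Submodule.subset_span ⟨σ, hσ, rfl⟩⟩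

/-- The space `∑_v ∂_v R_A`, spanned by the derivatives
`∂_v (a / b) = (b ∂_v a - a ∂_v b) / b ^ 2` of the elements `a / b` of `R_A`. -/
def derivSpace (Δ : Finset (StrongDual ℝ V)) : Submodule ℂ (Mer V) :=
  Submodule.span ℂ {f | ∃ (v : Cx V) (a b : Entire V), b ≠ 0 ∧
    toMer a / toMer b ∈ ratRing Δ ∧
    f = toMer (b * entireDeriv v a - a * entireDeriv v b) / toMer b ^ 2}

open Classical in
/-- The total residue on `R_A`: the projection to `S_A` along `∑_v ∂_v R_A`, that is, the element
`s ∈ S_A` with `f - s ∈ ∑_v ∂_v R_A`. -/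
def ratTotalResidue (Δ : Finset (StrongDual ℝ V)) (f : Mer V) : simpleSpace Δ :=
  if h : ∃ s : simpleSpace Δ, f - (s : Mer V) ∈ derivSpace Δ then h.choose else 0

/-- The homogeneous component of degree `k` of the Taylor expansion of `P` at `0`. -/
def homogPart (P : Cx V → ℂ) (k : ℕ) : Entire V :=
  ⟨fun z => ((k.factorial : ℂ))⁻¹ * iteratedFDeriv ℂ k P 0 (fun _ => z), by
    refine AnalyticOnNhd.mul analyticOnNhd_const fun z _ => ?_
    exact AnalyticAt.comp (g := iteratedFDeriv ℂ k P 0) (f := fun z _ => z)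
      (iteratedFDeriv ℂ k P 0).analyticAt
      ((ContinuousLinearMap.pi fun _ : Fin k => ContinuousLinearMap.id ℂ (Cx V)).analyticAt z)⟩

/-- `G` is, near `0`, of the form `P / ∏ᵢ βᵢ`, where `β₁, …, β_R ∈ Δ` and `P = a / b` is holomorphic
near `0`, and `T` is the total residue of `P_{[R-n]} / ∏ᵢ βᵢ`, where `n = dim V` and `P_{[R-n]}` is
the homogeneous component of degree `R - n` of `P` (zero if `R < n`). -/
def IsTotalResidue (Δ : Finset (StrongDual ℝ V)) (G : Mer V) (T : simpleSpace Δ) : Prop :=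
  ∃ (R : ℕ) (β : Fin R → StrongDual ℝ V) (a b : Entire V),
    (∀ i, β i ∈ Δ) ∧ b.1 0 ≠ 0 ∧
    G = (toMer a / toMer b) * ∏ i, (toMer (linForm (β i)))⁻¹ ∧
    ((R < Module.finrank ℝ V ∧ T = 0) ∨
      (Module.finrank ℝ V ≤ R ∧
        T = ratTotalResidue Δ
          (toMer (homogPart (fun z => a.1 z / b.1 z) (R - Module.finrank ℝ V)) *
            ∏ i, (toMer (linForm (β i)))⁻¹)))

open Classical in
/-- The total residue `Tres G ∈ S_A` (at the origin) of a meromorphic function `G` whose polar part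
near the origin lies along the hyperplanes `α = 0`, `α ∈ Δ`. -/
def totalResidue (Δ : Finset (StrongDual ℝ V)) (G : Mer V) : simpleSpace Δ :=
  if h : ∃ T, IsTotalResidue Δ G T then h.choose else 0

/-- `P` is a reduced set of poles of `F`: a finite set of points which are pairwise inequivalent
modulo `2πiΓ` and which represent every point `q` at which some product `F G`, with `G` entire, has
a nonzero total residue.  (The total residue of a function at `q` is read off at `z = 0` from its
composition with `z ↦ q - z`.) -/
structure IsReducedPoles (Γ : Submodule ℤ V) (Δ : Finset (StrongDual ℝ V)) (F : Mer V)
    (P : Finset (Cx V)) : Prop where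
  inequivalent : ∀ p ∈ P, ∀ q ∈ P, (∃ γ ∈ Γ, p - q = period γ) → p = q
  covers : ∀ (q : Cx V) (G : Entire V), totalResidue Δ (reflect q (F * toMer G)) ≠ 0 →
    ∃ p ∈ P, ∃ γ ∈ Γ, q - p = period γ

/-- `s[F, Γ](lam) = ∑_{p ∈ P} Tres (e^{⟨lam, z - p⟩} F(p - z))`, for a reduced set of poles `P`. -/
def residueTransform (Δ : Finset (StrongDual ℝ V)) (F : Mer V) (P : Finset (Cx V))
    (lam : StrongDual ℝ V) : simpleSpace Δ :=
  ∑ p ∈ P, totalResidue Δ (toMer (expFormShift lam p) * reflect p F)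

/-! ### Chambers and the Jeffrey-Kirwan functional -/

/-- The closed cone `C(ν)` generated by a finite set of linear forms. -/
def cone (ν : Finset (StrongDual ℝ V)) : Set (StrongDual ℝ V) :=
  {x | ∃ t : StrongDual ℝ V → ℝ, (∀ α, 0 ≤ t α) ∧ x = ∑ α ∈ ν, t α • α}

/-- The set of singular vectors: the union of the cones generated by fewer than `dim V` elements
of `Δ`. -/
def singularSet (Δ : Finset (StrongDual ℝ V)) : Set (StrongDual ℝ V) :=
  {x | ∃ ν ⊆ Δ, ν.card < Module.finrank ℝ V ∧ x ∈ cone ν}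

/-- A big chamber: a connected component of the set of regular vectors. -/
def IsBigChamber (Δ : Finset (StrongDual ℝ V)) (c : Set (StrongDual ℝ V)) : Prop :=
  ∃ x ∈ (singularSet Δ)ᶜ, c = connectedComponentIn (singularSet Δ)ᶜ x

open Classical in
/-- The Jeffrey-Kirwan functional `f ↦ J⟨c, f⟩_vol` on `S_A`: the linear functional such that, for
`σ ∈ B(Δ)`, `J⟨c, f_σ⟩` is `1 / vol(σ)` if `c ⊆ C(σ)` and `0` otherwise, where `vol(σ)` is the volume
of the parallelepiped `∑_{α ∈ σ} [0, 1] α`. -/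
def jeffreyKirwan (vol : MeasureTheory.Measure (StrongDual ℝ V)) (Δ : Finset (StrongDual ℝ V))
    (c : Set (StrongDual ℝ V)) : simpleSpace Δ →ₗ[ℂ] ℂ :=
  if h : ∃ J : simpleSpace Δ →ₗ[ℂ] ℂ, ∀ (σ : Finset (StrongDual ℝ V)) (hσ : IsBasisSubset Δ σ),
      J (simpleElt Δ σ hσ) =
        if c ⊆ cone σ then
          (((vol (parallelepiped (fun α : σ => (α : StrongDual ℝ V)))).toReal : ℂ))⁻¹
        else 0
  then h.choose else 0

/-- The measure `vol_{Γ*}` on `V*`: the Haar measure that gives volume `1` to the parallelepiped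
spanned by a basis of `Γ*` (the dual basis of a basis of `Γ`). -/
def dualVolume [FiniteDimensional ℝ V] (Γ : Submodule ℤ V) [DiscreteTopology Γ]
    [IsZLattice ℝ Γ] : MeasureTheory.Measure (StrongDual ℝ V) :=
  haveI : Module.Free ℤ Γ := ZLattice.module_free ℝ Γ
  haveI : Module.Finite ℤ Γ := ZLattice.module_finite ℝ Γ
  (((Module.Free.chooseBasis ℤ Γ).ofZLatticeBasis ℝ Γ).dualBasis.map
    LinearMap.toContinuousLinearMap).addHaar

end Basic

end

end JKResidue

/-!
The proof fixes a generic point `x = lam + μ` of the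
chamber, with `μ` in the interior of `Box(F)`, and proves, for all the exponential fractions `G` in
a class that contains `e^{-lam} F`, that the constant coefficient of the expansion of `G` is the sum
of the numbers `J (Tres (G (p - z)))` over the points `p` of the torus `V_ℂ / 2πiΓ`. Here `J` extends
the Jeffrey–Kirwan functional of the chamber to all meromorphic functions, and vanishes on
derivatives.

*The functional.* That the prescription for `J⟨c, f_σ⟩` respects the linear relations between the
`f_σ` modulo derivatives is `relation_of_mem_derivSpace`: on a tube `v₀ + iV`, the function `f_σ` is
`1 / vol σ` times the Fourier transform of `e^{-⟨y, v₀⟩}` on the cone `C(σ)`, and by homogeneity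
(`mem_degenerateSpan_of_scale`) a relation modulo derivatives is a relation modulo fractions whose
denominators do not span. These fractions are polynomial in some direction, so that a product of
difference operators kills them; on the other side of the Fourier transform this is multiplication
by a function that vanishes only on a null set. Hence the relation holds for the weighted indicator
functions of the cones, in particular on the chamber. It follows that there is a linear functional
`J` on meromorphic functions that induces the Jeffrey–Kirwan functional and vanishes on derivatives
(`exists_jeffreyKirwan_extension`). Residues with respect to `J` (`HasRes`) then depend only on the
function, and they vanish on derivatives (`hasRes_merDeriv`).

*The expansion.* The expansion of `F` is the only series with support bounded below in the direction
of `v₀` that is compatible with the fractions that represent `F` (`IsExp.unique`). Therefore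
expansions are linear and commute with derivations, and the functions for which the formula holds
form a space stable under the derivations `∂_v` (`formulaSpace`, `merDeriv_mem_formulaSpace`): for a
derivative both sides are zero.

*The zonotope.* If `F = (∑ c_ξ e^ξ) / ∏ (1 - u_k e^{β_k})` and `μ ∈ Box(F)`, then the growth of `F`
along generic rays shows that `μ + ξ` lies in the zonotope `∑ [0, 1] β_k` whenever `c_ξ ≠ 0`
(`mem_zonotope_of_mem_box`).

*Reduction to simple fractions.* It remains to treat one fraction `e^η / ∏ (1 - u_k e^{β_k})` for which
`x + η` lies in the zonotope. A linear relation between the `β_k` with integral coefficients makes it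
possible to lower the number of factors, or to replace factors by copies of a preferred one; the
point stays in the zonotope if the factors are telescoped in the order of their coefficients
(`exists_telescoping`, `ZonotopeMem.of_erase`, `ZonotopeMem.of_update`). When the remaining exponents
are independent, differentiation lowers the multiplicities to one (`mem_of_subset_of_deriv`).
Genericity of `x` forces the exponents to form a basis, with coefficients strictly between `0` and
`1`. This is `IsGeneric.zonotopeMem`.

*Simple fractions.* For `e^η / ∏_{α ∈ σ} (1 - U_α e^{Mα})` with `σ` a basis, the points where
the residue does not vanish for trivial reasons form a coset of a finite subgroup of the torus, of order `M^n vol σ`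
(`card_range_torusHom`). If `-η = ∑ l_α M α` with integral `l_α`, then all the residues are equal, and
`x` lies in `C(σ)` exactly when all the `l_α` are nonnegative, because the coefficients of `x + η` lie
in `(0, 1)`; both sides are `∏ U_α^{l_α}` in this case, and `0` otherwise. If `-η` is not of this form,
then `e^η` is a nontrivial character of the subgroup, up to a factor, and both sides vanish
(`hasSimpleFractions_formulaSpace`).
-/

namespace JKResidue

noncomputable section

/-! ### Meromorphic functions: values, derivations, substitutions -/

section MerBasics

variable {V : Type*} [NormedAddCommGroup V] [NormedSpace ℝ V]

/-! Shortcuts that spare instance search from unfolding the field of fractions. -/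

scoped instance : CommRing (Entire V) := inferInstance

scoped instance : SMul ℂ (Entire V) := inferInstance

scoped instance : Module ℂ (Entire V) := inferInstance

scoped instance : Field (Mer V) := inferInstance

scoped instance : DivisionRing (Mer V) := inferInstance

scoped instance : CommRing (Mer V) := inferInstance

scoped instance : Ring (Mer V) := inferInstance

scoped instance : CommSemiring (Mer V) := inferInstance

scoped instance : Semiring (Mer V) := inferInstance

scoped instance : Algebra ℂ (Mer V) := inferInstance

scoped instance : Module ℂ (Mer V) := inferInstance

scoped instance : SMul ℂ (Mer V) := inferInstance

scoped instance : AddCommGroup (Mer V) := inferInstance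

scoped instance : AddGroup (Mer V) := inferInstance

scoped instance : AddCommMonoid (Mer V) := inferInstance

scoped instance : AddMonoid (Mer V) := inferInstance

scoped instance : CommMonoid (Mer V) := inferInstance

scoped instance : Monoid (Mer V) := inferInstance

scoped instance : MonoidWithZero (Mer V) := inferInstance

scoped instance : DistribMulAction ℂ (Mer V) := inferInstance

scoped instance : MulAction ℂ (Mer V) := inferInstance

scoped instance : Mul (Mer V) := inferInstance

scoped instance : Add (Mer V) := inferInstance

scoped instance : Sub (Mer V) := inferInstance

scoped instance : Neg (Mer V) := inferInstance

scoped instance : Div (Mer V) := inferInstance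

scoped instance : Inv (Mer V) := inferInstance

scoped instance : Nontrivial (Mer V) := inferInstance

scoped instance : IsDomain (Entire V) := inferInstance

scoped instance : NoZeroDivisors (Entire V) := inferInstance

scoped instance : Ring (Entire V) := inferInstance

scoped instance : AddCommGroup (Entire V) := inferInstance

scoped instance : AddCommMonoid (Entire V) := inferInstance

scoped instance : AddMonoid (Entire V) := inferInstance

scoped instance : DistribMulAction ℂ (Entire V) := inferInstance

scoped instance : Algebra ℂ (Entire V) := inferInstance

scoped instance : GroupWithZero (Mer V) := inferInstance

scoped instance : CommGroupWithZero (Mer V) := inferInstance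

scoped instance : DivisionMonoid (Mer V) := inferInstance

scoped instance : DivisionCommMonoid (Mer V) := inferInstance

scoped instance : DivInvMonoid (Mer V) := inferInstance

scoped instance : DivInvOneMonoid (Mer V) := inferInstance

scoped instance : IsReduced (Mer V) := inferInstance

scoped instance : Algebra (Entire V) (Mer V) := inferInstance

scoped instance : CharZero (Mer V) :=
  charZero_of_injective_algebraMap (algebraMap ℂ (Mer V)).injective

theorem toMer_add (f g : Entire V) : toMer (f + g) = toMer f + toMer g := map_add _ _ _

theorem toMer_sub (f g : Entire V) : toMer (f - g) = toMer f - toMer g := map_sub _ _ _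

theorem toMer_neg (f : Entire V) : toMer (-f) = -toMer f := map_neg _ _

theorem toMer_mul (f g : Entire V) : toMer (f * g) = toMer f * toMer g := map_mul _ _ _

theorem toMer_one : toMer (1 : Entire V) = 1 := map_one _

theorem toMer_zero : toMer (0 : Entire V) = 0 := map_zero _

theorem toMer_pow (f : Entire V) (k : ℕ) : toMer (f ^ k) = toMer f ^ k := map_pow _ _ _

theorem toMer_smul (c : ℂ) (f : Entire V) : toMer (c • f) = c • toMer f := by
  simp only [toMer, Algebra.smul_def, map_mul]
  rw [← IsScalarTower.algebraMap_apply]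

theorem toMer_prod {ι : Type*} (s : Finset ι) (f : ι → Entire V) :
    toMer (∏ i ∈ s, f i) = ∏ i ∈ s, toMer (f i) := map_prod _ _ _

theorem toMer_sum {ι : Type*} (s : Finset ι) (f : ι → Entire V) :
    toMer (∑ i ∈ s, f i) = ∑ i ∈ s, toMer (f i) := map_sum _ _ _

theorem toMer_injective : Function.Injective (toMer : Entire V → Mer V) :=
  IsFractionRing.injective (Entire V) (Mer V)

theorem toMer_ne_zero {f : Entire V} (hf : f ≠ 0) : toMer f ≠ 0 := by
  rw [← toMer_zero]; exact fun h => hf (toMer_injective h)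

theorem entire_ne_zero_of_apply {f : Entire V} {z : Cx V} (h : f.1 z ≠ 0) : f ≠ 0 := by
  rintro rfl; exact h rfl

/-- Every meromorphic function is a quotient of entire functions. -/
theorem exists_toMer_div (F : Mer V) : ∃ a b : Entire V, b ≠ 0 ∧ F = toMer a / toMer b := by
  obtain ⟨a, b, hb, h⟩ := IsFractionRing.div_surjective (A := Entire V) F
  exact ⟨a, b, nonZeroDivisors.ne_zero hb, h.symm⟩

theorem HasValueAt.unique {F : Mer V} {z : Cx V} {w w' : ℂ} (h : HasValueAt F z w)
    (h' : HasValueAt F z w') : w = w' := by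
  obtain ⟨a, b, hb, hF, rfl⟩ := h
  obtain ⟨a', b', hb', hF', rfl⟩ := h'
  have h1 : a * b' = a' * b := by
    apply toMer_injective
    rw [toMer_mul, toMer_mul, ← hF, ← hF']; ring
  have h2 : a.1 z * b'.1 z = a'.1 z * b.1 z := congrFun (congrArg Subtype.val h1) z
  rw [div_eq_div_iff hb hb', h2]

theorem hasValueAt_toMer (f : Entire V) (z : Cx V) : HasValueAt (toMer f) z (f.1 z) :=
  ⟨f, 1, one_ne_zero, by rw [toMer_one, mul_one], (div_one _).symm⟩

theorem HasValueAt.add {F G : Mer V} {z : Cx V} {w w' : ℂ} (h : HasValueAt F z w)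
    (h' : HasValueAt G z w') : HasValueAt (F + G) z (w + w') := by
  obtain ⟨a, b, hb, hF, rfl⟩ := h
  obtain ⟨a', b', hb', hF', rfl⟩ := h'
  refine ⟨a * b' + a' * b, b * b', mul_ne_zero hb hb', ?_, ?_⟩
  · simp only [toMer_add, toMer_mul, ← hF, ← hF']; ring
  · change _ = (a.1 z * b'.1 z + a'.1 z * b.1 z) / (b.1 z * b'.1 z)
    field_simp

theorem HasValueAt.mul {F G : Mer V} {z : Cx V} {w w' : ℂ} (h : HasValueAt F z w)
    (h' : HasValueAt G z w') : HasValueAt (F * G) z (w * w') := by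
  obtain ⟨a, b, hb, hF, rfl⟩ := h
  obtain ⟨a', b', hb', hF', rfl⟩ := h'
  refine ⟨a * a', b * b', mul_ne_zero hb hb', ?_, ?_⟩
  · simp only [toMer_mul, ← hF, ← hF']; ring
  · change _ = (a.1 z * a'.1 z) / (b.1 z * b'.1 z)
    field_simp

theorem HasValueAt.smul {F : Mer V} {z : Cx V} {w : ℂ} (c : ℂ) (h : HasValueAt F z w) :
    HasValueAt (c • F) z (c * w) := by
  obtain ⟨a, b, hb, hF, rfl⟩ := h
  refine ⟨c • a, b, hb, ?_, ?_⟩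
  · rw [toMer_smul, ← hF, smul_mul_assoc]
  · change _ = (c * a.1 z) / b.1 z
    ring

theorem hasValueAt_inv_toMer {f : Entire V} {z : Cx V} (hf : f.1 z ≠ 0) :
    HasValueAt (toMer f)⁻¹ z (f.1 z)⁻¹ :=
  ⟨1, f, hf, by rw [toMer_one, inv_mul_cancel₀ (toMer_ne_zero (entire_ne_zero_of_apply hf))],
    (one_div _).symm⟩

theorem HasValueAt.valueAt_eq {F : Mer V} {z : Cx V} {w : ℂ} (h : HasValueAt F z w) :
    valueAt F z = w := by
  have h' : ∃ w, HasValueAt F z w := ⟨w, h⟩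
  unfold valueAt
  rw [dif_pos h']
  exact h'.choose_spec.unique h

theorem hasValueAt_finset_sum {ι : Type*} (s : Finset ι) {F : ι → Mer V} {z : Cx V} {w : ι → ℂ}
    (h : ∀ i ∈ s, HasValueAt (F i) z (w i)) : HasValueAt (∑ i ∈ s, F i) z (∑ i ∈ s, w i) := by
  classical
  induction s using Finset.induction_on with
  | empty => simpa [toMer_zero] using hasValueAt_toMer (0 : Entire V) z
  | insert a s ha ih =>
    rw [Finset.sum_insert ha, Finset.sum_insert ha]
    exact (h a (Finset.mem_insert_self a s)).add
      (ih fun i hi => h i (Finset.mem_insert_of_mem hi))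

theorem hasValueAt_finset_prod {ι : Type*} (s : Finset ι) {F : ι → Mer V} {z : Cx V} {w : ι → ℂ}
    (h : ∀ i ∈ s, HasValueAt (F i) z (w i)) : HasValueAt (∏ i ∈ s, F i) z (∏ i ∈ s, w i) := by
  classical
  induction s using Finset.induction_on with
  | empty => simpa [toMer_one] using hasValueAt_toMer (1 : Entire V) z
  | insert a s ha ih =>
    rw [Finset.prod_insert ha, Finset.prod_insert ha]
    exact (h a (Finset.mem_insert_self a s)).mul
      (ih fun i hi => h i (Finset.mem_insert_of_mem hi))

theorem entireDeriv_add (v : Cx V) (f g : Entire V) :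
    entireDeriv v (f + g) = entireDeriv v f + entireDeriv v g := by
  refine Subtype.ext (funext fun z => ?_)
  change fderiv ℂ (f.1 + g.1) z v = fderiv ℂ f.1 z v + fderiv ℂ g.1 z v
  rw [fderiv_add (f.2 z trivial).differentiableAt (g.2 z trivial).differentiableAt]
  rfl

theorem entireDeriv_mul (v : Cx V) (f g : Entire V) :
    entireDeriv v (f * g) = f * entireDeriv v g + g * entireDeriv v f := by
  refine Subtype.ext (funext fun z => ?_)
  change fderiv ℂ (f.1 * g.1) z v = f.1 z * fderiv ℂ g.1 z v + g.1 z * fderiv ℂ f.1 z v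
  rw [fderiv_mul (f.2 z trivial).differentiableAt (g.2 z trivial).differentiableAt]
  rfl

theorem entireDeriv_smul (v : Cx V) (c : ℂ) (f : Entire V) :
    entireDeriv v (c • f) = c • entireDeriv v f := by
  refine Subtype.ext (funext fun z => ?_)
  change fderiv ℂ (c • f.1) z v = c * fderiv ℂ f.1 z v
  rw [fderiv_const_smul (f.2 z trivial).differentiableAt]
  rfl

theorem entireDeriv_one (v : Cx V) : entireDeriv v (1 : Entire V) = 0 := by
  have h := entireDeriv_mul v (1 : Entire V) 1
  simpa using h

theorem entireDeriv_linForm (v : Cx V) (α : StrongDual ℝ V) :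
    entireDeriv v (linForm α) = pair α v • 1 := by
  refine Subtype.ext (funext fun z => ?_)
  change fderiv ℂ (fun z => pair α z) z v = pair α v * 1
  rw [(pair α).hasFDerivAt.fderiv, mul_one]

theorem entireDeriv_expForm (v : Cx V) (ξ : StrongDual ℝ V) :
    entireDeriv v (expForm ξ) = pair ξ v • expForm ξ := by
  refine Subtype.ext (funext fun z => ?_)
  change fderiv ℂ (fun z => Complex.exp (pair ξ z)) z v = pair ξ v * Complex.exp (pair ξ z)
  rw [((pair ξ).hasFDerivAt.cexp).fderiv]
  simp [mul_comm]

/-- The numerator of the derivative of a quotient, divided by the square of the denominator, does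
not depend on the choice of the quotient. -/
theorem quotient_deriv_congr (v : Cx V) {a b a' b' : Entire V} (hb : b ≠ 0) (hb' : b' ≠ 0)
    (h : toMer a / toMer b = toMer a' / toMer b') :
    toMer (b * entireDeriv v a - a * entireDeriv v b) / toMer b ^ 2 =
      toMer (b' * entireDeriv v a' - a' * entireDeriv v b') / toMer b' ^ 2 := by
  have h0 := toMer_ne_zero hb
  have h0' := toMer_ne_zero hb'
  rw [div_eq_div_iff h0 h0', ← toMer_mul, ← toMer_mul] at h
  have h1 := toMer_injective h
  have h2 : entireDeriv v (a * b') = entireDeriv v (a' * b) := by rw [h1]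
  rw [entireDeriv_mul, entireDeriv_mul] at h2
  rw [div_eq_div_iff (pow_ne_zero 2 h0) (pow_ne_zero 2 h0'), ← toMer_pow, ← toMer_pow,
    ← toMer_mul, ← toMer_mul]
  congr 1
  linear_combination (b * b') * h2 - (entireDeriv v b * b' + entireDeriv v b' * b) * h1

/-- The directional derivative `∂_v` on meromorphic functions. -/
def merDeriv (v : Cx V) (F : Mer V) : Mer V :=
  let a := (exists_toMer_div F).choose
  let b := (exists_toMer_div F).choose_spec.choose
  toMer (b * entireDeriv v a - a * entireDeriv v b) / toMer b ^ 2

theorem merDeriv_div (v : Cx V) (a : Entire V) {b : Entire V} (hb : b ≠ 0) :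
    merDeriv v (toMer a / toMer b) =
      toMer (b * entireDeriv v a - a * entireDeriv v b) / toMer b ^ 2 := by
  obtain ⟨h1, h2⟩ := (exists_toMer_div (toMer a / toMer b)).choose_spec.choose_spec
  exact quotient_deriv_congr v h1 hb h2.symm

theorem merDeriv_toMer (v : Cx V) (a : Entire V) :
    merDeriv v (toMer a) = toMer (entireDeriv v a) := by
  have h := merDeriv_div v a (one_ne_zero (α := Entire V))
  simpa [toMer_one, entireDeriv_one] using h

theorem merDeriv_add (v : Cx V) (F G : Mer V) :
    merDeriv v (F + G) = merDeriv v F + merDeriv v G := by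
  obtain ⟨a, b, hb, rfl⟩ := exists_toMer_div F
  obtain ⟨a', b', hb', rfl⟩ := exists_toMer_div G
  have h0 := toMer_ne_zero hb
  have h0' := toMer_ne_zero hb'
  have h : toMer a / toMer b + toMer a' / toMer b' = toMer (a * b' + b * a') / toMer (b * b') := by
    rw [toMer_add, toMer_mul, toMer_mul, toMer_mul, div_add_div _ _ h0 h0']
  rw [h, merDeriv_div v _ (mul_ne_zero hb hb'), merDeriv_div v _ hb, merDeriv_div v _ hb']
  simp only [entireDeriv_add, entireDeriv_mul, toMer_add, toMer_mul, toMer_sub]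
  field_simp
  ring

theorem merDeriv_mul (v : Cx V) (F G : Mer V) :
    merDeriv v (F * G) = F * merDeriv v G + G * merDeriv v F := by
  obtain ⟨a, b, hb, rfl⟩ := exists_toMer_div F
  obtain ⟨a', b', hb', rfl⟩ := exists_toMer_div G
  have h0 := toMer_ne_zero hb
  have h0' := toMer_ne_zero hb'
  have h : toMer a / toMer b * (toMer a' / toMer b') = toMer (a * a') / toMer (b * b') := by
    rw [toMer_mul, toMer_mul, div_mul_div_comm]
  rw [h, merDeriv_div v _ (mul_ne_zero hb hb'), merDeriv_div v _ hb, merDeriv_div v _ hb']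
  simp only [entireDeriv_mul, toMer_add, toMer_mul, toMer_sub]
  field_simp
  ring

theorem merDeriv_smul (v : Cx V) (c : ℂ) (F : Mer V) :
    merDeriv v (c • F) = c • merDeriv v F := by
  have hc : ∀ G : Mer V, c • G = toMer (c • (1 : Entire V)) * G := fun G => by
    rw [toMer_smul, toMer_one, smul_mul_assoc, one_mul]
  have h0 : entireDeriv v (c • (1 : Entire V)) = 0 := by
    rw [entireDeriv_smul, entireDeriv_one, smul_zero]
  rw [hc F, merDeriv_mul, merDeriv_toMer, h0, toMer_zero, mul_zero, add_zero, ← hc]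

/-- The directional derivative as a linear map. -/
def merDerivₗ (v : Cx V) : Mer V →ₗ[ℂ] Mer V where
  toFun := merDeriv v
  map_add' := merDeriv_add v
  map_smul' := merDeriv_smul v

theorem merDeriv_inv (v : Cx V) {F : Mer V} (hF : F ≠ 0) :
    merDeriv v F⁻¹ = -(merDeriv v F) * (F⁻¹) ^ 2 := by
  have h : merDeriv v (F * F⁻¹) = 0 := by
    rw [mul_inv_cancel₀ hF, ← toMer_one, merDeriv_toMer, entireDeriv_one, toMer_zero]
  rw [merDeriv_mul] at h
  have h2 : F⁻¹ * (F * merDeriv v F⁻¹ + F⁻¹ * merDeriv v F) = 0 := by rw [h, mul_zero]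
  rw [mul_add, ← mul_assoc, inv_mul_cancel₀ hF, one_mul] at h2
  linear_combination h2

theorem expForm_add (ξ η : StrongDual ℝ V) : expForm (ξ + η) = expForm ξ * expForm η := by
  refine Subtype.ext (funext fun z => ?_)
  change Complex.exp (pair (ξ + η) z) = Complex.exp (pair ξ z) * Complex.exp (pair η z)
  rw [← Complex.exp_add]
  congr 1
  exact map_add (show StrongDual ℝ V →L[ℝ] ℂ from z) ξ η

theorem expForm_zero : expForm (0 : StrongDual ℝ V) = 1 := by
  refine Subtype.ext (funext fun z => ?_)
  change Complex.exp (pair 0 z) = 1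
  have : pair (0 : StrongDual ℝ V) z = 0 := map_zero (show StrongDual ℝ V →L[ℝ] ℂ from z)
  rw [this, Complex.exp_zero]

theorem pair_add (α β : StrongDual ℝ V) (z : Cx V) : pair (α + β) z = pair α z + pair β z :=
  map_add (show StrongDual ℝ V →L[ℝ] ℂ from z) α β

theorem pair_zero (z : Cx V) : pair (0 : StrongDual ℝ V) z = 0 :=
  map_zero (show StrongDual ℝ V →L[ℝ] ℂ from z)

theorem pair_neg (α : StrongDual ℝ V) (z : Cx V) : pair (-α) z = -pair α z :=
  map_neg (show StrongDual ℝ V →L[ℝ] ℂ from z) α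

theorem pair_sub (α β : StrongDual ℝ V) (z : Cx V) : pair (α - β) z = pair α z - pair β z :=
  map_sub (show StrongDual ℝ V →L[ℝ] ℂ from z) α β

theorem pair_smul (c : ℝ) (α : StrongDual ℝ V) (z : Cx V) : pair (c • α) z = c * pair α z := by
  have := map_smul (show StrongDual ℝ V →L[ℝ] ℂ from z) c α
  rw [Complex.real_smul] at this
  exact this

theorem pair_zsmul (m : ℤ) (α : StrongDual ℝ V) (z : Cx V) : pair (m • α) z = m * pair α z := by
  have := map_zsmul (show StrongDual ℝ V →L[ℝ] ℂ from z) m α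
  rw [zsmul_eq_mul] at this
  exact this

theorem pair_sum {ι : Type*} (s : Finset ι) (α : ι → StrongDual ℝ V) (z : Cx V) :
    pair (∑ i ∈ s, α i) z = ∑ i ∈ s, pair (α i) z :=
  map_sum (show StrongDual ℝ V →L[ℝ] ℂ from z) α s

theorem Cx.ext {z w : Cx V} (h : ∀ α : StrongDual ℝ V, pair α z = pair α w) : z = w :=
  ContinuousLinearMap.ext (f := (show StrongDual ℝ V →L[ℝ] ℂ from z))
    (g := (show StrongDual ℝ V →L[ℝ] ℂ from w)) h

theorem ofReal_add (v w : V) : ofReal (v + w) = ofReal v + ofReal w :=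
  Cx.ext fun α => by simp [pair_ofReal]

theorem linForm_ne_zero {α : StrongDual ℝ V} (h : α ≠ 0) : linForm α ≠ 0 := by
  obtain ⟨v, hv⟩ : ∃ v, α v ≠ 0 := by
    by_contra! h'
    exact h (ContinuousLinearMap.ext h')
  refine entire_ne_zero_of_apply (z := ofReal v) ?_
  change pair α (ofReal v) ≠ 0
  rw [pair_ofReal]
  exact_mod_cast hv

theorem linForm_add (α β : StrongDual ℝ V) : linForm (α + β) = linForm α + linForm β :=
  Subtype.ext (funext fun z => pair_add α β z)

theorem linForm_zero : linForm (0 : StrongDual ℝ V) = 0 :=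
  Subtype.ext (funext fun z => pair_zero z)

theorem linForm_smul (c : ℝ) (α : StrongDual ℝ V) : linForm (c • α) = (c : ℂ) • linForm α :=
  Subtype.ext (funext fun z => pair_smul c α z)

theorem linForm_sum {ι : Type*} (s : Finset ι) (α : ι → StrongDual ℝ V) :
    linForm (∑ i ∈ s, α i) = ∑ i ∈ s, linForm (α i) := by
  classical
  induction s using Finset.induction_on with
  | empty => simp [linForm_zero]
  | insert a s ha ih => rw [Finset.sum_insert ha, Finset.sum_insert ha, linForm_add, ih]

theorem reflect_toMer (p : Cx V) (f : Entire V) :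
    reflect p (toMer f) = toMer (entireReflect p f) :=
  IsLocalization.map_eq (nonZeroDivisors_le_comap_nonZeroDivisors_of_injective _
    (entireReflect_injective p)) f

theorem entireReflect_apply (p : Cx V) (f : Entire V) (z : Cx V) :
    (entireReflect p f).1 z = f.1 (p - z) := rfl

theorem reflect_smul (p : Cx V) (c : ℂ) (F : Mer V) : reflect p (c • F) = c • reflect p F := by
  have h1 : ∀ G : Mer V, c • G = toMer (c • (1 : Entire V)) * G := fun G => by
    rw [toMer_smul, toMer_one, smul_mul_assoc, one_mul]
  rw [h1 F, map_mul, reflect_toMer, h1 (reflect p F)]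
  rfl

theorem entireReflect_ne_zero (p : Cx V) {f : Entire V} (hf : f ≠ 0) : entireReflect p f ≠ 0 := by
  rw [← map_zero (entireReflect p)]
  exact fun h => hf (entireReflect_injective p h)

theorem entireDeriv_entireReflect (v p : Cx V) (f : Entire V) :
    entireDeriv v (entireReflect p f) = -entireReflect p (entireDeriv v f) := by
  refine Subtype.ext (funext fun z => ?_)
  change fderiv ℂ (fun z => f.1 (p - z)) z v = -(fderiv ℂ f.1 (p - z) v)
  have h1 : HasFDerivAt (fun z : Cx V => p - z) (-(ContinuousLinearMap.id ℂ (Cx V))) z :=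
    (hasFDerivAt_id z).const_sub p
  have h2 := ((f.2 (p - z) trivial).differentiableAt.hasFDerivAt).comp z h1
  have h3 : fderiv ℂ (fun z => f.1 (p - z)) z = _ := h2.fderiv
  rw [h3]
  simp

theorem merDeriv_reflect (v p : Cx V) (F : Mer V) :
    merDeriv v (reflect p F) = -reflect p (merDeriv v F) := by
  obtain ⟨a, b, hb, rfl⟩ := exists_toMer_div F
  rw [merDeriv_div v a hb, map_div₀, map_div₀, map_pow, reflect_toMer, reflect_toMer,
    reflect_toMer, merDeriv_div v _ (entireReflect_ne_zero p hb), ← neg_div, ← toMer_neg]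
  congr 2
  simp only [entireDeriv_entireReflect, map_sub, map_mul]
  ring

end MerBasics

/-! ### Rational functions with poles along the arrangement -/

section Rational

variable {V : Type*} [NormedAddCommGroup V] [NormedSpace ℝ V]

/-- The product of the linear forms in a multiset. -/
def linProd (a : Multiset (StrongDual ℝ V)) : Entire V := (a.map linForm).prod

theorem linProd_zero : linProd (0 : Multiset (StrongDual ℝ V)) = 1 := by simp [linProd]

theorem linProd_cons (L : StrongDual ℝ V) (a : Multiset (StrongDual ℝ V)) :
    linProd (L ::ₘ a) = linForm L * linProd a := by simp [linProd]

theorem linProd_add (a b : Multiset (StrongDual ℝ V)) :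
    linProd (a + b) = linProd a * linProd b := by simp [linProd]

theorem linProd_ne_zero {a : Multiset (StrongDual ℝ V)} (h : (0 : StrongDual ℝ V) ∉ a) :
    linProd a ≠ 0 := by
  induction a using Multiset.induction_on with
  | empty => rw [linProd_zero]; exact one_ne_zero
  | cons L a ih =>
    rw [Multiset.mem_cons, not_or] at h
    rw [linProd_cons]
    exact mul_ne_zero (linForm_ne_zero (Ne.symm h.1)) (ih h.2)

/-- The quotient of the product of the forms in `a` by the product of the forms in `s`. -/
def linQuot (a s : Multiset (StrongDual ℝ V)) : Mer V := toMer (linProd a) / toMer (linProd s)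

theorem linQuot_cons_left (L : StrongDual ℝ V) (a s : Multiset (StrongDual ℝ V)) :
    linQuot (L ::ₘ a) s = toMer (linForm L) * linQuot a s := by
  rw [linQuot, linProd_cons, toMer_mul, linQuot, mul_div_assoc]

theorem linQuot_cons_right (β : StrongDual ℝ V) (a s : Multiset (StrongDual ℝ V)) :
    linQuot a (β ::ₘ s) = (toMer (linForm β))⁻¹ * linQuot a s := by
  rw [linQuot, linProd_cons, toMer_mul, linQuot, div_mul_eq_div_div, div_right_comm, inv_mul_eq_div]

theorem linQuot_zero_zero : linQuot (0 : Multiset (StrongDual ℝ V)) 0 = 1 := by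
  rw [linQuot, linProd_zero, toMer_one, div_one]

theorem linQuot_mul (a s a' s' : Multiset (StrongDual ℝ V)) :
    linQuot a s * linQuot a' s' = linQuot (a + a') (s + s') := by
  simp only [linQuot, linProd_add, toMer_mul, div_mul_div_comm]

theorem linForm_mul_linQuot [DecidableEq (StrongDual ℝ V)] {α : StrongDual ℝ V} (hα : α ≠ 0)
    (a : Multiset (StrongDual ℝ V)) {s : Multiset (StrongDual ℝ V)} (h : α ∈ s) :
    toMer (linForm α) * linQuot a s = linQuot a (s.erase α) := by
  conv_lhs => rw [← Multiset.cons_erase h, linQuot_cons_right]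
  rw [mul_inv_cancel_left₀ (toMer_ne_zero (linForm_ne_zero hα))]

/-- The polynomial functions, spanned by the products of linear forms. -/
def polySpan (V : Type*) [NormedAddCommGroup V] [NormedSpace ℝ V] : Submodule ℂ (Entire V) :=
  Submodule.span ℂ (Set.range linProd)

theorem linProd_mem_polySpan (a : Multiset (StrongDual ℝ V)) : linProd a ∈ polySpan V :=
  Submodule.subset_span ⟨a, rfl⟩

theorem linForm_mul_mem_polySpan (L : StrongDual ℝ V) {f : Entire V} (hf : f ∈ polySpan V) :
    linForm L * f ∈ polySpan V := by
  induction hf using Submodule.span_induction with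
  | mem x hx =>
    obtain ⟨a, rfl⟩ := hx
    rw [← linProd_cons]; exact linProd_mem_polySpan _
  | zero => rw [mul_zero]; exact zero_mem _
  | add x y _ _ hx hy => rw [mul_add]; exact add_mem hx hy
  | smul c x _ hx => rw [mul_smul_comm]; exact Submodule.smul_mem _ c hx

theorem entireDeriv_mem_polySpan (v : Cx V) {f : Entire V} (hf : f ∈ polySpan V) :
    entireDeriv v f ∈ polySpan V := by
  induction hf using Submodule.span_induction with
  | mem x hx =>
    obtain ⟨a, rfl⟩ := hx
    induction a using Multiset.induction_on with
    | empty => rw [linProd_zero, entireDeriv_one]; exact zero_mem _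
    | cons L a ih =>
      rw [linProd_cons, entireDeriv_mul, entireDeriv_linForm, mul_smul_comm, mul_one]
      exact add_mem (linForm_mul_mem_polySpan L ih)
        (Submodule.smul_mem _ _ (linProd_mem_polySpan a))
  | zero =>
    have h := entireDeriv_smul v 0 (0 : Entire V)
    rw [zero_smul, zero_smul] at h
    rw [h]; exact zero_mem _
  | add x y _ _ hx hy => rw [entireDeriv_add]; exact add_mem hx hy
  | smul c x _ hx => rw [entireDeriv_smul]; exact Submodule.smul_mem _ c hx

/-- A product of linear forms has a polynomial antiderivative in every nonzero real direction. The
powers of a form `ℓ` with `ℓ v = 1` carry the induction. -/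
theorem exists_antideriv_linProd {v : V} {ℓ : StrongDual ℝ V} (hℓ : ℓ v = 1)
    (a : Multiset (StrongDual ℝ V)) (j : ℕ) :
    ∃ f ∈ polySpan V, entireDeriv (ofReal v) f = linProd a * linForm ℓ ^ j := by
  induction a using Multiset.induction_on generalizing j with
  | empty =>
    have hd : ∀ k : ℕ, linForm ℓ ^ k ∈ polySpan V ∧
        entireDeriv (ofReal v) (linForm ℓ ^ (k + 1)) = ((k : ℂ) + 1) • linForm ℓ ^ k := by
      have h1 : entireDeriv (ofReal v) (linForm ℓ) = 1 := by
        rw [entireDeriv_linForm, pair_ofReal, hℓ, Complex.ofReal_one, one_smul]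
      intro k
      induction k with
      | zero =>
        refine ⟨?_, by simp [h1]⟩
        rw [pow_zero, ← linProd_zero]; exact linProd_mem_polySpan 0
      | succ k ih =>
        refine ⟨?_, ?_⟩
        · rw [pow_succ']; exact linForm_mul_mem_polySpan ℓ ih.1
        · rw [pow_succ', entireDeriv_mul, ih.2, h1, mul_one, mul_smul_comm, ← pow_succ']
          push_cast
          module
    refine ⟨((j : ℂ) + 1)⁻¹ • linForm ℓ ^ (j + 1), Submodule.smul_mem _ _ (hd (j + 1)).1, ?_⟩
    rw [entireDeriv_smul, (hd j).2, smul_smul, inv_mul_cancel₀ (Nat.cast_add_one_ne_zero j),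
      one_smul, linProd_zero, one_mul]
  | cons L a ih =>
    obtain ⟨f, hf, hf'⟩ := ih j
    obtain ⟨g, hg, hg'⟩ := ih (j + 1)
    have hL : linForm L = linForm (L - (L v) • ℓ) + ((L v : ℝ) : ℂ) • linForm ℓ := by
      rw [← linForm_smul, ← linForm_add, sub_add_cancel]
    have h0 : entireDeriv (ofReal v) (linForm (L - (L v) • ℓ)) = 0 := by
      rw [entireDeriv_linForm, pair_ofReal]
      simp [hℓ]
    refine ⟨linForm (L - (L v) • ℓ) * f + ((L v : ℝ) : ℂ) • g,
      add_mem (linForm_mul_mem_polySpan _ hf) (Submodule.smul_mem _ _ hg), ?_⟩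
    rw [entireDeriv_add, entireDeriv_mul, h0, mul_zero, add_zero, entireDeriv_smul, hf', hg',
      linProd_cons]
    conv_rhs => rw [hL]
    rw [add_mul, add_mul, smul_mul_assoc, smul_mul_assoc, pow_succ']
    congr 1
    · ring
    · congr 1; ring

theorem exists_antideriv_polySpan {v : V} (hv : v ≠ 0) {f : Entire V} (hf : f ∈ polySpan V) :
    ∃ g ∈ polySpan V, entireDeriv (ofReal v) g = f := by
  obtain ⟨ℓ, hℓ⟩ : ∃ ℓ : StrongDual ℝ V, ℓ v = 1 := SeparatingDual.exists_eq_one hv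
  induction hf using Submodule.span_induction with
  | mem x hx =>
    obtain ⟨a, rfl⟩ := hx
    simpa using exists_antideriv_linProd hℓ a 0
  | zero =>
    refine ⟨0, zero_mem _, ?_⟩
    have h := entireDeriv_smul (ofReal v) 0 (0 : Entire V)
    rwa [zero_smul, zero_smul] at h
  | add x y _ _ hx hy =>
    obtain ⟨f, hf, rfl⟩ := hx
    obtain ⟨g, hg, rfl⟩ := hy
    exact ⟨f + g, add_mem hf hg, entireDeriv_add _ _ _⟩
  | smul c x _ hx =>
    obtain ⟨f, hf, rfl⟩ := hx
    exact ⟨c • f, Submodule.smul_mem _ c hf, entireDeriv_smul _ _ _⟩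

/-- The span of the inverse products whose factors run exactly over a basis, with multiplicities,
and have at least `k` factors. -/
def basicSpan (Δ : Finset (StrongDual ℝ V)) (k : ℕ) : Submodule ℂ (Mer V) :=
  Submodule.span ℂ {f | ∃ (σ : Finset (StrongDual ℝ V)) (s : Multiset (StrongDual ℝ V)),
    IsBasisSubset Δ σ ∧ (∀ α, α ∈ s ↔ α ∈ σ) ∧ k ≤ s.card ∧ f = linQuot 0 s}

/-- The span of the fractions whose denominators do not span the dual space. -/
def degenerateSpan (Δ : Finset (StrongDual ℝ V)) : Submodule ℂ (Mer V) :=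
  Submodule.span ℂ {f | ∃ a s : Multiset (StrongDual ℝ V),
    (∀ β ∈ s, β ∈ Δ) ∧ Submodule.span ℝ {β | β ∈ s} ≠ ⊤ ∧ f = linQuot a s}

/-- Partial fractions: every fraction with poles along the arrangement is a combination of basic
fractions and of degenerate ones. -/
theorem linQuot_mem_basicSpan_sup {Δ : Finset (StrongDual ℝ V)}
    (h0 : (0 : StrongDual ℝ V) ∉ Δ) (a s : Multiset (StrongDual ℝ V)) (hs : ∀ β ∈ s, β ∈ Δ) :
    linQuot a s ∈ basicSpan Δ 0 ⊔ degenerateSpan Δ := by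
  classical
  obtain ⟨r, hr⟩ := Set.countable_iff_exists_injOn.1 Δ.countable_toSet
  obtain ⟨B, hB⟩ : ∃ B, ∀ β ∈ Δ, r β ≤ B := ⟨Δ.sup r, fun β hβ => Finset.le_sup hβ⟩
  -- induction on the number of factors, then on their total rank, which is at most `B * N`
  induction hN : s.card using Nat.strong_induction_on generalizing a s with
  | _ N ihN =>
  induction hM : B * N - (s.map r).sum using Nat.strong_induction_on generalizing a s with
  | _ M ihM =>
  by_cases hsp : Submodule.span ℝ {β | β ∈ s} = ⊤
  swap
  · exact Submodule.mem_sup_right (Submodule.subset_span ⟨a, s, hs, hsp, rfl⟩)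
  have hset : ((s.toFinset : Finset (StrongDual ℝ V)) : Set (StrongDual ℝ V)) = {β | β ∈ s} := by
    ext; simp
  induction a using Multiset.induction_on with
  | cons L a _ =>
    -- the form `L` is a combination of the factors of the denominator, and each of them cancels
    have hL : L ∈ Submodule.span ℝ ((s.toFinset : Finset (StrongDual ℝ V)) :
        Set (StrongDual ℝ V)) := by
      rw [hset, hsp]; trivial
    obtain ⟨g, -, hg⟩ := Submodule.mem_span_finset.1 hL
    have e : linQuot (L ::ₘ a) s = ∑ α ∈ s.toFinset, (g α : ℂ) • linQuot a (s.erase α) := by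
      rw [linQuot_cons_left, ← hg, linForm_sum, toMer_sum, Finset.sum_mul]
      refine Finset.sum_congr rfl fun α hα => ?_
      have hα' := Multiset.mem_toFinset.1 hα
      rw [linForm_smul, toMer_smul, smul_mul_assoc,
        linForm_mul_linQuot (ne_of_mem_of_not_mem (hs α hα') h0) a hα']
    rw [e]
    refine Submodule.sum_mem _ fun α hα => Submodule.smul_mem _ _ ?_
    have hα' := Multiset.mem_toFinset.1 hα
    refine ihN _ ?_ a (s.erase α) (fun β hβ => hs β (Multiset.mem_of_mem_erase hβ)) rfl
    rw [← hN]; exact Multiset.card_erase_lt_of_mem hα'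
  | empty =>
    by_cases hli : LinearIndepOn ℝ id ((s.toFinset : Finset (StrongDual ℝ V)) :
        Set (StrongDual ℝ V))
    · refine Submodule.mem_sup_left (Submodule.subset_span ⟨s.toFinset, s, ⟨?_, hli, ?_⟩, ?_,
        Nat.zero_le _, rfl⟩)
      · intro β hβ; exact hs β (Multiset.mem_toFinset.1 hβ)
      · rw [hset, hsp]
      · simp
    · rw [linearIndepOn_finset_iff] at hli
      push Not at hli
      obtain ⟨g, hg, k, hk, hgk⟩ := hli
      -- exchange along a relation, in favour of the member of highest rank
      obtain ⟨k₀, hk₀, hmax⟩ := Finset.exists_max_image (s.toFinset.filter fun α => g α ≠ 0) r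
        ⟨k, Finset.mem_filter.2 ⟨hk, hgk⟩⟩
      rw [Finset.mem_filter] at hk₀
      have hk₀s := Multiset.mem_toFinset.1 hk₀.1
      have hk₀0 : k₀ ≠ 0 := ne_of_mem_of_not_mem (hs _ hk₀s) h0
      have e1 : k₀ = ∑ α ∈ s.toFinset.erase k₀, (-(g α / g k₀)) • α := by
        rw [← Finset.add_sum_erase _ _ hk₀.1] at hg
        simp only [id] at hg
        calc k₀ = (g k₀)⁻¹ • (g k₀ • k₀) := (inv_smul_smul₀ hk₀.2 _).symm
          _ = _ := by
            rw [eq_neg_of_add_eq_zero_left hg, smul_neg, Finset.smul_sum, ← Finset.sum_neg_distrib]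
            refine Finset.sum_congr rfl fun α _ => ?_
            rw [smul_smul, div_eq_inv_mul]
            module
      have e2 : linQuot 0 s = ∑ α ∈ s.toFinset.erase k₀,
          ((-(g α / g k₀) : ℝ) : ℂ) • linQuot 0 (k₀ ::ₘ s.erase α) := by
        have : linQuot 0 s = toMer (linForm k₀) * linQuot 0 (k₀ ::ₘ s) := by
          rw [linQuot_cons_right, mul_inv_cancel_left₀ (toMer_ne_zero (linForm_ne_zero hk₀0))]
        rw [this]
        conv_lhs => rw [e1]
        rw [linForm_sum, toMer_sum, Finset.sum_mul]
        refine Finset.sum_congr rfl fun α hα => ?_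
        have hα' := Multiset.mem_toFinset.1 (Finset.mem_of_mem_erase hα)
        rw [← e1, linForm_smul, toMer_smul, smul_mul_assoc, linQuot_cons_right, mul_left_comm,
          linForm_mul_linQuot (ne_of_mem_of_not_mem (hs α hα') h0) 0 hα', ← linQuot_cons_right]
      rw [e2]
      refine Submodule.sum_mem _ fun α hα => ?_
      by_cases hgα : g α = 0
      · rw [hgα]; simp
      refine Submodule.smul_mem _ _ ?_
      have hα' := Multiset.mem_toFinset.1 (Finset.mem_of_mem_erase hα)
      have hlt : r α < r k₀ := by
        refine lt_of_le_of_ne (hmax α (Finset.mem_filter.2 ⟨Finset.mem_of_mem_erase hα, hgα⟩)) ?_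
        exact fun h => (Finset.ne_of_mem_erase hα) (hr (hs α hα') (hs k₀ hk₀s) h)
      have hs' : ∀ β ∈ k₀ ::ₘ s.erase α, β ∈ Δ := by
        intro β hβ
        rcases Multiset.mem_cons.1 hβ with rfl | hβ
        · exact hs _ hk₀s
        · exact hs β (Multiset.mem_of_mem_erase hβ)
      have hcard : (k₀ ::ₘ s.erase α).card = N := by
        rw [Multiset.card_cons, Multiset.card_erase_add_one hα', hN]
      have hbound : ((k₀ ::ₘ s.erase α).map r).sum ≤ B * N := by
        rw [← hcard, mul_comm, ← smul_eq_mul, ← Multiset.card_map r]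
        refine Multiset.sum_le_card_nsmul _ _ fun x hx => ?_
        obtain ⟨β, hβ, rfl⟩ := Multiset.mem_map.1 hx
        exact hB β (hs' β hβ)
      have hsum : (s.map r).sum < ((k₀ ::ₘ s.erase α).map r).sum := by
        conv_lhs => rw [← Multiset.cons_erase hα']
        simp only [Multiset.map_cons, Multiset.sum_cons]
        omega
      exact ihM _ (by omega) 0 _ hs' hcard rfl

theorem linQuot_mem_ratRing {Δ : Finset (StrongDual ℝ V)} (a s : Multiset (StrongDual ℝ V))
    (hs : ∀ β ∈ s, β ∈ Δ) : linQuot a s ∈ ratRing Δ := by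
  induction a using Multiset.induction_on with
  | cons L a ih =>
    rw [linQuot_cons_left]
    exact mul_mem (Algebra.subset_adjoin (Or.inl ⟨L, rfl⟩)) ih
  | empty =>
    induction s using Multiset.induction_on with
    | empty => rw [linQuot_zero_zero]; exact one_mem _
    | cons β s ih =>
      rw [linQuot_cons_right]
      exact mul_mem (Algebra.subset_adjoin (Or.inr ⟨β, hs β (Multiset.mem_cons_self _ _), rfl⟩))
        (ih fun γ hγ => hs γ (Multiset.mem_cons_of_mem hγ))

theorem mem_span_linQuot_of_mem_ratRing {Δ : Finset (StrongDual ℝ V)} {f : Mer V}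
    (hf : f ∈ ratRing Δ) :
    f ∈ Submodule.span ℂ {f | ∃ a s : Multiset (StrongDual ℝ V),
      (∀ β ∈ s, β ∈ Δ) ∧ f = linQuot a s} := by
  induction hf using Algebra.adjoin_induction with
  | mem x hx =>
    refine Submodule.subset_span ?_
    rcases hx with ⟨α, rfl⟩ | ⟨α, hα, rfl⟩
    · exact ⟨{α}, 0, by simp, by simp [linQuot, linProd, toMer_one]⟩
    · exact ⟨0, {α}, by simpa using hα, by simp [linQuot, linProd, toMer_one]⟩
  | algebraMap r =>
    rw [Algebra.algebraMap_eq_smul_one, ← linQuot_zero_zero]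
    exact Submodule.smul_mem _ _ (Submodule.subset_span ⟨0, 0, by simp, rfl⟩)
  | add x y _ _ hx hy => exact add_mem hx hy
  | mul x y _ _ hx hy =>
    have h := Submodule.mul_mem_mul hx hy
    rw [Submodule.span_mul_span] at h
    refine Submodule.span_mono ?_ h
    rintro _ ⟨_, ⟨a, s, hs, rfl⟩, _, ⟨a', s', hs', rfl⟩, rfl⟩
    refine ⟨a + a', s + s', ?_, linQuot_mul _ _ _ _⟩
    intro β hβ
    exact (Multiset.mem_add.1 hβ).elim (hs β) (hs' β)

theorem ratRing_le_basicSpan_sup {Δ : Finset (StrongDual ℝ V)} (h0 : (0 : StrongDual ℝ V) ∉ Δ)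
    {f : Mer V} (hf : f ∈ ratRing Δ) : f ∈ basicSpan Δ 0 ⊔ degenerateSpan Δ := by
  refine Submodule.span_le.2 ?_ (mem_span_linQuot_of_mem_ratRing hf)
  rintro _ ⟨a, s, hs, rfl⟩
  exact linQuot_mem_basicSpan_sup h0 a s hs

theorem merDeriv_mem_derivSpace {Δ : Finset (StrongDual ℝ V)} (v : Cx V) {f : Mer V}
    (hf : f ∈ ratRing Δ) : merDeriv v f ∈ derivSpace Δ := by
  obtain ⟨a, b, hb, rfl⟩ := exists_toMer_div f
  exact Submodule.subset_span ⟨v, a, b, hb, hf, merDeriv_div v a hb⟩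

theorem smul_toMer_mem_span_linQuot {a : Entire V} (ha : a ∈ polySpan V)
    (s : Multiset (StrongDual ℝ V)) :
    toMer a / toMer (linProd s) ∈ Submodule.span ℂ (Set.range fun b => linQuot b s) := by
  induction ha using Submodule.span_induction with
  | mem x hx => obtain ⟨b, rfl⟩ := hx; exact Submodule.subset_span ⟨b, rfl⟩
  | zero => rw [toMer_zero, zero_div]; exact zero_mem _
  | add x y _ _ hx hy => rw [toMer_add, add_div]; exact add_mem hx hy
  | smul c x _ hx => rw [toMer_smul, smul_div_assoc]; exact Submodule.smul_mem _ _ hx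

theorem polySpan_div_mem_ratRing {Δ : Finset (StrongDual ℝ V)} {a : Entire V}
    (ha : a ∈ polySpan V) (s : Multiset (StrongDual ℝ V)) (hs : ∀ β ∈ s, β ∈ Δ) :
    toMer a / toMer (linProd s) ∈ ratRing Δ := by
  have h := smul_toMer_mem_span_linQuot ha s
  refine (Submodule.span_le (p := Subalgebra.toSubmodule (ratRing Δ))).2 ?_ h
  rintro _ ⟨b, rfl⟩
  exact linQuot_mem_ratRing b s hs

theorem polySpan_div_mem_degenerateSpan {Δ : Finset (StrongDual ℝ V)} {a : Entire V}
    (ha : a ∈ polySpan V) (s : Multiset (StrongDual ℝ V)) (hs : ∀ β ∈ s, β ∈ Δ)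
    (hsp : Submodule.span ℝ {β | β ∈ s} ≠ ⊤) :
    toMer a / toMer (linProd s) ∈ degenerateSpan Δ := by
  have h := smul_toMer_mem_span_linQuot ha s
  refine Submodule.span_le.2 ?_ h
  rintro _ ⟨b, rfl⟩
  exact Submodule.subset_span ⟨b, s, hs, hsp, rfl⟩

/-- A proper subspace of the dual space is annihilated by a nonzero vector. -/
theorem exists_vector_of_span_ne_top [FiniteDimensional ℝ V] {S : Set (StrongDual ℝ V)}
    (h : Submodule.span ℝ S ≠ ⊤) : ∃ v : V, v ≠ 0 ∧ ∀ β ∈ S, β v = 0 := by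
  obtain ⟨f, hf, hle⟩ := Submodule.exists_le_ker_of_lt_top _ (lt_top_iff_ne_top.2 h)
  have hsurj : Function.Surjective (Module.Dual.eval ℝ V) :=
    (Module.evalEquiv ℝ V).surjective
  obtain ⟨v, hv⟩ := hsurj (f.comp (LinearMap.toContinuousLinearMap :
    (V →ₗ[ℝ] ℝ) ≃ₗ[ℝ] StrongDual ℝ V).toLinearMap)
  have hv' : ∀ β : StrongDual ℝ V, β v = f β := fun β => by
    have := LinearMap.congr_fun hv (β : V →ₗ[ℝ] ℝ)
    exact this
  refine ⟨v, ?_, fun β hβ => ?_⟩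
  · rintro rfl
    refine hf (LinearMap.ext fun β => ?_)
    rw [← hv' β, map_zero]; rfl
  · rw [hv' β]
    exact hle (Submodule.subset_span hβ)

/-- The logarithmic derivative of an inverse product of linear forms. -/
theorem merDeriv_linQuot_zero (v : Cx V) {s : Multiset (StrongDual ℝ V)}
    (h0 : (0 : StrongDual ℝ V) ∉ s) :
    merDeriv v (linQuot 0 s) =
      -((s.map fun β => pair β v • (toMer (linForm β))⁻¹).sum * linQuot 0 s) := by
  induction s using Multiset.induction_on with
  | empty =>
    rw [linQuot_zero_zero, ← toMer_one, merDeriv_toMer, entireDeriv_one, toMer_zero]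
    simp
  | cons β s ih =>
    rw [Multiset.mem_cons, not_or] at h0
    have hβ := toMer_ne_zero (linForm_ne_zero (Ne.symm h0.1))
    rw [linQuot_cons_right, merDeriv_mul, ih h0.2, merDeriv_inv v hβ, merDeriv_toMer,
      entireDeriv_linForm, toMer_smul, toMer_one, Multiset.map_cons, Multiset.sum_cons]
    simp only [smul_mul_assoc, add_mul, neg_mul, one_mul, mul_neg, mul_smul_comm]
    rw [neg_add, add_comm]
    congr 1
    · congr 2; ring
    · congr 1; ring

/-- A derivation adds one factor to a basic fraction, and this factor already occurs in it. -/
theorem merDeriv_mem_of_basic {Δ : Finset (StrongDual ℝ V)} (h0 : (0 : StrongDual ℝ V) ∉ Δ)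
    (v : Cx V) {k : ℕ} {f : Mer V} (hf : f ∈ basicSpan Δ k) :
    merDeriv v f ∈ basicSpan Δ (k + 1) := by
  have hle : basicSpan Δ k ≤ (basicSpan Δ (k + 1)).comap (merDerivₗ v) := by
    refine Submodule.span_le.2 ?_
    rintro _ ⟨σ, s, hσ, hs, hk, rfl⟩
    change merDeriv v _ ∈ basicSpan Δ (k + 1)
    have h0s : (0 : StrongDual ℝ V) ∉ s := fun h => h0 (hσ.1 ((hs 0).1 h))
    rw [merDeriv_linQuot_zero v h0s, ← Multiset.sum_map_mul_right]
    refine neg_mem (multiset_sum_mem _ fun x hx => ?_)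
    obtain ⟨β, hβ, rfl⟩ := Multiset.mem_map.1 hx
    rw [smul_mul_assoc, ← linQuot_cons_right]
    refine Submodule.smul_mem _ _ (Submodule.subset_span ⟨σ, β ::ₘ s, hσ, fun α => ?_, ?_, rfl⟩)
    · rw [Multiset.mem_cons, hs α, or_iff_right_of_imp]
      rintro rfl; exact (hs _).1 hβ
    · rw [Multiset.card_cons]; omega
  exact hle hf

theorem merDeriv_mem_of_degenerate {Δ : Finset (StrongDual ℝ V)}
    (h0 : (0 : StrongDual ℝ V) ∉ Δ) (v : Cx V) {f : Mer V} (hf : f ∈ degenerateSpan Δ) :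
    merDeriv v f ∈ degenerateSpan Δ := by
  have hle : degenerateSpan Δ ≤ (degenerateSpan Δ).comap (merDerivₗ v) := by
    refine Submodule.span_le.2 ?_
    rintro _ ⟨a, s, hs, hsp, rfl⟩
    change merDeriv v _ ∈ degenerateSpan Δ
    have h0s : (0 : StrongDual ℝ V) ∉ s := fun h => h0 (hs 0 h)
    have e : linQuot a s = toMer (linProd a) * linQuot 0 s := by
      rw [linQuot, linQuot, linProd_zero, toMer_one, div_eq_mul_one_div]
    rw [e, merDeriv_mul, merDeriv_linQuot_zero v h0s, mul_neg, mul_left_comm, ← e,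
      merDeriv_toMer]
    refine add_mem (neg_mem ?_) ?_
    · rw [← Multiset.sum_map_mul_right]
      refine multiset_sum_mem _ fun x hx => ?_
      obtain ⟨β, hβ, rfl⟩ := Multiset.mem_map.1 hx
      rw [smul_mul_assoc, ← linQuot_cons_right]
      refine Submodule.smul_mem _ _ (Submodule.subset_span ⟨a, β ::ₘ s, ?_, ?_, rfl⟩)
      · intro γ hγ
        rcases Multiset.mem_cons.1 hγ with rfl | hγ
        exacts [hs _ hβ, hs _ hγ]
      · have : {γ | γ ∈ β ::ₘ s} = {γ | γ ∈ s} := by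
          ext γ
          simp only [Set.mem_ofPred_eq, Multiset.mem_cons, or_iff_right_iff_imp]
          rintro rfl; exact hβ
        rwa [this]
    · have e2 : linQuot 0 s * toMer (entireDeriv v (linProd a)) =
          toMer (entireDeriv v (linProd a)) / toMer (linProd s) := by
        rw [linQuot, linProd_zero, toMer_one, div_mul_eq_mul_div, one_mul]
      rw [e2]
      exact polySpan_div_mem_degenerateSpan
        (entireDeriv_mem_polySpan v (linProd_mem_polySpan a)) s hs hsp
  exact hle hf

theorem finrank_eq_card_of_isBasisSubset [FiniteDimensional ℝ V] {Δ σ : Finset (StrongDual ℝ V)}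
    (hσ : IsBasisSubset Δ σ) : Module.finrank ℝ V = σ.card := by
  obtain ⟨-, hli, hsp⟩ := hσ
  have h1 : Module.finrank ℝ (StrongDual ℝ V) = Module.finrank ℝ V := by
    rw [← (LinearMap.toContinuousLinearMap : (V →ₗ[ℝ] ℝ) ≃ₗ[ℝ] StrongDual ℝ V).finrank_eq]
    exact Subspace.dual_finrank_eq
  rw [← h1, ← finrank_top, ← hsp]
  exact finrank_span_finset_eq_card hli

theorem linQuot_val_eq_simpleFraction (σ : Finset (StrongDual ℝ V)) :
    linQuot 0 σ.val = simpleFraction σ := by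
  rw [linQuot, linProd_zero, toMer_one, one_div, simpleFraction, Finset.prod_inv_distrib,
    ← toMer_prod]
  rfl

theorem val_le_of_forall_mem_iff {σ : Finset (StrongDual ℝ V)} {s : Multiset (StrongDual ℝ V)}
    (h : ∀ α, α ∈ s ↔ α ∈ σ) : σ.val ≤ s :=
  (Multiset.le_iff_subset σ.nodup).2 fun α hα => (h α).2 hα

/-- Derivatives of rational functions have only degenerate terms and basic terms of degree below
`-dim V`. -/
theorem derivSpace_le [FiniteDimensional ℝ V] {Δ : Finset (StrongDual ℝ V)}
    (h0 : (0 : StrongDual ℝ V) ∉ Δ) :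
    derivSpace Δ ≤ basicSpan Δ (Module.finrank ℝ V + 1) ⊔ degenerateSpan Δ := by
  refine Submodule.span_le.2 ?_
  rintro _ ⟨v, a, b, hb, hab, rfl⟩
  rw [← merDeriv_div v a hb]
  obtain ⟨g, hg, d, hd, e⟩ := Submodule.mem_sup.1 (ratRing_le_basicSpan_sup h0 hab)
  rw [← e, merDeriv_add]
  refine add_mem (Submodule.mem_sup_left ?_)
    (Submodule.mem_sup_right (merDeriv_mem_of_degenerate h0 v hd))
  refine merDeriv_mem_of_basic h0 v ?_
  refine Submodule.span_mono ?_ hg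
  rintro _ ⟨σ, s, hσ, hs, -, rfl⟩
  refine ⟨σ, s, hσ, hs, ?_, rfl⟩
  rw [finrank_eq_card_of_isBasisSubset hσ]
  exact Multiset.card_le_card (val_le_of_forall_mem_iff hs)

/-- A degenerate fraction has an antiderivative along a vector that its denominator does not see. -/
theorem degenerateSpan_le_derivSpace [FiniteDimensional ℝ V] {Δ : Finset (StrongDual ℝ V)}
    (h0 : (0 : StrongDual ℝ V) ∉ Δ) : degenerateSpan Δ ≤ derivSpace Δ := by
  refine Submodule.span_le.2 ?_
  rintro _ ⟨a, s, hs, hsp, rfl⟩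
  obtain ⟨v, hv, hvs⟩ := exists_vector_of_span_ne_top hsp
  obtain ⟨g, hg, hg'⟩ := exists_antideriv_polySpan hv (linProd_mem_polySpan a)
  have h0s : (0 : StrongDual ℝ V) ∉ s := fun h => h0 (hs 0 h)
  have hz : ((s.map fun β => pair β (ofReal v) • (toMer (linForm β))⁻¹).sum : Mer V) = 0 := by
    refine Multiset.sum_eq_zero fun x hx => ?_
    obtain ⟨β, hβ, rfl⟩ := Multiset.mem_map.1 hx
    rw [pair_ofReal, hvs β hβ, Complex.ofReal_zero, zero_smul]
  have e : merDeriv (ofReal v) (toMer g / toMer (linProd s)) = linQuot a s := by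
    have e1 : ∀ x : Entire V, toMer x / toMer (linProd s) = toMer x * linQuot 0 s := fun x => by
      rw [linQuot, linProd_zero, toMer_one, div_eq_mul_one_div]
    rw [e1, merDeriv_mul, merDeriv_linQuot_zero _ h0s, hz, zero_mul, neg_zero, mul_zero, zero_add,
      merDeriv_toMer, hg', mul_comm, ← e1, linQuot]
  rw [← e]
  exact merDeriv_mem_derivSpace _ (polySpan_div_mem_ratRing hg s hs)

theorem eq_zero_of_span_eq_top {S : Set (StrongDual ℝ V)} (hS : Submodule.span ℝ S = ⊤) {v : V}
    (hv : ∀ β ∈ S, β v = 0) : v = 0 := by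
  refine SeparatingDual.eq_zero_of_forall_dual_eq_zero (R := ℝ) fun β => ?_
  have hβ : β ∈ Submodule.span ℝ S := by rw [hS]; trivial
  induction hβ using Submodule.span_induction with
  | mem x hx => exact hv x hx
  | zero => rfl
  | add x y _ _ hx hy => simp [hx, hy]
  | smul c x _ hx => simp [hx]

theorem exists_dual_vector [FiniteDimensional ℝ V] {Δ σ : Finset (StrongDual ℝ V)}
    (hσ : IsBasisSubset Δ σ) {α : StrongDual ℝ V} (hα : α ∈ σ) :
    ∃ v : V, α v = 1 ∧ ∀ β ∈ σ, β ≠ α → β v = 0 := by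
  classical
  have hne : Submodule.span ℝ ((σ.erase α : Finset (StrongDual ℝ V)) :
      Set (StrongDual ℝ V)) ≠ ⊤ := by
    intro h
    have h1 := finrank_span_finset_le_card (R := ℝ) (σ.erase α)
    have h2 : (Finset.card σ) = Module.finrank ℝ (StrongDual ℝ V) := by
      rw [← finrank_top, ← hσ.2.2]
      exact (finrank_span_finset_eq_card hσ.2.1).symm
    rw [Set.finrank, h, finrank_top, ← h2, Finset.card_erase_of_mem hα] at h1
    have := Finset.card_pos.2 ⟨α, hα⟩
    omega
  obtain ⟨v, hv, hvs⟩ := exists_vector_of_span_ne_top hne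
  have hvs' : ∀ β ∈ σ, β ≠ α → β v = 0 := fun β hβ hβα =>
    hvs β (Finset.mem_coe.2 (Finset.mem_erase.2 ⟨hβα, hβ⟩))
  have hαv : α v ≠ 0 := by
    intro h
    refine hv (eq_zero_of_span_eq_top hσ.2.2 fun β hβ => ?_)
    by_cases hβα : β = α
    · rw [hβα, h]
    · exact hvs' β hβ hβα
  refine ⟨(α v)⁻¹ • v, by simp [hαv], fun β hβ hβα => by simp [hvs' β hβ hβα]⟩

/-- Existence of the total residue: `R_A = S_A + ∑ ∂_v R_A`. -/
theorem exists_simpleSpace_sub_mem_derivSpace [FiniteDimensional ℝ V]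
    {Δ : Finset (StrongDual ℝ V)} (h0 : (0 : StrongDual ℝ V) ∉ Δ) {f : Mer V}
    (hf : f ∈ ratRing Δ) : ∃ s : simpleSpace Δ, f - (s : Mer V) ∈ derivSpace Δ := by
  classical
  suffices h : f ∈ simpleSpace Δ ⊔ derivSpace Δ by
    obtain ⟨s, hs, d, hd, rfl⟩ := Submodule.mem_sup.1 h
    exact ⟨⟨s, hs⟩, by simpa using hd⟩
  refine sup_le ?_ ((degenerateSpan_le_derivSpace h0).trans le_sup_right)
    (ratRing_le_basicSpan_sup h0 hf)
  refine Submodule.span_le.2 ?_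
  rintro _ ⟨σ, s, hσ, hs, -, rfl⟩
  by_cases hnd : s.Nodup
  · have : s = σ.val := hnd.ext σ.nodup |>.2 hs
    refine Submodule.mem_sup_left (Submodule.subset_span ⟨σ, hσ, ?_⟩)
    rw [this, linQuot_val_eq_simpleFraction]
  · -- if `α` occurs twice, the fraction is proportional to a derivative of the fraction with one
    -- factor `α` less, along a direction that kills the other elements of `σ`
    refine Submodule.mem_sup_right ?_
    obtain ⟨α, hα⟩ : ∃ α, ¬ s.count α ≤ 1 := by
      by_contra! h; exact hnd (Multiset.nodup_iff_count_le_one.2 h)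
    push Not at hα
    have hαs : α ∈ s := Multiset.count_pos.1 (by omega)
    have hασ := (hs α).1 hαs
    obtain ⟨v, hv, hvs⟩ := exists_dual_vector hσ hασ
    have hαv : α v ≠ 0 := by rw [hv]; exact one_ne_zero
    have h0s : (0 : StrongDual ℝ V) ∉ s.erase α := fun h =>
      h0 (hσ.1 ((hs 0).1 (Multiset.mem_of_mem_erase h)))
    have e : merDeriv (ofReal v) (linQuot 0 (s.erase α)) =
        (-((s.erase α).count α * (α v : ℂ))) • linQuot 0 s := by
      rw [merDeriv_linQuot_zero _ h0s]
      have : ((s.erase α).map fun β => pair β (ofReal v) • (toMer (linForm β))⁻¹).sum =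
          ((s.erase α).count α * (α v : ℂ)) • (toMer (linForm α))⁻¹ := by
        rw [Finset.sum_multiset_map_count, Finset.sum_eq_single α]
        · rw [pair_ofReal, ← Nat.cast_smul_eq_nsmul ℂ, smul_smul]
        · intro β hβ hβα
          have : β ∈ σ := (hs β).1 (Multiset.mem_of_mem_erase (Multiset.mem_toFinset.1 hβ))
          rw [pair_ofReal, hvs β this hβα]
          simp
        · intro h
          rw [Multiset.mem_toFinset] at h
          rw [Multiset.count_eq_zero_of_notMem h, zero_smul]
      rw [this, smul_mul_assoc, ← linQuot_cons_right, Multiset.cons_erase hαs, neg_smul]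
    have hc : (-((s.erase α).count α * (α v : ℂ))) ≠ 0 := by
      refine neg_ne_zero.2 (mul_ne_zero ?_ (by exact_mod_cast hαv))
      rw [Multiset.count_erase_self]
      exact_mod_cast (by omega : s.count α - 1 ≠ 0)
    rw [← inv_smul_smul₀ hc (linQuot 0 s), ← e]
    refine Submodule.smul_mem _ _ (merDeriv_mem_derivSpace _ (linQuot_mem_ratRing _ _ ?_))
    exact fun β hβ => hσ.1 ((hs β).1 (Multiset.mem_of_mem_erase hβ))

end Rational

/-! ### Laplace transforms of simplicial cones -/

section Laplace

open MeasureTheory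

variable {V : Type*} [NormedAddCommGroup V] [NormedSpace ℝ V]

/-- An integrable real function with vanishing Fourier transform vanishes almost everywhere. -/
theorem ae_eq_zero_of_fourier_real {E : Type*} [NormedAddCommGroup E] [NormedSpace ℝ E]
    [FiniteDimensional ℝ E] [MeasurableSpace E] [BorelSpace E] {μ : Measure E} {f : E → ℝ}
    (hf : Integrable f μ)
    (h : ∀ L : StrongDual ℝ E, ∫ y, (f y : ℂ) * Complex.exp (L y * Complex.I) ∂μ = 0) :
    f =ᵐ[μ] 0 := by
  have : SecondCountableTopology E := by
    have := FiniteDimensional.proper_real E; infer_instance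
  have : CompleteSpace E := FiniteDimensional.complete ℝ E
  -- the positive and negative parts of `f` define finite measures with the same characteristic
  -- function, hence equal
  let p : Measure E := μ.withDensity fun y => ((f y).toNNReal : ENNReal)
  let q : Measure E := μ.withDensity fun y => ((-f y).toNNReal : ENNReal)
  have : IsFiniteMeasure p := isFiniteMeasure_withDensity_ofReal hf.2
  have : IsFiniteMeasure q := isFiniteMeasure_withDensity_ofReal hf.neg.2
  have mp : AEMeasurable (fun y => (f y).toNNReal) μ := hf.aemeasurable.real_toNNReal
  have mq : AEMeasurable (fun y => (-f y).toNNReal) μ := hf.neg.aemeasurable.real_toNNReal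
  have hexp : ∀ L : StrongDual ℝ E, ∀ y, ‖Complex.exp (L y * Complex.I)‖ ≤ 1 := fun L y => by
    rw [Complex.norm_exp_ofReal_mul_I]
  have ip : ∀ (g : E → ℝ), Integrable g μ → ∀ L : StrongDual ℝ E,
      Integrable (fun y => ((g y).toNNReal : ℝ) • Complex.exp (L y * Complex.I)) μ := fun g hg L => by
    have h1 : Integrable (fun y => (((g y).toNNReal : ℝ) : ℂ)) μ := hg.real_toNNReal.ofReal
    simpa only [Complex.real_smul] using
      h1.mul_bdd (c := 1) (by fun_prop) (Filter.Eventually.of_forall (hexp L))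
  have hpq : p = q := by
    refine Measure.ext_of_charFunDual (funext fun L => ?_)
    rw [charFunDual_apply, charFunDual_apply, integral_withDensity_eq_integral_smul₀ mp,
      integral_withDensity_eq_integral_smul₀ mq, ← sub_eq_zero]
    simp only [NNReal.smul_def]
    rw [← integral_sub (ip f hf L) (ip (fun y => -f y) hf.neg L), ← h L]
    refine integral_congr_ae (Filter.Eventually.of_forall fun y => ?_)
    dsimp only
    rw [← sub_smul, Complex.real_smul]
    congr 2
    rcases le_total 0 (f y) with h0 | h0
    · rw [Real.coe_toNNReal _ h0, Real.toNNReal_of_nonpos (by linarith)]; simp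
    · rw [Real.toNNReal_of_nonpos h0, Real.coe_toNNReal _ (by linarith)]; simp
  have h1 := (withDensity_eq_iff mp.coe_nnreal_ennreal mq.coe_nnreal_ennreal ?_).1 hpq
  · filter_upwards [h1] with y hy
    have hy' : (f y).toNNReal = (-f y).toNNReal := by exact_mod_cast hy
    change f y = 0
    rcases le_total 0 (f y) with h0 | h0
    · rw [Real.toNNReal_of_nonpos (by linarith : -f y ≤ 0), Real.toNNReal_eq_zero] at hy'
      linarith
    · rw [Real.toNNReal_of_nonpos h0, eq_comm, Real.toNNReal_eq_zero] at hy'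
      linarith
  · have := (inferInstance : IsFiniteMeasure p).measure_univ_lt_top
    rw [withDensity_apply _ MeasurableSet.univ, Measure.restrict_univ] at this
    exact this.ne

/-- An integrable complex function with vanishing Fourier transform vanishes almost everywhere. -/
theorem ae_eq_zero_of_fourier {E : Type*} [NormedAddCommGroup E] [NormedSpace ℝ E]
    [FiniteDimensional ℝ E] [MeasurableSpace E] [BorelSpace E] {μ : Measure E} {f : E → ℂ}
    (hf : Integrable f μ)
    (h : ∀ L : StrongDual ℝ E, ∫ y, f y * Complex.exp (L y * Complex.I) ∂μ = 0) :
    f =ᵐ[μ] 0 := by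
  have hexp : ∀ L : StrongDual ℝ E, ∀ y, ‖Complex.exp (L y * Complex.I)‖ ≤ 1 := fun L y => by
    rw [Complex.norm_exp_ofReal_mul_I]
  have hint : ∀ (g : E → ℂ), Integrable g μ → ∀ L : StrongDual ℝ E,
      Integrable (fun y => g y * Complex.exp (L y * Complex.I)) μ := fun g hg L =>
    hg.mul_bdd (c := 1) (by fun_prop) (Filter.Eventually.of_forall (hexp L))
  -- the conjugate function has vanishing transform too
  have hconj : ∀ L : StrongDual ℝ E,
      ∫ y, (starRingEnd ℂ) (f y) * Complex.exp (L y * Complex.I) ∂μ = 0 := fun L => by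
    have h1 := congrArg (starRingEnd ℂ) (h (-L))
    rw [← integral_conj, map_zero] at h1
    rw [← h1]
    refine integral_congr_ae (Filter.Eventually.of_forall fun y => ?_)
    simp [← Complex.exp_conj]
  have hcint : Integrable (fun y => (starRingEnd ℂ) (f y)) μ :=
    (Complex.conjLIE.toContinuousLinearEquiv.toContinuousLinearMap.restrictScalars ℝ).integrable_comp hf
  have hre := ae_eq_zero_of_fourier_real (f := fun y => (f y).re) hf.re fun L => by
    have e : ∀ y, (((f y).re : ℝ) : ℂ) * Complex.exp (L y * Complex.I) =
        (2 : ℂ)⁻¹ * (f y * Complex.exp (L y * Complex.I) +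
          (starRingEnd ℂ) (f y) * Complex.exp (L y * Complex.I)) := fun y => by
      rw [Complex.re_eq_add_conj]; ring
    simp_rw [e]
    rw [integral_const_mul, integral_add (hint f hf L) (hint _ hcint L), h L, hconj L]
    simp
  have him := ae_eq_zero_of_fourier_real (f := fun y => (f y).im) hf.im fun L => by
    have e : ∀ y, (((f y).im : ℝ) : ℂ) * Complex.exp (L y * Complex.I) =
        (2 * Complex.I : ℂ)⁻¹ * (f y * Complex.exp (L y * Complex.I) -
          (starRingEnd ℂ) (f y) * Complex.exp (L y * Complex.I)) := fun y => by
      rw [Complex.im_eq_sub_conj]; field_simp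
    simp_rw [e]
    rw [integral_const_mul, integral_sub (hint f hf L) (hint _ hcint L), h L, hconj L]
    simp
  filter_upwards [hre, him] with y h1 h2
  exact Complex.ext h1 h2

/-- The basis of the dual space formed by the elements of a basis subset. -/
def basisOfSubset {Δ σ : Finset (StrongDual ℝ V)} (hσ : IsBasisSubset Δ σ) :
    Module.Basis σ ℝ (StrongDual ℝ V) :=
  Module.Basis.mk hσ.2.1 (by rw [← hσ.2.2]; exact Submodule.span_mono (by rintro x hx; exact ⟨⟨x, hx⟩, rfl⟩))

theorem basisOfSubset_apply {Δ σ : Finset (StrongDual ℝ V)} (hσ : IsBasisSubset Δ σ) (α : σ) :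
    basisOfSubset hσ α = α := by
  simp [basisOfSubset]

theorem mem_cone_iff_repr {Δ σ : Finset (StrongDual ℝ V)} (hσ : IsBasisSubset Δ σ)
    (y : StrongDual ℝ V) : y ∈ cone σ ↔ ∀ α, 0 ≤ (basisOfSubset hσ).repr y α := by
  classical
  constructor
  · rintro ⟨t, ht, rfl⟩ α
    have : ∑ β ∈ σ, t β • β = ∑ β : σ, t β • basisOfSubset hσ β := by
      simp_rw [basisOfSubset_apply]
      exact (Finset.sum_coe_sort σ (fun β => t β • β)).symm
    rw [this, Module.Basis.repr_sum_self (basisOfSubset hσ) (fun β : σ => t β)]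
    exact ht α
  · intro h
    refine ⟨fun α => if hα : α ∈ σ then (basisOfSubset hσ).repr y ⟨α, hα⟩ else 0, ?_, ?_⟩
    · intro α
      dsimp only
      split_ifs
      exacts [h _, le_rfl]
    · conv_lhs => rw [← (basisOfSubset hσ).sum_repr y]
      rw [← Finset.sum_coe_sort σ]
      refine Finset.sum_congr rfl fun α _ => ?_
      dsimp only
      rw [dif_pos α.2, basisOfSubset_apply]

/-- The Laplace transform of the indicator function of a simplicial cone. -/
theorem laplace_cone [FiniteDimensional ℝ V] (μ : Measure (StrongDual ℝ V)) [μ.IsAddHaarMeasure]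
    {Δ σ : Finset (StrongDual ℝ V)} (hσ : IsBasisSubset Δ σ) {z : Cx V}
    (hz : ∀ α ∈ σ, 0 < (pair α z).re) :
    Integrable ((cone σ).indicator fun y => Complex.exp (-pair y z)) μ ∧
    ∫ y, (cone σ).indicator (fun y => Complex.exp (-pair y z)) y ∂μ =
      ((μ (parallelepiped (fun α : σ => (α : StrongDual ℝ V)))).toReal : ℂ) *
        ∏ α ∈ σ, (pair α z)⁻¹ := by
  classical
  set b := basisOfSubset hσ with hb
  have hpar : parallelepiped (fun α : σ => (α : StrongDual ℝ V)) = parallelepiped b := by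
    congr 1; funext α; exact (basisOfSubset_apply hσ α).symm
  have hμ : μ = μ (parallelepiped b) • b.addHaar := by
    have := Measure.addHaarMeasure_unique μ b.parallelepiped
    rwa [Module.Basis.addHaar]
  let e : (σ → ℝ) ≃L[ℝ] StrongDual ℝ V := b.equivFunL.symm
  have hmap : (volume : Measure (σ → ℝ)).map e = b.addHaar := by
    have h1 : (Pi.basisFun ℝ σ).addHaar = (volume : Measure (σ → ℝ)) := by
      rw [← addHaarMeasure_eq_volume_pi, ← Module.Basis.parallelepiped_basisFun,
        Module.Basis.addHaar]
    rw [← h1, Module.Basis.map_addHaar]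
    congr 1
    refine Module.Basis.eq_of_apply_eq fun i => ?_
    have : b.equivFunL.symm (Pi.single i 1) = b.equivFun.symm (Pi.single i 1) := rfl
    simp [e, this, Module.Basis.equivFun_symm_apply, Pi.single_apply]
  have hemb : MeasurableEmbedding e := e.toHomeomorph.measurableEmbedding
  -- in coordinates the integrand is a product
  have hcoord : ∀ t : σ → ℝ, (cone σ).indicator (fun y => Complex.exp (-pair y z)) (e t) =
      ∏ α : σ, (Set.Ici (0 : ℝ)).indicator (fun s : ℝ => Complex.exp (-pair (α : StrongDual ℝ V) z * s))
        (t α) := by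
    intro t
    have he : e t = ∑ α, t α • (α : StrongDual ℝ V) := by
      have : e t = b.equivFun.symm t := rfl
      rw [this, Module.Basis.equivFun_symm_apply]
      exact Finset.sum_congr rfl fun α _ => by rw [hb, basisOfSubset_apply]
    have hr : ∀ α, b.repr (e t) α = t α :=
      fun α => congrFun (b.equivFun.apply_symm_apply t) α
    by_cases ht : ∀ α, 0 ≤ t α
    · rw [Set.indicator_of_mem ((mem_cone_iff_repr hσ _).2 fun α => by rw [hr]; exact ht α)]
      rw [Finset.prod_congr rfl fun α _ => Set.indicator_of_mem (Set.mem_Ici.2 (ht α)) _,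
        ← Complex.exp_sum]
      congr 1
      rw [he, pair_sum, ← Finset.sum_neg_distrib]
      refine Finset.sum_congr rfl fun α _ => ?_
      rw [pair_smul]; ring
    · rw [Set.indicator_of_notMem fun h => ht fun α => by
        rw [← hr]; exact (mem_cone_iff_repr hσ _).1 h α]
      push Not at ht
      obtain ⟨α, hα⟩ := ht
      rw [Finset.prod_eq_zero (Finset.mem_univ α)]
      exact Set.indicator_of_notMem (by simpa using hα) _
  have h1int : ∀ α : σ, Integrable ((Set.Ici (0 : ℝ)).indicator
      (fun s : ℝ => Complex.exp (-pair (α : StrongDual ℝ V) z * s))) volume := fun α => by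
    rw [integrable_indicator_iff measurableSet_Ici, integrableOn_Ici_iff_integrableOn_Ioi]
    exact integrableOn_exp_mul_complex_Ioi (by simpa using hz α α.2) 0
  have h1val : ∀ α : σ, ∫ s : ℝ, (Set.Ici (0 : ℝ)).indicator
      (fun s : ℝ => Complex.exp (-pair (α : StrongDual ℝ V) z * s)) s = (pair α z)⁻¹ := fun α => by
    rw [integral_indicator measurableSet_Ici, integral_Ici_eq_integral_Ioi,
      integral_exp_mul_complex_Ioi (by simpa using hz α α.2)]
    simp [neg_div_neg_eq]
  have hb_int : Integrable ((cone σ).indicator fun y => Complex.exp (-pair y z)) b.addHaar := by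
    rw [← hmap, hemb.integrable_map_iff]
    have : ((cone σ).indicator fun y => Complex.exp (-pair y z)) ∘ e = _ := funext hcoord
    rw [this]
    exact Integrable.fintype_prod (fun α => h1int α)
  have hfin : μ (parallelepiped b) ≠ ⊤ := b.parallelepiped.isCompact.measure_lt_top.ne
  constructor
  · rw [hμ]
    exact hb_int.smul_measure hfin
  · rw [hpar]
    conv_lhs => rw [hμ]
    rw [integral_smul_measure, ← hmap, hemb.integral_map, integral_congr_ae
      (Filter.Eventually.of_forall hcoord), Complex.real_smul]
    congr 1
    rw [integral_fintype_prod_volume_eq_prod (fun (α : σ) => (Set.Ici (0 : ℝ)).indicator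
      (fun s : ℝ => Complex.exp (-pair (α : StrongDual ℝ V) z * s)))]
    rw [Finset.prod_congr rfl fun α _ => h1val α]
    exact Finset.prod_coe_sort σ (fun α => (pair α z)⁻¹)

end Laplace

/-! ### The Jeffrey–Kirwan functional and total residues -/

section JK

open MeasureTheory

variable {V : Type*} [NormedAddCommGroup V] [NormedSpace ℝ V]

/-- The substitution `f ↦ (z ↦ f (2 z))` on entire functions. -/
def entireScale : Entire V →+* Entire V where
  toFun f := ⟨fun z => f.1 ((2 : ℂ) • z), fun z _ =>
    (f.2 ((2 : ℂ) • z) (Set.mem_univ _)).comp (f := fun z : Cx V => (2 : ℂ) • z)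
      (((2 : ℂ) • ContinuousLinearMap.id ℂ (Cx V)).analyticAt z)⟩
  map_one' := rfl
  map_mul' _ _ := rfl
  map_zero' := rfl
  map_add' _ _ := rfl

theorem entireScale_injective : Function.Injective (entireScale : Entire V →+* Entire V) := by
  intro f g h
  refine Subtype.ext (funext fun z => ?_)
  have h1 : f.1 ((2 : ℂ) • ((2 : ℂ)⁻¹ • z)) = g.1 ((2 : ℂ) • ((2 : ℂ)⁻¹ • z)) :=
    congrFun (congrArg Subtype.val h) ((2 : ℂ)⁻¹ • z)
  rwa [smul_inv_smul₀ two_ne_zero] at h1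

/-- The substitution `F ↦ (z ↦ F (2 z))` on meromorphic functions. -/
def merScale : Mer V →+* Mer V :=
  IsFractionRing.map (A := Entire V) (B := Entire V) (j := entireScale) entireScale_injective

theorem merScale_toMer (f : Entire V) : merScale (toMer f : Mer V) = toMer (entireScale f) :=
  IsLocalization.map_eq (nonZeroDivisors_le_comap_nonZeroDivisors_of_injective _
    entireScale_injective) f

theorem merScale_smul (c : ℂ) (F : Mer V) : merScale (c • F) = c • merScale F := by
  have h1 : ∀ G : Mer V, c • G = toMer (c • (1 : Entire V)) * G := fun G => by
    rw [toMer_smul, toMer_one, smul_mul_assoc, one_mul]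
  rw [h1 F, map_mul, merScale_toMer, h1 (merScale F)]
  rfl

/-- The substitution `F ↦ (z ↦ F (2 z))` as a linear map. -/
def merScaleₗ : Module.End ℂ (Mer V) where
  toFun := merScale
  map_add' := map_add _
  map_smul' := merScale_smul

theorem entireScale_linProd (a : Multiset (StrongDual ℝ V)) :
    entireScale (linProd a) = (2 : ℂ) ^ a.card • linProd a := by
  induction a using Multiset.induction_on with
  | empty => simp [linProd_zero]
  | cons L a ih =>
    have : entireScale (linForm L) = (2 : ℂ) • linForm L :=
      Subtype.ext (funext fun z => map_smul (pair L) 2 z)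
    rw [linProd_cons, map_mul, ih, this, Multiset.card_cons, smul_mul_smul_comm, pow_succ']

theorem merScaleₗ_linQuot (a s : Multiset (StrongDual ℝ V)) :
    merScaleₗ (linQuot a s) = ((2 : ℂ) ^ a.card / 2 ^ s.card) • linQuot a s := by
  change merScale _ = _
  rw [linQuot, map_div₀, merScale_toMer, merScale_toMer, entireScale_linProd, entireScale_linProd,
    toMer_smul, toMer_smul, Algebra.smul_def, Algebra.smul_def, Algebra.smul_def, map_div₀,
    mul_div_mul_comm]

/-- If `x` is a sum of eigenvectors of `T` with eigenvalues different from `μ₀` and of an element of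
a stable subspace `N`, and `T x = μ₀ x`, then `x` belongs to `N`. -/
theorem mem_of_eigenvector {W : Type*} [AddCommGroup W] [Module ℂ W] (T : Module.End ℂ W)
    (N : Submodule ℂ W) (hN : N ≤ N.comap T) (G : Set W) {μ₀ : ℂ}
    (hG : ∀ g ∈ G, ∃ μ, μ ≠ μ₀ ∧ T g = μ • g) {x : W} (hx : x ∈ Submodule.span ℂ G ⊔ N)
    (hs : T x = μ₀ • x) : x ∈ N := by
  let T' : Module.End ℂ (W ⧸ N) := N.mapQ N T hN
  let π := N.mkQ
  have hT : ∀ y, T' (π y) = π (T y) := fun y => rfl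
  have h1 : π x ∈ T'.eigenspace μ₀ := by
    rw [Module.End.mem_eigenspace_iff, hT, hs, map_smul]
  have hle : Submodule.span ℂ G ⊔ N ≤ (⨆ μ, ⨆ (_ : μ ≠ μ₀), T'.eigenspace μ).comap π := by
    refine sup_le (Submodule.span_le.2 ?_) fun y hy => ?_
    · intro g hg
      obtain ⟨μ, hμ, e⟩ := hG g hg
      refine Submodule.mem_iSup_of_mem μ (Submodule.mem_iSup_of_mem hμ ?_)
      rw [Module.End.mem_eigenspace_iff, hT, e, map_smul]
    · have : π y = 0 := (Submodule.Quotient.mk_eq_zero _).2 hy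
      rw [Submodule.mem_comap, this]; exact zero_mem _
  have h3 := (Submodule.disjoint_def.1 (T'.eigenspaces_iSupIndep μ₀)) _ h1 (hle hx)
  exact (Submodule.Quotient.mk_eq_zero _).1 h3

/-- A function homogeneous of degree `-n`, equal to degenerate terms plus basic terms of degrees
below `-n`, is degenerate: the scaling `z ↦ 2 z` separates the degrees. -/
theorem mem_degenerateSpan_of_scale {Δ : Finset (StrongDual ℝ V)} {n : ℕ} {x : Mer V}
    (hx : x ∈ basicSpan Δ (n + 1) ⊔ degenerateSpan Δ)
    (hs : merScaleₗ x = ((2 : ℂ) ^ n)⁻¹ • x) : x ∈ degenerateSpan Δ := by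
  refine mem_of_eigenvector merScaleₗ _ (Submodule.span_le.2 ?_) _ ?_ hx hs
  · rintro _ ⟨a, s, h1, h2, rfl⟩
    change merScaleₗ _ ∈ degenerateSpan Δ
    rw [merScaleₗ_linQuot]
    exact Submodule.smul_mem _ _ (Submodule.subset_span ⟨a, s, h1, h2, rfl⟩)
  · rintro _ ⟨σ, s, -, -, hk, rfl⟩
    refine ⟨_, ?_, merScaleₗ_linQuot 0 s⟩
    rw [Multiset.card_zero, pow_zero, one_div]
    intro h
    have h3 : (2 : ℂ) ^ s.card = 2 ^ n := inv_injective h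
    have h4 : (2 : ℕ) ^ s.card = 2 ^ n := by exact_mod_cast h3
    have := Nat.pow_right_injective le_rfl h4
    omega

/-- The difference operator `h ↦ h (· + v) - h`. -/
def diffOp {E : Type*} [AddCommGroup E] (v : E) : Module.End ℂ (E → ℂ) where
  toFun h := fun w => h (w + v) - h w
  map_add' _ _ := funext fun _ => by simp only [Pi.add_apply]; ring
  map_smul' _ _ := funext fun _ => by
    simp only [Pi.smul_apply, smul_eq_mul, RingHom.id_apply]; ring

theorem diffOp_apply {E : Type*} [AddCommGroup E] (v : E) (h : E → ℂ) (w : E) : diffOp v h w = h (w + v) - h w := rfl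

theorem diffOp_commute {E : Type*} [AddCommGroup E] (v v' : E) : Commute (diffOp v) (diffOp v') := by
  refine LinearMap.ext fun h => funext fun w => ?_
  simp only [Module.End.mul_apply, diffOp_apply]
  rw [add_right_comm]; ring

/-- `h` is annihilated by a product of difference operators in nonzero directions. -/
def Killed {E : Type*} [AddCommGroup E] (h : E → ℂ) : Prop :=
  ∃ l : List E, (∀ v ∈ l, v ≠ 0) ∧ (l.map diffOp).prod h = 0

theorem Killed.add {E : Type*} [AddCommGroup E] {h h' : E → ℂ} (hh : Killed h)
    (hh' : Killed h') : Killed (h + h') := by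
  obtain ⟨l, hl, e⟩ := hh
  obtain ⟨l', hl', e'⟩ := hh'
  refine ⟨l ++ l', fun v hv => (List.mem_append.1 hv).elim (hl v) (hl' v), ?_⟩
  have hc : Commute (l.map diffOp).prod (l'.map diffOp).prod := by
    refine Commute.list_prod_left _ _ fun x hx => Commute.list_prod_right _ _ fun y hy => ?_
    obtain ⟨v, -, rfl⟩ := List.mem_map.1 hx
    obtain ⟨v', -, rfl⟩ := List.mem_map.1 hy
    exact diffOp_commute v v'
  rw [List.map_append, List.prod_append, map_add]
  conv_lhs => arg 1; rw [hc.eq, Module.End.mul_apply, e, map_zero]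
  rw [Module.End.mul_apply, e', map_zero, zero_add]

theorem Killed.smul {E : Type*} [AddCommGroup E] {h : E → ℂ} (c : ℂ) (hh : Killed h) : Killed (c • h) := by
  obtain ⟨l, hl, e⟩ := hh
  exact ⟨l, hl, by rw [map_smul, e, smul_zero]⟩

/-- Multiplication by an affine function raises the order of vanishing under differences by one. -/
theorem diffOp_pow_affine_mul {E : Type*} [AddCommGroup E] {v : E} {ℓ : E → ℂ} {c : ℂ}
    (hℓ : ∀ w, ℓ (w + v) = ℓ w + c) (k : ℕ) (h : E → ℂ) (hk : (diffOp v ^ k) h = 0) : (diffOp v ^ (k + 1)) (ℓ * h) = 0 := by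
  induction k generalizing h with
  | zero =>
    have : h = 0 := by simpa using hk
    rw [this, mul_zero, map_zero]
  | succ k ih =>
    have e : diffOp v (ℓ * h) = ℓ * diffOp v h + c • (diffOp v h + h) := by
      funext w
      simp only [diffOp_apply, Pi.mul_apply, Pi.add_apply, Pi.smul_apply, smul_eq_mul, hℓ]
      ring
    have hk' : (diffOp v ^ k) (diffOp v h) = 0 := by
      rw [← Module.End.mul_apply, ← pow_succ]; exact hk
    rw [pow_succ, Module.End.mul_apply, e, map_add, ih _ hk', map_smul, map_add, hk, zero_add,
      add_zero, pow_succ', Module.End.mul_apply, hk', map_zero, smul_zero]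

/-- The point `v₀ + i w` of the complexification. -/
def tubePoint (v₀ w : V) : Cx V := ofReal v₀ + Complex.I • ofReal w

theorem pair_tubePoint (α : StrongDual ℝ V) (v₀ w : V) :
    pair α (tubePoint v₀ w) = (α v₀ : ℂ) + Complex.I * (α w : ℂ) := by
  rw [tubePoint, map_add, map_smul, pair_ofReal, pair_ofReal, smul_eq_mul]

theorem pair_tubePoint_re (α : StrongDual ℝ V) (v₀ w : V) :
    (pair α (tubePoint v₀ w)).re = α v₀ := by
  rw [pair_tubePoint]; simp

theorem pair_tubePoint_ne_zero {α : StrongDual ℝ V} {v₀ : V} (h : 0 < α v₀) (w : V) :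
    pair α (tubePoint v₀ w) ≠ 0 := by
  intro h'
  have := pair_tubePoint_re α v₀ w
  rw [h', Complex.zero_re] at this
  exact h.ne this

theorem linProd_apply (a : Multiset (StrongDual ℝ V)) (z : Cx V) :
    (linProd a).1 z = (a.map fun α => pair α z).prod := by
  induction a using Multiset.induction_on with
  | empty => rw [linProd_zero]; rfl
  | cons L a ih =>
    rw [linProd_cons, Multiset.map_cons, Multiset.prod_cons, ← ih]; rfl

theorem linProd_tubePoint_ne_zero {v₀ : V} {s : Multiset (StrongDual ℝ V)}
    (hs : ∀ β ∈ s, 0 < β v₀) (w : V) : (linProd s).1 (tubePoint v₀ w) ≠ 0 := by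
  rw [linProd_apply]
  refine Multiset.prod_ne_zero fun h => ?_
  obtain ⟨β, hβ, e⟩ := Multiset.mem_map.1 h
  exact pair_tubePoint_ne_zero (hs β hβ) w e

theorem hasValueAt_linQuot {v₀ : V} (a : Multiset (StrongDual ℝ V))
    {s : Multiset (StrongDual ℝ V)} (hs : ∀ β ∈ s, 0 < β v₀) (w : V) :
    HasValueAt (linQuot a s) (tubePoint v₀ w)
      ((linProd a).1 (tubePoint v₀ w) * ((linProd s).1 (tubePoint v₀ w))⁻¹) := by
  rw [linQuot, div_eq_mul_inv]
  exact (hasValueAt_toMer _ _).mul (hasValueAt_inv_toMer (linProd_tubePoint_ne_zero hs w))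

/-- On a tube, degenerate fractions are annihilated by differences: they are polynomial in a
direction annihilated by their denominators. -/
theorem exists_killed_of_mem_degenerateSpan [FiniteDimensional ℝ V] {Δ : Finset (StrongDual ℝ V)}
    {v₀ : V} (hv₀ : ∀ α ∈ Δ, 0 < α v₀) {x : Mer V} (hx : x ∈ degenerateSpan Δ) :
    ∃ h : V → ℂ, (∀ w, HasValueAt x (tubePoint v₀ w) (h w)) ∧ Killed h := by
  induction hx using Submodule.span_induction with
  | mem x hx =>
    obtain ⟨a, s, hs, hsp, rfl⟩ := hx
    obtain ⟨v, hv, hvs⟩ := exists_vector_of_span_ne_top hsp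
    refine ⟨_, hasValueAt_linQuot a fun β hβ => hv₀ β (hs β hβ),
      List.replicate (a.card + 1) v, fun w hw => (List.eq_of_mem_replicate hw).symm ▸ hv, ?_⟩
    rw [List.map_replicate, List.prod_replicate]
    clear hs
    induction a using Multiset.induction_on with
    | empty =>
      rw [Multiset.card_zero, zero_add, pow_one]
      funext w
      rw [diffOp_apply, linProd_zero]
      have : (linProd s).1 (tubePoint v₀ (w + v)) = (linProd s).1 (tubePoint v₀ w) := by
        rw [linProd_apply, linProd_apply]
        congr 1
        refine Multiset.map_congr rfl fun β hβ => ?_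
        rw [pair_tubePoint, pair_tubePoint, map_add, hvs β hβ, add_zero]
      rw [this]
      exact sub_self _
    | cons L a ih =>
      rw [Multiset.card_cons]
      have := diffOp_pow_affine_mul (v := v) (ℓ := fun w => pair L (tubePoint v₀ w))
        (c := Complex.I * (L v : ℂ)) (fun w => by
          rw [pair_tubePoint, pair_tubePoint, map_add]; push_cast; ring) _ _ ih
      convert this using 2
      funext w
      rw [linProd_cons]
      exact mul_assoc _ _ _
  | zero =>
    refine ⟨0, fun w => ?_, [], by simp, by simp⟩
    have := hasValueAt_toMer (0 : Entire V) (tubePoint v₀ w)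
    rwa [toMer_zero] at this
  | add x y _ _ hx hy =>
    obtain ⟨h, h1, h2⟩ := hx
    obtain ⟨h', h1', h2'⟩ := hy
    exact ⟨h + h', fun w => (h1 w).add (h1' w), h2.add h2'⟩
  | smul c x _ hx =>
    obtain ⟨h, h1, h2⟩ := hx
    exact ⟨c • h, fun w => (h1 w).smul c, h2.smul c⟩

theorem addHaar_hyperplane {E : Type*} [NormedAddCommGroup E] [NormedSpace ℝ E]
    [FiniteDimensional ℝ E] [MeasurableSpace E] [BorelSpace E] (μ : Measure E)
    [μ.IsAddHaarMeasure] (S : Submodule ℝ E) (hS : S ≠ ⊤) (x : E) :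
    μ {y | y - x ∈ S} = 0 := by
  have : {y | y - x ∈ S} = (fun y => y + -x) ⁻¹' (S : Set E) := by
    ext y; simp [sub_eq_add_neg]
  rw [this, measure_preimage_add_right]
  exact Measure.addHaar_submodule μ S hS

/-- The Fourier–Laplace factor `e^{-i⟨y, w⟩}`. -/
def expI (w : V) (y : StrongDual ℝ V) : ℂ := Complex.exp (-(Complex.I * (y w : ℂ)))

theorem expI_add (w v : V) (y : StrongDual ℝ V) : expI (w + v) y = expI w y * expI v y := by
  rw [expI, expI, expI, ← Complex.exp_add, map_add]; congr 1; push_cast; ring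

theorem norm_expI (w : V) (y : StrongDual ℝ V) : ‖expI w y‖ = 1 := by
  have : -(Complex.I * (y w : ℂ)) = ((-(y w) : ℝ) : ℂ) * Complex.I := by push_cast; ring
  rw [expI, this, Complex.norm_exp_ofReal_mul_I]

theorem continuous_expI (w : V) : Continuous (expI w) := by
  unfold expI
  have : Continuous fun y : StrongDual ℝ V => y w := (ContinuousLinearMap.apply ℝ ℝ w).continuous
  fun_prop

theorem ae_expI_ne_one [FiniteDimensional ℝ V] (μ : Measure (StrongDual ℝ V)) [μ.IsAddHaarMeasure]
    {v : V} (hv : v ≠ 0) : ∀ᵐ y ∂μ, expI v y ≠ 1 := by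
  obtain ⟨ℓ, hℓ⟩ : ∃ ℓ : StrongDual ℝ V, ℓ v = 1 := SeparatingDual.exists_eq_one hv
  let S : Submodule ℝ (StrongDual ℝ V) := (ContinuousLinearMap.apply ℝ ℝ v).ker
  have hS : S ≠ ⊤ := fun h => by
    have : ℓ ∈ S := by rw [h]; trivial
    have h1 : ℓ v = 0 := this
    exact one_ne_zero (hℓ.symm.trans h1)
  have hnull : ∀ k : ℤ, ∀ᵐ y ∂μ, y - (2 * Real.pi * k) • ℓ ∉ S := fun k => by
    rw [ae_iff]
    simpa using addHaar_hyperplane μ S hS ((2 * Real.pi * k) • ℓ)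
  filter_upwards [ae_all_iff.2 hnull] with y hy h
  rw [expI, Complex.exp_eq_one_iff] at h
  obtain ⟨k, hk⟩ := h
  refine hy (-k) ?_
  change (y - (2 * Real.pi * ((-k : ℤ) : ℝ)) • ℓ) v = 0
  have h1 : (y v : ℂ) = ((-(2 * Real.pi * k) : ℝ) : ℂ) := by
    have hI := Complex.I_ne_zero
    have : Complex.I * (y v : ℂ) = Complex.I * ((-(2 * Real.pi * k) : ℝ) : ℂ) := by
      push_cast; linear_combination -hk
    exact mul_left_cancel₀ hI this
  have h2 : y v = -(2 * Real.pi * k) := by exact_mod_cast h1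
  simp [h2, hℓ]

/-- Differences of a Fourier transform multiply the function by factors `e^{-i⟨y, v⟩} - 1`. -/
theorem diffOp_list_fourier [FiniteDimensional ℝ V] {μ : Measure (StrongDual ℝ V)}
    {g : StrongDual ℝ V → ℂ} (hg : Integrable g μ) (l : List V) :
    Integrable (fun y => g y * (l.map fun v => expI v y - 1).prod) μ ∧
    (l.map diffOp).prod (fun w => ∫ y, g y * expI w y ∂μ) =
      fun w => ∫ y, (g y * (l.map fun v => expI v y - 1).prod) * expI w y ∂μ := by
  induction l with
  | nil => simpa using hg
  | cons v l ih =>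
    have hb : ∀ (f : StrongDual ℝ V → ℂ) (w : V), Integrable f μ →
        Integrable (fun y => f y * expI w y) μ := fun f w hf =>
      hf.mul_bdd (c := 1) (continuous_expI w).aestronglyMeasurable
        (Filter.Eventually.of_forall fun y => (norm_expI w y).le)
    have e : ∀ y, g y * ((v :: l).map fun v => expI v y - 1).prod =
        (g y * (l.map fun v => expI v y - 1).prod) * expI v y -
          g y * (l.map fun v => expI v y - 1).prod := fun y => by
      rw [List.map_cons, List.prod_cons]; ring
    refine ⟨?_, ?_⟩
    · simp_rw [e]
      exact (hb _ v ih.1).sub ih.1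
    · rw [List.map_cons, List.prod_cons, Module.End.mul_apply, ih.2]
      funext w
      rw [diffOp_apply, ← integral_sub (hb _ _ ih.1) (hb _ _ ih.1)]
      refine integral_congr_ae (Filter.Eventually.of_forall fun y => ?_)
      dsimp only
      rw [e y, expI_add]; ring

/-- The linear relations between the simple fractions modulo derivatives hold between the weighted
indicator functions of the corresponding cones: these functions, times `e^{-⟨y, v₀⟩}`, have the simple
fractions on the tube `v₀ + iV` as Fourier transforms, and a relation modulo derivatives becomes, after
a product of differences, a relation between Fourier transforms. -/
theorem relation_of_mem_derivSpace [FiniteDimensional ℝ V] (μ : Measure (StrongDual ℝ V))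
    [μ.IsAddHaarMeasure] {Δ : Finset (StrongDual ℝ V)} {v₀ : V} (hv₀ : ∀ α ∈ Δ, 0 < α v₀)
    {c : Set (StrongDual ℝ V)} (hco : IsOpen c) (hcn : c.Nonempty)
    (hcσ : ∀ σ, IsBasisSubset Δ σ → ∀ x ∈ c, (x ∈ cone σ ↔ c ⊆ cone σ))
    (S : Finset (Finset (StrongDual ℝ V))) (hS : ∀ σ ∈ S, IsBasisSubset Δ σ)
    (a : Finset (StrongDual ℝ V) → ℂ)
    (hmem : ∑ σ ∈ S, a σ • simpleFraction σ ∈ derivSpace Δ) :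
    ∑ σ ∈ S, a σ * (open Classical in if c ⊆ cone σ then
      (((μ (parallelepiped (fun α : σ => (α : StrongDual ℝ V)))).toReal : ℂ))⁻¹ else 0) = 0 := by
  classical
  have h0 : (0 : StrongDual ℝ V) ∉ Δ := fun h => lt_irrefl (0 : ℝ) (by simpa using hv₀ 0 h)
  set vol : Finset (StrongDual ℝ V) → ℂ := fun σ =>
    ((μ (parallelepiped (fun α : σ => (α : StrongDual ℝ V)))).toReal : ℂ) with hvol
  have hvol0 : ∀ σ ∈ S, vol σ ≠ 0 := fun σ hσ => by
    have hb : (fun α : σ => (α : StrongDual ℝ V)) = basisOfSubset (hS σ hσ) :=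
      funext fun α => (basisOfSubset_apply (hS σ hσ) α).symm
    have h1 : μ (parallelepiped (basisOfSubset (hS σ hσ))) ≠ 0 :=
      (Measure.measure_pos_of_nonempty_interior μ
        (basisOfSubset (hS σ hσ)).parallelepiped.interior_nonempty).ne'
    have h2 : μ (parallelepiped (basisOfSubset (hS σ hσ))) ≠ ⊤ :=
      (basisOfSubset (hS σ hσ)).parallelepiped.isCompact.measure_lt_top.ne
    simp only [hvol, hb]
    exact_mod_cast (ENNReal.toReal_pos h1 h2).ne'
  have hdeg : ∑ σ ∈ S, a σ • simpleFraction σ ∈ degenerateSpan Δ := by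
    refine mem_degenerateSpan_of_scale (derivSpace_le h0 hmem) ?_
    rw [map_sum, Finset.smul_sum]
    refine Finset.sum_congr rfl fun σ hσ => ?_
    rw [map_smul, ← linQuot_val_eq_simpleFraction, merScaleₗ_linQuot,
      finrank_eq_card_of_isBasisSubset (hS σ hσ), smul_comm]
    congr 1
    simp
  -- the values of the combination on the tube are the Fourier transform of `g`
  obtain ⟨h, hval, l, hl, hkill⟩ := exists_killed_of_mem_degenerateSpan hv₀ hdeg
  let g : StrongDual ℝ V → ℂ := fun y =>
    ∑ σ ∈ S, (a σ * (vol σ)⁻¹) * (cone σ).indicator (fun y => Complex.exp (-(y v₀ : ℂ))) y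
  have hz : ∀ σ ∈ S, ∀ w, ∀ α ∈ σ, 0 < (pair α (tubePoint v₀ w)).re := fun σ hσ w α hα => by
    rw [pair_tubePoint_re]; exact hv₀ α ((hS σ hσ).1 hα)
  have hfac : ∀ σ : Finset (StrongDual ℝ V), ∀ w y,
      (cone σ).indicator (fun y => Complex.exp (-pair y (tubePoint v₀ w))) y =
      (cone σ).indicator (fun y => Complex.exp (-(y v₀ : ℂ))) y * expI w y := fun σ w y => by
    by_cases hy : y ∈ cone σ
    · rw [Set.indicator_of_mem hy, Set.indicator_of_mem hy, pair_tubePoint, expI,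
        ← Complex.exp_add]
      congr 1; ring
    · rw [Set.indicator_of_notMem hy, Set.indicator_of_notMem hy, zero_mul]
  have hint : ∀ σ ∈ S, Integrable ((cone σ).indicator (fun y => Complex.exp (-(y v₀ : ℂ)))) μ :=
    fun σ hσ => by
    have h1 := (laplace_cone μ (hS σ hσ) (hz σ hσ 0)).1
    refine h1.congr (Filter.Eventually.of_forall fun y => ?_)
    have := hfac σ 0 y
    simpa [expI] using this
  have hg : Integrable g μ := integrable_finsetSum _ fun σ hσ => (hint σ hσ).const_mul _
  have hgh : h = fun w => ∫ y, g y * expI w y ∂μ := by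
    funext w
    refine (hval w).unique ?_
    have e1 : ∫ y, g y * expI w y ∂μ = ∑ σ ∈ S, a σ * ∏ α ∈ σ, (pair α (tubePoint v₀ w))⁻¹ := by
      have : ∀ y, g y * expI w y = ∑ σ ∈ S, (a σ * (vol σ)⁻¹) *
          (cone σ).indicator (fun y => Complex.exp (-pair y (tubePoint v₀ w))) y := fun y => by
        rw [Finset.sum_mul]
        exact Finset.sum_congr rfl fun σ _ => by rw [hfac, mul_assoc]
      simp_rw [this]
      rw [integral_finsetSum _ fun σ hσ =>
        ((laplace_cone μ (hS σ hσ) (hz σ hσ w)).1).const_mul _]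
      refine Finset.sum_congr rfl fun σ hσ => ?_
      rw [integral_const_mul, (laplace_cone μ (hS σ hσ) (hz σ hσ w)).2, mul_assoc,
        inv_mul_cancel_left₀ (hvol0 σ hσ)]
    rw [e1]
    refine hasValueAt_finset_sum S fun σ hσ => (hasValueAt_finset_prod σ fun α hα => ?_).smul _
    exact hasValueAt_inv_toMer (pair_tubePoint_ne_zero (hv₀ α ((hS σ hσ).1 hα)) w)
  -- after the differences the transform vanishes, so `g` times a product of factors vanishes a.e.
  obtain ⟨hgi, hge⟩ := diffOp_list_fourier hg l
  rw [← hgh, hkill] at hge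
  have hae := ae_eq_zero_of_fourier hgi fun L => by
    obtain ⟨w, hw⟩ := (Module.evalEquiv ℝ V).surjective
      ((L : StrongDual ℝ V →ₗ[ℝ] ℝ).comp (LinearMap.toContinuousLinearMap :
        (V →ₗ[ℝ] ℝ) ≃ₗ[ℝ] StrongDual ℝ V).toLinearMap)
    have hw' : ∀ y : StrongDual ℝ V, y w = L y := fun y =>
      LinearMap.congr_fun hw (y : V →ₗ[ℝ] ℝ)
    have h1 := congrFun hge (-w)
    rw [Pi.zero_apply] at h1
    rw [h1]
    refine integral_congr_ae (Filter.Eventually.of_forall fun y => ?_)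
    have : expI (-w) y = Complex.exp (L y * Complex.I) := by
      rw [expI, map_neg, hw']; congr 1; push_cast; ring
    dsimp only
    rw [this]
  -- the factors are nonzero a.e., and on `c` the value of `g` is the sum in question up to a factor
  have hne : ∀ᵐ y ∂μ, ∀ v ∈ l, expI v y ≠ 1 := by
    have : ∀ᵐ y ∂μ, ∀ v : {v // v ∈ l}, expI (v : V) y ≠ 1 :=
      ae_all_iff.2 fun v => ae_expI_ne_one μ (hl v v.2)
    filter_upwards [this] with y hy v hv using hy ⟨v, hv⟩
  have hfreq : ∃ᵐ y ∂μ, y ∈ c := by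
    rw [frequently_ae_mem_iff]
    exact (hco.measure_pos μ hcn).ne'
  obtain ⟨y, hyc, hy0, hyl⟩ := (hfreq.and_eventually (hae.and hne)).exists
  have hprod : (l.map fun v => expI v y - 1).prod ≠ 0 := by
    refine List.prod_ne_zero fun h => ?_
    obtain ⟨v, hv, e⟩ := List.mem_map.1 h
    exact hyl v hv (sub_eq_zero.1 e)
  have hgy : g y = 0 := (mul_eq_zero.1 hy0).resolve_right hprod
  have hgy' : g y = (∑ σ ∈ S, a σ * (if c ⊆ cone σ then (vol σ)⁻¹ else 0)) *
      Complex.exp (-(y v₀ : ℂ)) := by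
    rw [Finset.sum_mul]
    refine Finset.sum_congr rfl fun σ hσ => ?_
    by_cases hyσ : y ∈ cone σ
    · rw [Set.indicator_of_mem hyσ, if_pos ((hcσ σ (hS σ hσ) y hyc).1 hyσ)]
    · rw [Set.indicator_of_notMem hyσ, if_neg fun h => hyσ (h hyc)]; simp
  rw [hgy', mul_eq_zero] at hgy
  exact hgy.resolve_right (Complex.exp_ne_zero _)

/-- A family of values that respects the linear relations of a family of vectors modulo a subspace
is induced by a linear functional. -/
theorem exists_functional_of_relations {W B : Type*} [AddCommGroup W] [Module ℂ W]
    (N : Submodule ℂ W) (f : B → W) (j : B → ℂ)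
    (h : ∀ l : B →₀ ℂ, Finsupp.linearCombination ℂ f l ∈ N →
      Finsupp.linearCombination ℂ j l = 0) :
    ∃ J : W →ₗ[ℂ] ℂ, (∀ x ∈ N, J x = 0) ∧ ∀ b, J (f b) = j b := by
  let φ := N.mkQ.comp (Finsupp.linearCombination ℂ f)
  have hker : Finsupp.linearCombination ℂ j ∈ (LinearMap.ker φ).dualAnnihilator := by
    rw [Submodule.mem_dualAnnihilator]
    intro l hl
    exact h l ((Submodule.Quotient.mk_eq_zero N).1 hl)
  rw [← LinearMap.range_dualMap_eq_dualAnnihilator_ker] at hker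
  obtain ⟨J, hJ⟩ := hker
  refine ⟨J.comp N.mkQ, fun x hx => ?_, fun b => ?_⟩
  · have : N.mkQ x = 0 := (Submodule.Quotient.mk_eq_zero N).2 hx
    rw [LinearMap.comp_apply, this, map_zero]
  · have := LinearMap.congr_fun hJ (Finsupp.single b 1)
    simpa [φ] using this

/-- The Jeffrey–Kirwan functional extends to a linear functional that vanishes on derivatives. -/
theorem exists_jeffreyKirwan_extension [FiniteDimensional ℝ V] (μ : Measure (StrongDual ℝ V))
    [μ.IsAddHaarMeasure] {Δ : Finset (StrongDual ℝ V)} {v₀ : V} (hv₀ : ∀ α ∈ Δ, 0 < α v₀)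
    {c : Set (StrongDual ℝ V)} (hco : IsOpen c) (hcn : c.Nonempty)
    (hcσ : ∀ σ, IsBasisSubset Δ σ → ∀ x ∈ c, (x ∈ cone σ ↔ c ⊆ cone σ)) :
    ∃ J : Mer V →ₗ[ℂ] ℂ, (∀ x ∈ derivSpace Δ, J x = 0) ∧
      (∀ σ, IsBasisSubset Δ σ → J (simpleFraction σ) = (open Classical in if c ⊆ cone σ then
        (((μ (parallelepiped (fun α : σ => (α : StrongDual ℝ V)))).toReal : ℂ))⁻¹ else 0)) ∧
      ∀ s : simpleSpace Δ, jeffreyKirwan μ Δ c s = J (s : Mer V) := by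
  classical
  obtain ⟨J, h1, h2⟩ := exists_functional_of_relations (B := {σ // IsBasisSubset Δ σ})
    (derivSpace Δ) (fun σ => simpleFraction σ.1) (fun σ => if c ⊆ cone σ.1 then
        (((μ (parallelepiped (fun α : σ.1 => (α : StrongDual ℝ V)))).toReal : ℂ))⁻¹ else 0)
    fun l hl => by
      have key := relation_of_mem_derivSpace μ hv₀ hco hcn hcσ
        (l.support.map (Function.Embedding.subtype _)) (fun σ hσ => by
          obtain ⟨τ, -, rfl⟩ := Finset.mem_map.1 hσ
          exact τ.2) (fun σ => if h : IsBasisSubset Δ σ then l ⟨σ, h⟩ else 0) (by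
          rw [Finset.sum_map]
          rw [Finsupp.linearCombination_apply, Finsupp.sum] at hl
          refine Eq.mp (congrArg (· ∈ derivSpace Δ) (Finset.sum_congr rfl fun τ _ => ?_)) hl
          exact congrArg (· • simpleFraction τ.1)
            (dif_pos τ.2 : (if h : IsBasisSubset Δ τ.1 then l ⟨τ.1, h⟩ else 0) = l τ).symm)
      rw [Finset.sum_map] at key
      rw [Finsupp.linearCombination_apply, Finsupp.sum]
      refine Eq.trans (Finset.sum_congr rfl fun τ _ => ?_) key
      exact congrArg (· * _)
        (dif_pos τ.2 : (if h : IsBasisSubset Δ τ.1 then l ⟨τ.1, h⟩ else 0) = l τ).symm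
  refine ⟨J, h1, fun σ hσ => h2 ⟨σ, hσ⟩, fun s => ?_⟩
  have hex : ∃ J : simpleSpace Δ →ₗ[ℂ] ℂ, ∀ (σ : Finset (StrongDual ℝ V))
      (hσ : IsBasisSubset Δ σ), J (simpleElt Δ σ hσ) =
        if c ⊆ cone σ then
          (((μ (parallelepiped (fun α : σ => (α : StrongDual ℝ V)))).toReal : ℂ))⁻¹
        else 0 := ⟨J.comp (simpleSpace Δ).subtype, fun σ hσ => h2 ⟨σ, hσ⟩⟩
  have hdef : jeffreyKirwan μ Δ c = hex.choose := by
    unfold jeffreyKirwan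
    rw [dif_pos hex]
  obtain ⟨s, hs⟩ := s
  induction hs using Submodule.span_induction with
  | mem x hx =>
    obtain ⟨σ, hσ, rfl⟩ := hx
    rw [hdef]
    exact (hex.choose_spec σ hσ).trans (h2 ⟨σ, hσ⟩).symm
  | zero => exact (map_zero _).trans (map_zero J).symm
  | add x y hx hy ex ey =>
    have : (⟨x + y, add_mem hx hy⟩ : simpleSpace Δ) = ⟨x, hx⟩ + ⟨y, hy⟩ := rfl
    rw [this, map_add, ex, ey]
    exact (map_add J _ _).symm
  | smul r x hx ex =>
    have : (⟨r • x, Submodule.smul_mem _ r hx⟩ : simpleSpace Δ) = r • ⟨x, hx⟩ := rfl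
    rw [this, map_smul, ex]
    exact (map_smul J _ _).symm

end JK

/-! ### Homogeneous components -/

section Homogeneous

variable {V : Type*} [NormedAddCommGroup V] [NormedSpace ℝ V]

/-- `a` is the sequence of Taylor coefficients of `g` at the origin. -/
def IsTaylor (g : ℂ → ℂ) (a : ℕ → ℂ) : Prop :=
  ∀ᶠ t in nhds (0 : ℂ), HasSum (fun n => t ^ n * a n) (g t)

theorem IsTaylor.unique {g : ℂ → ℂ} {a a' : ℕ → ℂ} (h : IsTaylor g a) (h' : IsTaylor g a') :
    a = a' := by
  have key : ∀ b : ℕ → ℂ, IsTaylor g b →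
      HasFPowerSeriesAt g (FormalMultilinearSeries.ofScalars ℂ b) 0 := fun b hb => by
    rw [hasFPowerSeriesAt_iff]
    filter_upwards [hb] with t ht
    simpa [FormalMultilinearSeries.coeff_ofScalars] using ht
  have e := (key a h).eq_formalMultilinearSeries (key a' h')
  funext n
  have := congrArg (fun p => FormalMultilinearSeries.coeff p n) e
  simpa [FormalMultilinearSeries.coeff_ofScalars] using this

theorem IsTaylor.congr {g g' : ℂ → ℂ} {a : ℕ → ℂ} (h : IsTaylor g a)
    (e : g =ᶠ[nhds 0] g') : IsTaylor g' a := by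
  filter_upwards [h, e] with t ht ht'
  rwa [← ht']

theorem IsTaylor.add {g g' : ℂ → ℂ} {a a' : ℕ → ℂ} (h : IsTaylor g a) (h' : IsTaylor g' a') :
    IsTaylor (fun t => g t + g' t) (fun n => a n + a' n) := by
  filter_upwards [h, h'] with t ht ht'
  simpa only [mul_add] using ht.add ht'

theorem IsTaylor.const_mul {g : ℂ → ℂ} {a : ℕ → ℂ} (c : ℂ) (h : IsTaylor g a) :
    IsTaylor (fun t => c * g t) (fun n => c * a n) := by
  filter_upwards [h] with t ht
  simpa only [mul_left_comm] using ht.mul_left c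

theorem IsTaylor.pow_mul {g : ℂ → ℂ} {a : ℕ → ℂ} (d : ℕ) (h : IsTaylor g a) :
    IsTaylor (fun t => t ^ d * g t) (fun n => if n < d then 0 else a (n - d)) := by
  filter_upwards [h] with t ht
  rw [← hasSum_nat_add_iff' d]
  have e : ∑ i ∈ Finset.range d, t ^ i * (if i < d then 0 else a (i - d)) = 0 :=
    Finset.sum_eq_zero fun i hi => by rw [if_pos (Finset.mem_range.1 hi), mul_zero]
  rw [e, sub_zero]
  refine Eq.mp (congrArg (fun f => HasSum f _) (funext fun n => ?_)) (ht.mul_left (t ^ d))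
  rw [if_neg (by omega), Nat.add_sub_cancel, pow_add]; ring

theorem isTaylor_homogPart {f : Cx V → ℂ} (hf : AnalyticAt ℂ f 0) (z : Cx V) :
    IsTaylor (fun t => f (t • z)) (fun k => (homogPart f k).1 z) := by
  obtain ⟨p, r, hp⟩ := hf
  have hc : Filter.Tendsto (fun t : ℂ => t • z) (nhds 0) (nhds 0) := by
    have : Continuous fun t : ℂ => t • z := by fun_prop
    simpa using this.tendsto 0
  have hball : ∀ᶠ t : ℂ in nhds 0, t • z ∈ Metric.eball (0 : Cx V) r :=
    hc.eventually (Metric.eball_mem_nhds _ hp.r_pos)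
  filter_upwards [hball] with t ht
  have h1 := hp.hasSum ht
  rw [zero_add] at h1
  refine Eq.mp (congrArg (fun f => HasSum f _) (funext fun k => ?_)) h1
  symm
  change t ^ k * (((k.factorial : ℂ))⁻¹ * iteratedFDeriv ℂ k f 0 (fun _ => z)) = _
  rw [← hp.factorial_smul z k, nsmul_eq_mul,
    inv_mul_cancel_left₀ (by exact_mod_cast k.factorial_ne_zero)]
  exact ((p k).map_smul_univ (fun _ => t) (fun _ => z)).symm ▸ by simp

/-- The homogeneous component of integral degree; it is zero in negative degrees. -/
def homogPartInt (f : Cx V → ℂ) (k : ℤ) : Entire V := if 0 ≤ k then homogPart f k.toNat else 0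

theorem homogPartInt_natCast (f : Cx V → ℂ) (k : ℕ) : homogPartInt f k = homogPart f k := by
  rw [homogPartInt, if_pos (Int.natCast_nonneg k), Int.toNat_natCast]

theorem homogPartInt_of_neg (f : Cx V → ℂ) {k : ℤ} (hk : k < 0) : homogPartInt f k = 0 := by
  rw [homogPartInt, if_neg (not_le.2 hk)]

theorem homogPart_congr {f g : Cx V → ℂ} (h : f =ᶠ[nhds 0] g) (k : ℕ) :
    homogPart f k = homogPart g k := by
  refine Subtype.ext (funext fun z => ?_)
  change _ * iteratedFDeriv ℂ k f 0 _ = _ * iteratedFDeriv ℂ k g 0 _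
  rw [(h.iteratedFDeriv ℂ k).eq_of_nhds]

theorem homogPartInt_congr {f g : Cx V → ℂ} (h : f =ᶠ[nhds 0] g) (k : ℤ) :
    homogPartInt f k = homogPartInt g k := by
  rw [homogPartInt, homogPartInt, homogPart_congr h]

theorem homogPartInt_add {f g : Cx V → ℂ} (hf : AnalyticAt ℂ f 0) (hg : AnalyticAt ℂ g 0)
    (k : ℤ) : homogPartInt (fun z => f z + g z) k = homogPartInt f k + homogPartInt g k := by
  rcases lt_or_ge k 0 with hk | hk
  · simp only [homogPartInt_of_neg _ hk, add_zero]
  · lift k to ℕ using hk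
    simp only [homogPartInt_natCast]
    refine Subtype.ext (funext fun z => ?_)
    have h1 := isTaylor_homogPart (hf.add hg) z
    exact congrFun (h1.unique ((isTaylor_homogPart hf z).add (isTaylor_homogPart hg z))) k

/-- `Q` is homogeneous of degree `d`. -/
def IsHomog (Q : Entire V) (d : ℕ) : Prop := ∀ (t : ℂ) (z : Cx V), Q.1 (t • z) = t ^ d * Q.1 z

theorem homogPartInt_mul {f : Cx V → ℂ} (hf : AnalyticAt ℂ f 0) {Q : Entire V} {d : ℕ}
    (hQ : IsHomog Q d) (k : ℤ) :
    homogPartInt (fun z => Q.1 z * f z) (k + d) = Q * homogPartInt f k := by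
  have hQf : AnalyticAt ℂ (fun z => Q.1 z * f z) 0 := (Q.2 0 trivial).mul hf
  have key : ∀ z j, (homogPart (fun z => Q.1 z * f z) j).1 z =
      if j < d then 0 else Q.1 z * (homogPart f (j - d)).1 z := fun z j => by
    have h1 := isTaylor_homogPart hQf z
    have h2 := ((isTaylor_homogPart hf z).pow_mul d).const_mul (Q.1 z)
    have h3 := congrFun (h1.unique (h2.congr (Filter.Eventually.of_forall fun t => ?_))) j
    · rw [h3, mul_ite, mul_zero]
    · dsimp only
      rw [hQ t z]; ring
  refine Subtype.ext (funext fun z => ?_)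
  change _ = Q.1 z * (homogPartInt f k).1 z
  rcases lt_or_ge (k + d) 0 with hk | hk
  · rw [homogPartInt_of_neg _ hk, homogPartInt_of_neg _ (by omega)]
    exact (mul_zero _).symm
  · obtain ⟨j, hj⟩ := Int.eq_ofNat_of_zero_le hk
    rw [hj, homogPartInt_natCast, key]
    split_ifs with h
    · rw [homogPartInt_of_neg _ (by omega)]
      exact (mul_zero _).symm
    · have : k = ((j - d : ℕ) : ℤ) := by omega
      rw [this, homogPartInt_natCast]

theorem isHomog_linProd (s : Multiset (StrongDual ℝ V)) : IsHomog (linProd s) s.card := by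
  intro t z
  rw [linProd_apply, linProd_apply]
  have : ∀ α : StrongDual ℝ V, pair α (t • z) = t * pair α z := fun α => map_smul (pair α) t z
  simp_rw [this]
  rw [Multiset.prod_map_mul]
  simp

theorem homogPart_zero {f : Cx V → ℂ} : homogPart f 0 = f 0 • (1 : Entire V) := by
  refine Subtype.ext (funext fun z => ?_)
  change ((Nat.factorial 0 : ℂ))⁻¹ * iteratedFDeriv ℂ 0 f 0 (fun _ => z) = f 0 * 1
  simp

/-- Differentiation commutes with taking homogeneous components. -/
theorem homogPart_fderiv {f : Cx V → ℂ} (hf : AnalyticAt ℂ f 0) (v : Cx V) (k : ℕ) :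
    homogPart (fun z => fderiv ℂ f z v) k = entireDeriv v (homogPart f (k + 1)) := by
  refine Subtype.ext (funext fun z => ?_)
  set M := iteratedFDeriv ℂ (k + 1) f 0 with hM
  -- by symmetry the direction `v` may be put in the last place
  have hsymm : ∀ i : Fin (k + 1), M (Function.update (fun _ => z) i v) =
      M (Fin.snoc (fun _ => z) v) := fun i => by
    have h1 := (hf.contDiffAt (n := ⊤)).iteratedFDeriv_comp_perm (n := k + 1)
      (Fin.snoc (α := fun _ => Cx V) (fun _ => z) v) (Equiv.swap i (Fin.last k))
    rw [← h1]
    congr 1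
    funext j
    rcases eq_or_ne j i with rfl | hji
    · simp
    · rw [Function.update_of_ne hji, Function.comp_apply]
      rcases eq_or_ne j (Fin.last k) with rfl | hj
      · rw [Equiv.swap_apply_right]
        obtain ⟨i', rfl⟩ := Fin.exists_castSucc_eq.2 hji.symm
        simp
      · rw [Equiv.swap_apply_of_ne_of_ne hji hj]
        obtain ⟨j', rfl⟩ := Fin.exists_castSucc_eq.2 hj
        simp
  have h1 : (fun z => fderiv ℂ f z v) = (ContinuousLinearMap.apply ℂ ℂ v) ∘ (fderiv ℂ f) := rfl
  have hL : (homogPart (fun z => fderiv ℂ f z v) k).1 z =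
      ((k.factorial : ℂ))⁻¹ * M (Fin.snoc (fun _ => z) v) := by
    change ((k.factorial : ℂ))⁻¹ * iteratedFDeriv ℂ k (fun z => fderiv ℂ f z v) 0 (fun _ => z) = _
    rw [h1, ContinuousLinearMap.iteratedFDeriv_comp_left _ (hf.fderiv.contDiffAt (n := ⊤)) (by simp), hM,
      iteratedFDeriv_succ_apply_right]
    simp
  have hR : (entireDeriv v (homogPart f (k + 1))).1 z =
      (((k + 1).factorial : ℂ))⁻¹ * ∑ i : Fin (k + 1), M (Function.update (fun _ => z) i v) := by
    change fderiv ℂ (fun z => (((k + 1).factorial : ℂ))⁻¹ * M (fun _ => z)) z v = _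
    have h2 : HasFDerivAt (fun z : Cx V => M (fun _ => z))
        ((M.linearDeriv (fun _ => z)).comp (ContinuousLinearMap.pi fun _ => ContinuousLinearMap.id ℂ (Cx V))) z :=
      (M.hasFDerivAt (fun _ => z)).comp z
        (ContinuousLinearMap.pi fun _ : Fin (k + 1) => ContinuousLinearMap.id ℂ (Cx V)).hasFDerivAt
    rw [(h2.const_mul _).fderiv]
    simp [ContinuousMultilinearMap.linearDeriv_apply]
  rw [hL, hR, Finset.sum_congr rfl fun i _ => hsymm i]
  rw [Finset.sum_const, Finset.card_univ, Fintype.card_fin, nsmul_eq_mul, Nat.factorial_succ]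
  have : (k.factorial : ℂ) ≠ 0 := by exact_mod_cast k.factorial_ne_zero
  have h3 : ((k + 1 : ℕ) : ℂ) ≠ 0 := by exact_mod_cast k.succ_ne_zero
  push_cast at h3 ⊢
  field_simp

/-- A point of the complexification in terms of a real basis. -/
theorem eq_sum_pair_smul [FiniteDimensional ℝ V] {ι : Type*} [Fintype ι] (e : Module.Basis ι ℝ V)
    (z : Cx V) :
    z = ∑ i, pair (LinearMap.toContinuousLinearMap (e.coord i)) z • ofReal (e i) := by
  refine Cx.ext fun α => ?_
  have h1 : α = ∑ i, α (e i) • LinearMap.toContinuousLinearMap (e.coord i) := by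
    refine ContinuousLinearMap.ext fun v => ?_
    conv_lhs => rw [← e.sum_repr v]
    simp only [map_sum, map_smul, smul_eq_mul, sum_apply,
      smul_apply, LinearMap.coe_toContinuousLinearMap', Module.Basis.coord_apply]
    exact Finset.sum_congr rfl fun i _ => mul_comm _ _
  rw [map_sum]
  simp_rw [map_smul, pair_ofReal, smul_eq_mul]
  conv_lhs => rw [h1, pair_sum]
  simp_rw [pair_smul, mul_comm]

theorem homogPart_mem_polySpan [FiniteDimensional ℝ V] (f : Cx V → ℂ) (k : ℕ) :
    homogPart f k ∈ polySpan V := by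
  classical
  let e := Module.finBasis ℝ V
  let x : Fin (Module.finrank ℝ V) → StrongDual ℝ V := fun i =>
    LinearMap.toContinuousLinearMap (e.coord i)
  have key : homogPart f k = ∑ r : Fin k → Fin (Module.finrank ℝ V),
      (((k.factorial : ℂ))⁻¹ * iteratedFDeriv ℂ k f 0 (fun j => ofReal (e (r j)))) •
        linProd (Multiset.map (fun j => x (r j)) Finset.univ.val) := by
    refine Subtype.ext (funext fun z => ?_)
    have h1 : (homogPart f k).1 z = ((k.factorial : ℂ))⁻¹ *
        iteratedFDeriv ℂ k f 0 (fun _ => ∑ i, pair (x i) z • ofReal (e i)) := by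
      rw [← eq_sum_pair_smul e z]; rfl
    rw [h1]
    have h2 := (iteratedFDeriv ℂ k f 0).toMultilinearMap.map_sum
      (fun (_ : Fin k) (i : Fin (Module.finrank ℝ V)) => pair (x i) z • ofReal (e i))
    have h3 : ∀ r : Fin k → Fin (Module.finrank ℝ V),
        iteratedFDeriv ℂ k f 0 (fun j => pair (x (r j)) z • ofReal (e (r j))) =
          (∏ j, pair (x (r j)) z) * iteratedFDeriv ℂ k f 0 (fun j => ofReal (e (r j))) :=
      fun r => (iteratedFDeriv ℂ k f 0).map_smul_univ _ _
    refine (congrArg (((k.factorial : ℂ))⁻¹ * ·) (h2.trans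
      (Finset.sum_congr rfl fun r _ => h3 r))).trans ?_
    rw [Finset.mul_sum]
    have h4 : ∀ (T : Finset (Fin k → Fin (Module.finrank ℝ V)))
        (g : (Fin k → Fin (Module.finrank ℝ V)) → Entire V),
        (∑ r ∈ T, g r).1 z = ∑ r ∈ T, (g r).1 z := fun T g => by
      rw [AddSubmonoidClass.coe_finsetSum, Finset.sum_apply]
    rw [h4]
    refine Finset.sum_congr rfl fun r _ => ?_
    change _ = _ * (linProd _).1 z
    rw [linProd_apply, Multiset.map_map]
    simp only [Function.comp_def]
    change _ = _ * ∏ j, pair (x (r j)) z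
    ring
  rw [key]
  exact Submodule.sum_mem _ fun r _ => Submodule.smul_mem _ _ (linProd_mem_polySpan _)

theorem homogPartInt_mem_polySpan [FiniteDimensional ℝ V] (f : Cx V → ℂ) (k : ℤ) :
    homogPartInt f k ∈ polySpan V := by
  rw [homogPartInt]
  split_ifs
  exacts [homogPart_mem_polySpan f _, zero_mem _]

theorem homogPartInt_fderiv {f : Cx V → ℂ} (hf : AnalyticAt ℂ f 0) (v : Cx V) (k : ℤ) :
    homogPartInt (fun z => fderiv ℂ f z v) k = entireDeriv v (homogPartInt f (k + 1)) := by
  have hz : entireDeriv v (0 : Entire V) = 0 := by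
    simpa using entireDeriv_smul v 0 (0 : Entire V)
  rcases lt_or_ge k 0 with hk | hk
  · rw [homogPartInt_of_neg _ hk]
    rcases lt_or_ge (k + 1) 0 with hk' | hk'
    · rw [homogPartInt_of_neg _ hk', hz]
    · have : k + 1 = ((0 : ℕ) : ℤ) := by push_cast; omega
      rw [this, homogPartInt_natCast, homogPart_zero, entireDeriv_smul, entireDeriv_one, smul_zero]
  · lift k to ℕ using hk
    rw [homogPartInt_natCast, homogPart_fderiv hf]
    exact_mod_cast congrArg (entireDeriv v) (homogPartInt_natCast f (k + 1)).symm

theorem homogPartInt_smul {f : Cx V → ℂ} (hf : AnalyticAt ℂ f 0) (c : ℂ) (k : ℤ) :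
    homogPartInt (fun z => c * f z) k = c • homogPartInt f k := by
  have := homogPartInt_mul hf (Q := c • (1 : Entire V)) (d := 0) (fun t z => by simp) k
  simp only [Nat.cast_zero, add_zero, smul_mul_assoc, one_mul] at this
  rw [← this]
  congr 1
  funext z
  change _ = (c * 1) * f z
  ring

end Homogeneous

/-! ### Numerical residues -/

section Residue

variable {V : Type*} [NormedAddCommGroup V] [NormedSpace ℝ V]

/-- The total residue of `f / ∏ s`, before reduction modulo derivatives: the homogeneous part of
degree `-dim V` of this quotient. -/
def resPart (s : Multiset (StrongDual ℝ V)) (f : Cx V → ℂ) : Mer V :=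
  toMer (homogPartInt f ((s.card : ℤ) - Module.finrank ℝ V)) / toMer (linProd s)

/-- `G` has poles along the hyperplanes of `Δ` near the origin, and `r` is the value of the
functional `J` on its total residue there. -/
def HasRes (J : Mer V →ₗ[ℂ] ℂ) (Δ : Finset (StrongDual ℝ V)) (G : Mer V) (r : ℂ) : Prop :=
  ∃ (s : Multiset (StrongDual ℝ V)) (a b : Entire V), (∀ α ∈ s, α ∈ Δ) ∧ b.1 0 ≠ 0 ∧
    G * toMer (b * linProd s) = toMer a ∧ r = J (resPart s fun z => a.1 z / b.1 z)

variable {J : Mer V →ₗ[ℂ] ℂ} {Δ : Finset (StrongDual ℝ V)}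

theorem linProd_ne_zero_of_forall_mem (h0 : (0 : StrongDual ℝ V) ∉ Δ)
    {s : Multiset (StrongDual ℝ V)} (hs : ∀ α ∈ s, α ∈ Δ) : linProd s ≠ 0 :=
  linProd_ne_zero fun h => h0 (hs 0 h)

theorem analyticAt_div {a b : Entire V} (hb : b.1 0 ≠ 0) :
    AnalyticAt ℂ (fun z => a.1 z / b.1 z) 0 :=
  (a.2 0 trivial).div (b.2 0 trivial) hb

theorem eventually_ne_zero {b : Entire V} (hb : b.1 0 ≠ 0) :
    ∀ᶠ z in nhds (0 : Cx V), b.1 z ≠ 0 :=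
  (b.2 0 trivial).continuousAt.eventually_ne hb

theorem resPart_add_right (h0 : (0 : StrongDual ℝ V) ∉ Δ) {s t : Multiset (StrongDual ℝ V)}
    (ht : ∀ α ∈ t, α ∈ Δ) {f : Cx V → ℂ} (hf : AnalyticAt ℂ f 0) :
    resPart (s + t) (fun z => (linProd t).1 z * f z) = resPart s f := by
  rw [resPart, resPart]
  have e : ((s + t).card : ℤ) - Module.finrank ℝ V =
      ((s.card : ℤ) - Module.finrank ℝ V) + (t.card : ℕ) := by
    rw [Multiset.card_add]; push_cast; ring
  rw [e, homogPartInt_mul hf (isHomog_linProd t), linProd_add, toMer_mul, toMer_mul, mul_comm]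
  exact mul_div_mul_right _ _ (toMer_ne_zero (linProd_ne_zero_of_forall_mem h0 ht))

theorem resPart_congr {s : Multiset (StrongDual ℝ V)} {f g : Cx V → ℂ} (h : f =ᶠ[nhds 0] g) :
    resPart s f = resPart s g := by
  rw [resPart, resPart, homogPartInt_congr h]

theorem HasRes.unique (h0 : (0 : StrongDual ℝ V) ∉ Δ) {G : Mer V} {r r' : ℂ}
    (h : HasRes J Δ G r) (h' : HasRes J Δ G r') : r = r' := by
  obtain ⟨s, a, b, hs, hb, e, rfl⟩ := h
  obtain ⟨s', a', b', hs', hb', e', rfl⟩ := h'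
  rw [← resPart_add_right h0 hs' (analyticAt_div hb), ← resPart_add_right h0 hs (analyticAt_div hb'),
    add_comm s' s]
  congr 1
  refine resPart_congr ?_
  have key : linProd s' * (a * b') = linProd s * (a' * b) := by
    apply toMer_injective
    simp only [toMer_mul] at e e' ⊢
    rw [← e, ← e']; ring
  filter_upwards [eventually_ne_zero hb, eventually_ne_zero hb'] with z hz hz'
  have := congrFun (congrArg Subtype.val key) z
  change (linProd s').1 z * (a.1 z * b'.1 z) = (linProd s).1 z * (a'.1 z * b.1 z) at this
  field_simp
  linear_combination this

theorem HasRes.add (h0 : (0 : StrongDual ℝ V) ∉ Δ) {G G' : Mer V} {r r' : ℂ}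
    (h : HasRes J Δ G r) (h' : HasRes J Δ G' r') : HasRes J Δ (G + G') (r + r') := by
  obtain ⟨s, a, b, hs, hb, e, rfl⟩ := h
  obtain ⟨s', a', b', hs', hb', e', rfl⟩ := h'
  refine ⟨s + s', linProd s' * (a * b') + linProd s * (a' * b), b * b', fun α hα => ?_,
    mul_ne_zero hb hb', ?_, ?_⟩
  · rcases Multiset.mem_add.1 hα with h | h
    exacts [hs α h, hs' α h]
  · rw [linProd_add]
    simp only [toMer_mul, toMer_add] at e e' ⊢
    rw [← e, ← e']; ring
  · rw [← resPart_add_right h0 hs' (analyticAt_div hb),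
      ← resPart_add_right h0 hs (analyticAt_div hb'), add_comm s' s, ← map_add]
    congr 1
    have hf : ∀ (t : Multiset (StrongDual ℝ V)) (a b : Entire V), b.1 0 ≠ 0 →
        AnalyticAt ℂ (fun z => (linProd t).1 z * (a.1 z / b.1 z)) 0 := fun t a b hb =>
      ((linProd t).2 0 trivial).mul (analyticAt_div hb)
    rw [resPart, resPart, ← add_div, ← toMer_add, ← homogPartInt_add (hf _ _ _ hb) (hf _ _ _ hb'),
      resPart]
    congr 2
    refine homogPartInt_congr ?_ _
    filter_upwards [eventually_ne_zero hb, eventually_ne_zero hb'] with z hz hz'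
    change _ = ((linProd s').1 z * (a.1 z * b'.1 z) + (linProd s).1 z * (a'.1 z * b.1 z)) /
      (b.1 z * b'.1 z)
    field_simp

theorem HasRes.smul {G : Mer V} {r : ℂ} (c : ℂ) (h : HasRes J Δ G r) :
    HasRes J Δ (c • G) (c * r) := by
  obtain ⟨s, a, b, hs, hb, e, rfl⟩ := h
  refine ⟨s, c • a, b, hs, hb, ?_, ?_⟩
  · rw [smul_mul_assoc, e, toMer_smul]
  · rw [← smul_eq_mul, ← map_smul]
    congr 1
    rw [resPart, ← smul_div_assoc, ← toMer_smul, ← homogPartInt_smul (analyticAt_div hb), resPart]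
    congr 3
    funext z
    exact (mul_div_assoc _ _ _).symm

/-- Derivatives have no residues: the homogeneous part that computes the residue of `∂_v G` is the
derivative of a homogeneous part of `G`. -/
theorem hasRes_merDeriv [FiniteDimensional ℝ V] (h0 : (0 : StrongDual ℝ V) ∉ Δ)
    (hJ : ∀ x ∈ derivSpace Δ, J x = 0)
    {G : Mer V} {r : ℂ} (h : HasRes J Δ G r) (v : Cx V) : HasRes J Δ (merDeriv v G) 0 := by
  obtain ⟨s, a, b, hs, hb, e, -⟩ := h
  have hB := linProd_ne_zero_of_forall_mem h0 hs
  have hb0 := entire_ne_zero_of_apply hb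
  have hBm := toMer_ne_zero hB
  have hbm := toMer_ne_zero hb0
  have hG : G = toMer a / toMer (b * linProd s) := by
    rw [← e, mul_div_cancel_right₀ _ (toMer_ne_zero (mul_ne_zero hb0 hB))]
  refine ⟨s + s, (b * entireDeriv v a - a * entireDeriv v b) * linProd s -
      a * b * entireDeriv v (linProd s), b * b, fun α hα => ?_, mul_ne_zero hb hb, ?_, ?_⟩
  · rcases Multiset.mem_add.1 hα with h | h
    exacts [hs α h, hs α h]
  · rw [hG, merDeriv_div v a (mul_ne_zero hb0 hB), entireDeriv_mul, linProd_add]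
    simp only [toMer_mul, toMer_sub, toMer_add]
    field_simp
    ring
  · set f : Cx V → ℂ := fun z => a.1 z / b.1 z with hf
    have hfa : AnalyticAt ℂ f 0 := analyticAt_div hb
    set B := linProd s
    set k : ℤ := (s.card : ℤ) - Module.finrank ℝ V
    have hBf : AnalyticAt ℂ (fun z => B.1 z * f z) 0 := (B.2 0 trivial).mul hfa
    have hdf : AnalyticAt ℂ (fun z => fderiv ℂ f z v) 0 :=
      ((ContinuousLinearMap.apply ℂ ℂ v).analyticAt (fderiv ℂ f 0)).comp hfa.fderiv
    have hdBf : AnalyticAt ℂ (fun z => fderiv ℂ (fun z => B.1 z * f z) z v) 0 :=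
      ((ContinuousLinearMap.apply ℂ ℂ v).analyticAt _).comp hBf.fderiv
    set h := homogPartInt f (k + 1)
    -- `B ∂_v f - f ∂_v B = 2 B ∂_v f - ∂_v (B f)`, and both terms have simple homogeneous parts
    have e1 : homogPartInt (fun z => B.1 z * fderiv ℂ f z v) (k + s.card) = B * entireDeriv v h := by
      rw [homogPartInt_mul hdf (isHomog_linProd s), homogPartInt_fderiv hfa]
    have e2 : homogPartInt (fun z => fderiv ℂ (fun z => B.1 z * f z) z v) (k + s.card) =
        entireDeriv v (B * h) := by
      rw [homogPartInt_fderiv hBf, add_right_comm, homogPartInt_mul hfa (isHomog_linProd s)]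
    have e3 : homogPartInt (fun z => 2 * (B.1 z * fderiv ℂ f z v) +
        (-1) * fderiv ℂ (fun z => B.1 z * f z) z v) (k + s.card) =
        B * entireDeriv v h - h * entireDeriv v B := by
      have hB1 : AnalyticAt ℂ (fun z => B.1 z * fderiv ℂ f z v) 0 := (B.2 0 trivial).mul hdf
      have e0 := homogPartInt_add (f := fun z => 2 * (B.1 z * fderiv ℂ f z v))
        (g := fun z => (-1) * fderiv ℂ (fun z => B.1 z * f z) z v)
        (analyticAt_const.mul hB1) (analyticAt_const.mul hdBf) (k + s.card)
      rw [e0, homogPartInt_smul hB1, homogPartInt_smul hdBf, e1, e2, entireDeriv_mul, neg_one_smul,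
        two_smul]
      ring
    have e4 : resPart (s + s) (fun z => ((b * entireDeriv v a - a * entireDeriv v b) * B -
        a * b * entireDeriv v B).1 z / (b * b).1 z) = merDeriv v (toMer h / toMer B) := by
      rw [merDeriv_div v h hB, ← e3, resPart, linProd_add]
      have : ((s + s).card : ℤ) - Module.finrank ℝ V = k + s.card := by
        rw [Multiset.card_add]; push_cast; ring
      rw [this, toMer_mul, ← sq (toMer B)]
      congr 2
      refine homogPartInt_congr ?_ _
      filter_upwards [eventually_ne_zero hb, hfa.eventually_analyticAt] with z hz hfz
      have ha' := (a.2 z trivial).differentiableAt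
      have hb' := (b.2 z trivial).differentiableAt
      have hB' := (B.2 z trivial).differentiableAt
      have d1 : fderiv ℂ f z v * b.1 z + f z * fderiv ℂ b.1 z v = fderiv ℂ a.1 z v := by
        have h1 : (fun z => f z * b.1 z) =ᶠ[nhds z] a.1 := by
          filter_upwards [hb'.continuousAt.eventually_ne hz] with w hw
          exact div_mul_cancel₀ _ hw
        rw [← h1.fderiv_eq, fderiv_fun_mul hfz.differentiableAt hb']
        change _ = f z * fderiv ℂ b.1 z v + b.1 z * fderiv ℂ f z v
        ring
      have d2 : fderiv ℂ (fun z => B.1 z * f z) z v = B.1 z * fderiv ℂ f z v + f z * fderiv ℂ B.1 z v := by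
        rw [fderiv_fun_mul hB' hfz.differentiableAt]
        rfl
      rw [d2]
      change ((b.1 z * fderiv ℂ a.1 z v - a.1 z * fderiv ℂ b.1 z v) * B.1 z -
        a.1 z * b.1 z * fderiv ℂ B.1 z v) / (b.1 z * b.1 z) = _
      have d3 : a.1 z = f z * b.1 z := (div_mul_cancel₀ _ hz).symm
      rw [← d1, d3]
      field_simp
      ring
    rw [e4]
    exact (hJ _ (merDeriv_mem_derivSpace v
      (polySpan_div_mem_ratRing (homogPartInt_mem_polySpan _ _) s hs))).symm

/-- Residues vanish where the polar hyperplanes do not cut out a point. -/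
theorem hasRes_zero_of_degenerate [FiniteDimensional ℝ V] (h0 : (0 : StrongDual ℝ V) ∉ Δ)
    (hJ : ∀ x ∈ derivSpace Δ, J x = 0) {G : Mer V} {s : Multiset (StrongDual ℝ V)} {a b : Entire V}
    (hs : ∀ α ∈ s, α ∈ Δ) (hsp : Submodule.span ℝ {α | α ∈ s} ≠ ⊤) (hb : b.1 0 ≠ 0)
    (e : G * toMer (b * linProd s) = toMer a) : HasRes J Δ G 0 := by
  refine ⟨s, a, b, hs, hb, e, ?_⟩
  exact (hJ _ (degenerateSpan_le_derivSpace h0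
    (polySpan_div_mem_degenerateSpan (homogPartInt_mem_polySpan _ _) s hs hsp))).symm

/-- The residue at a normal crossing of polar hyperplanes. -/
theorem hasRes_of_isBasisSubset [FiniteDimensional ℝ V] {σ : Finset (StrongDual ℝ V)}
    (hσ : IsBasisSubset Δ σ) {G : Mer V} {a b : Entire V} (hb : b.1 0 ≠ 0)
    (e : G * toMer (b * linProd σ.val) = toMer a) :
    HasRes J Δ G (a.1 0 / b.1 0 * J (simpleFraction σ)) := by
  refine ⟨σ.val, a, b, fun α hα => hσ.1 hα, hb, e, ?_⟩
  have hc : ((σ.val.card : ℕ) : ℤ) - Module.finrank ℝ V = ((0 : ℕ) : ℤ) := by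
    rw [finrank_eq_card_of_isBasisSubset hσ]; simp
  rw [resPart, hc, homogPartInt_natCast, homogPart_zero, toMer_smul, toMer_one, smul_div_assoc,
    map_smul, smul_eq_mul, ← linQuot_val_eq_simpleFraction, linQuot, linProd_zero, toMer_one]

theorem linProd_map {R : ℕ} (β : Fin R → StrongDual ℝ V) :
    linProd (Multiset.map β Finset.univ.val) = ∏ i, linForm (β i) := by
  rw [linProd, Multiset.map_map]
  rfl

/-- The functional `J` does not distinguish a fraction from its reduction modulo derivatives. -/
theorem hasRes_of_isTotalResidue [FiniteDimensional ℝ V] (h0 : (0 : StrongDual ℝ V) ∉ Δ)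
    (hJ : ∀ x ∈ derivSpace Δ, J x = 0) {G : Mer V} {T : simpleSpace Δ}
    (h : IsTotalResidue Δ G T) : HasRes J Δ G (J (T : Mer V)) := by
  obtain ⟨R, β, a, b, hβ, hb, e, hT⟩ := h
  set s : Multiset (StrongDual ℝ V) := Multiset.map β Finset.univ.val
  have hs : ∀ α ∈ s, α ∈ Δ := fun α hα => by
    obtain ⟨i, -, rfl⟩ := Multiset.mem_map.1 hα
    exact hβ i
  have hcard : s.card = R := by simp [s]
  have hprod : ∏ i, (toMer (linForm (β i)))⁻¹ = (toMer (linProd s))⁻¹ := by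
    rw [Finset.prod_inv_distrib, ← toMer_prod, linProd_map]
  have hB := toMer_ne_zero (linProd_ne_zero_of_forall_mem h0 hs)
  have hbm := toMer_ne_zero (entire_ne_zero_of_apply hb)
  refine ⟨s, a, b, hs, hb, ?_, ?_⟩
  · rw [e, hprod, toMer_mul]
    field_simp
  · rw [hprod, ← div_eq_mul_inv] at hT
    rw [resPart, hcard]
    rcases hT with ⟨hR, rfl⟩ | ⟨hR, rfl⟩
    · rw [homogPartInt_of_neg _ (by omega), toMer_zero, zero_div, map_zero]
      exact map_zero J
    · have hk : (R : ℤ) - Module.finrank ℝ V = ((R - Module.finrank ℝ V : ℕ) : ℤ) := by omega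
      rw [hk, homogPartInt_natCast]
      set f := toMer (homogPart (fun z => a.1 z / b.1 z) (R - Module.finrank ℝ V)) /
        toMer (linProd s)
      have hf : f ∈ ratRing Δ := polySpan_div_mem_ratRing (homogPart_mem_polySpan _ _) s hs
      have hex := exists_simpleSpace_sub_mem_derivSpace h0 hf
      have : f - (ratTotalResidue Δ f : Mer V) ∈ derivSpace Δ := by
        rw [ratTotalResidue, dif_pos hex]
        exact hex.choose_spec
      have := hJ _ this
      rw [map_sub, sub_eq_zero] at this
      exact this.symm

theorem HasRes.totalResidue_eq [FiniteDimensional ℝ V] (h0 : (0 : StrongDual ℝ V) ∉ Δ)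
    (hJ : ∀ x ∈ derivSpace Δ, J x = 0) {G : Mer V} {r : ℂ} (h : HasRes J Δ G r) :
    J (totalResidue Δ G : Mer V) = r := by
  have hex : ∃ T, IsTotalResidue Δ G T := by
    obtain ⟨s, a, b, hs, hb, e, -⟩ := h
    have hB := toMer_ne_zero (linProd_ne_zero_of_forall_mem h0 hs)
    have hbm := toMer_ne_zero (entire_ne_zero_of_apply hb)
    have hprod : ∏ i, (toMer (linForm (s.toList.get i)))⁻¹ = (toMer (linProd s))⁻¹ := by
      rw [Finset.prod_inv_distrib, ← toMer_prod]
      rw [← linProd_map]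
      congr 3
      rw [Fin.univ_val_map, List.ofFn_get, Multiset.coe_toList]
    have hG : G = (toMer a / toMer b) * ∏ i, (toMer (linForm (s.toList.get i)))⁻¹ := by
      rw [hprod, ← e, toMer_mul]
      field_simp
    have hβ : ∀ i, s.toList.get i ∈ Δ := fun i =>
      hs _ (Multiset.mem_toList.1 (List.get_mem _ _))
    rcases lt_or_ge s.toList.length (Module.finrank ℝ V) with hR | hR
    · exact ⟨0, _, _, a, b, hβ, hb, hG, Or.inl ⟨hR, rfl⟩⟩
    · exact ⟨_, _, _, a, b, hβ, hb, hG, Or.inr ⟨hR, rfl⟩⟩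
  have : IsTotalResidue Δ G (totalResidue Δ G) := by
    rw [totalResidue, dif_pos hex]
    exact hex.choose_spec
  exact (hasRes_of_isTotalResidue h0 hJ this).unique h0 h

end Residue

/-! ### Formal expansions -/

section Expansion

variable {V : Type*} [NormedAddCommGroup V] [NormedSpace ℝ V]

open AddMonoidAlgebra (single)

/-- Finite combinations of the characters `e^ξ`, `ξ ∈ Γ*`, as formal expressions. -/
abbrev CharRing (Γ : Submodule ℤ V) : Type _ := AddMonoidAlgebra ℂ (dualLattice Γ)

variable {Γ : Submodule ℤ V}

/-- The meromorphic function defined by a combination of characters. -/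
def evalChar : CharRing Γ →ₐ[ℂ] Mer V :=
  AddMonoidAlgebra.lift ℂ (Mer V) (dualLattice Γ)
    { toFun := fun ξ => toMer (expForm (ξ.toAdd : StrongDual ℝ V))
      map_one' := by
        change toMer (expForm (0 : StrongDual ℝ V)) = 1
        rw [expForm_zero, toMer_one]
      map_mul' := fun ξ η => by
        change toMer (expForm ((ξ.toAdd : StrongDual ℝ V) + (η.toAdd : StrongDual ℝ V))) = _
        rw [expForm_add, toMer_mul] }

theorem evalChar_single (ξ : dualLattice Γ) (c : ℂ) :
    evalChar (single ξ c) = c • toMer (expForm (ξ : StrongDual ℝ V)) :=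
  AddMonoidAlgebra.lift_single _ _ _

/-- The action of combinations of characters on formal series by convolution. -/
def shiftAct : CharRing Γ →ₐ[ℂ] Module.End ℂ (dualLattice Γ → ℂ) :=
  AddMonoidAlgebra.lift ℂ (Module.End ℂ (dualLattice Γ → ℂ)) (dualLattice Γ)
    { toFun := fun ξ =>
        { toFun := fun Θ lam => Θ (lam - ξ.toAdd)
          map_add' := fun _ _ => rfl
          map_smul' := fun _ _ => rfl }
      map_one' := LinearMap.ext fun Θ => funext fun lam => congrArg Θ (sub_zero lam)
      map_mul' := fun ξ η => LinearMap.ext fun Θ => funext fun lam =>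
        congrArg Θ (sub_add_eq_sub_sub lam ξ.toAdd η.toAdd) }

theorem shiftAct_single (ξ : dualLattice Γ) (c : ℂ) (Θ : dualLattice Γ → ℂ) (lam : dualLattice Γ) :
    shiftAct (single ξ c) Θ lam = c * Θ (lam - ξ) := by
  rw [shiftAct, AddMonoidAlgebra.lift_single]
  rfl

theorem shiftAct_mul_apply (A B : CharRing Γ) (Θ : dualLattice Γ → ℂ) :
    shiftAct (A * B) Θ = shiftAct A (shiftAct B Θ) := by
  rw [map_mul]; rfl

open Classical in
/-- The formal series `1`. -/
def deltaZero (lam : dualLattice Γ) : ℂ := if lam = 0 then 1 else 0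

theorem evalChar_eq (A : CharRing Γ) :
    evalChar A = toMer (A.coeff.sum fun ξ a => a • expForm (ξ : StrongDual ℝ V)) := by
  induction A using AddMonoidAlgebra.induction_linear with
  | zero => simp [toMer_zero]
  | add A B hA hB =>
    rw [map_add, hA, hB, AddMonoidAlgebra.coeff_add, Finsupp.sum_add_index', toMer_add]
    · simp
    · intro ξ b c; rw [add_smul]
  | single ξ c =>
    rw [evalChar_single, AddMonoidAlgebra.coeff_single, Finsupp.sum_single_index, toMer_smul]
    simp

/-- Distinct characters are linearly independent (Dedekind). -/
theorem evalChar_injective : Function.Injective (evalChar : CharRing Γ → Mer V) := by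
  rw [injective_iff_map_eq_zero]
  intro A hA
  rw [evalChar_eq, ← toMer_zero] at hA
  have h1 := toMer_injective hA
  let χ : dualLattice Γ → (Multiplicative (Cx V) →* ℂ) := fun ξ =>
    { toFun := fun z => Complex.exp (pair (ξ : StrongDual ℝ V) z.toAdd)
      map_one' := by
        change Complex.exp (pair (ξ : StrongDual ℝ V) 0) = 1
        rw [map_zero, Complex.exp_zero]
      map_mul' := fun z w => by
        change Complex.exp (pair (ξ : StrongDual ℝ V) (z.toAdd + w.toAdd)) = _
        rw [map_add, Complex.exp_add] }
  have hχ : Function.Injective χ := fun ξ η h => by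
    refine Subtype.ext (ContinuousLinearMap.ext fun v => ?_)
    have h2 : ∀ t : ℂ, Complex.exp (t * ((ξ : StrongDual ℝ V) v : ℂ)) =
        Complex.exp (t * ((η : StrongDual ℝ V) v : ℂ)) := fun t => by
      have := DFunLike.congr_fun h (Multiplicative.ofAdd (t • ofReal v))
      change Complex.exp (pair (ξ : StrongDual ℝ V) (t • ofReal v)) =
        Complex.exp (pair (η : StrongDual ℝ V) (t • ofReal v)) at this
      simpa only [map_smul, pair_ofReal, smul_eq_mul] using this
    have h3 := h2 1
    rw [one_mul, one_mul, ← Complex.ofReal_exp, ← Complex.ofReal_exp] at h3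
    exact Real.exp_injective (Complex.ofReal_injective h3)
  have hli := (linearIndependent_monoidHom (Multiplicative (Cx V)) ℂ).comp χ hχ
  have h2 : A.coeff = 0 := by
    refine linearIndependent_iff.1 hli A.coeff ?_
    funext z
    have := congrFun (congrArg Subtype.val h1) z.toAdd
    rw [Finsupp.linearCombination_apply, Finsupp.sum, Finset.sum_apply]
    rw [Finsupp.sum, AddSubmonoidClass.coe_finsetSum, Finset.sum_apply] at this
    exact this
  exact AddMonoidAlgebra.coeff_injective h2

/-- The support of `Θ` is bounded below in the direction of `v₀`. -/
def BoundedBelow (v₀ : V) (Θ : dualLattice Γ → ℂ) : Prop :=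
  ∃ B : ℝ, ∀ lam, Θ lam ≠ 0 → B ≤ (lam : StrongDual ℝ V) v₀

theorem BoundedBelow.add {v₀ : V} {Θ Θ' : dualLattice Γ → ℂ} (h : BoundedBelow v₀ Θ)
    (h' : BoundedBelow v₀ Θ') : BoundedBelow v₀ (Θ + Θ') := by
  obtain ⟨B, hB⟩ := h
  obtain ⟨B', hB'⟩ := h'
  refine ⟨min B B', fun lam hl => ?_⟩
  by_cases h0 : Θ lam = 0
  · refine (min_le_right _ _).trans (hB' lam fun h1 => hl ?_)
    rw [Pi.add_apply, h0, h1, add_zero]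
  · exact (min_le_left _ _).trans (hB lam h0)

theorem BoundedBelow.smul {v₀ : V} {Θ : dualLattice Γ → ℂ} (c : ℂ) (h : BoundedBelow v₀ Θ) :
    BoundedBelow v₀ (c • Θ) := by
  obtain ⟨B, hB⟩ := h
  exact ⟨B, fun lam hl => hB lam fun h0 => hl (by rw [Pi.smul_apply, h0, smul_zero])⟩

theorem BoundedBelow.shiftAct {v₀ : V} {Θ : dualLattice Γ → ℂ} (h : BoundedBelow v₀ Θ)
    (A : CharRing Γ) : BoundedBelow v₀ (shiftAct A Θ) := by
  induction A using AddMonoidAlgebra.induction_linear with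
  | zero => exact ⟨0, fun lam hl => absurd (by rw [map_zero]; rfl) hl⟩
  | add A B hA hB => rw [map_add]; exact hA.add hB
  | single ξ c =>
    obtain ⟨B, hB⟩ := h
    refine ⟨B + (ξ : StrongDual ℝ V) v₀, fun lam hl => ?_⟩
    rw [shiftAct_single] at hl
    have := hB _ (right_ne_zero_of_mul hl)
    simp only [Submodule.coe_sub, sub_apply] at this
    linarith

/-- Convolution with `D` is injective on the series that are bounded below. -/
def IsCancellable (v₀ : V) (D : CharRing Γ) : Prop :=
  ∀ Θ : dualLattice Γ → ℂ, BoundedBelow v₀ Θ → shiftAct D Θ = 0 → Θ = 0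

theorem IsCancellable.mul {v₀ : V} {D D' : CharRing Γ} (h : IsCancellable v₀ D)
    (h' : IsCancellable v₀ D') : IsCancellable v₀ (D * D') := fun Θ hΘ e =>
  h' Θ hΘ (h _ (hΘ.shiftAct D') (by rw [← shiftAct_mul_apply, e]))

theorem isCancellable_one {v₀ : V} : IsCancellable v₀ (1 : CharRing Γ) := fun Θ _ e => by
  rw [map_one] at e
  exact e

theorem isCancellable_one_sub_single {v₀ : V} {γ : dualLattice Γ}
    (hγ : 0 < (γ : StrongDual ℝ V) v₀) (u : ℂ) : IsCancellable v₀ (1 - single γ u) := by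
  rintro Θ ⟨B, hB⟩ e
  have h1 : ∀ lam, Θ lam = u * Θ (lam - γ) := fun lam => by
    have := congrFun e lam
    rw [map_sub, map_one, LinearMap.sub_apply, Pi.sub_apply, shiftAct_single] at this
    exact sub_eq_zero.1 this
  funext lam
  by_contra h0
  -- a nonzero coefficient propagates in the direction `-γ`, which is excluded by the lower bound
  have h2 : ∀ k : ℕ, Θ (lam - k • γ) ≠ 0 := fun k => by
    induction k with
    | zero => simpa using h0
    | succ k ih =>
      rw [h1] at ih
      rw [succ_nsmul, ← sub_sub]
      exact right_ne_zero_of_mul ih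
  obtain ⟨k, hk⟩ := exists_nat_gt (((lam : StrongDual ℝ V) v₀ - B) / (γ : StrongDual ℝ V) v₀)
  have h3 := hB _ (h2 k)
  rw [div_lt_iff₀ hγ] at hk
  have h4 : ((lam - k • γ : dualLattice Γ) : StrongDual ℝ V) v₀ =
      (lam : StrongDual ℝ V) v₀ - k * (γ : StrongDual ℝ V) v₀ := by simp
  rw [h4] at h3
  linarith

/-- `Θ` is the expansion of `F` whose support is bounded below in the direction of `v₀`. -/
def IsExp (v₀ : V) (F : Mer V) (Θ : dualLattice Γ → ℂ) : Prop :=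
  BoundedBelow v₀ Θ ∧ ∃ D N : CharRing Γ, IsCancellable v₀ D ∧ F * evalChar D = evalChar N ∧
    shiftAct D Θ = shiftAct N deltaZero

theorem IsExp.unique {v₀ : V} {F : Mer V} {Θ Θ' : dualLattice Γ → ℂ} (h : IsExp v₀ F Θ)
    (h' : IsExp v₀ F Θ') : Θ = Θ' := by
  obtain ⟨hb, D, N, hD, e, a⟩ := h
  obtain ⟨hb', D', N', hD', e', a'⟩ := h'
  have key : D' * N = D * N' := by
    apply evalChar_injective
    rw [map_mul, map_mul, ← e, ← e']; ring
  have h1 : shiftAct (D * D') Θ = shiftAct (D * D') Θ' := by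
    rw [mul_comm, shiftAct_mul_apply, a, ← shiftAct_mul_apply, key, mul_comm D' D,
      shiftAct_mul_apply, shiftAct_mul_apply, a']
  have h2 := (hD.mul hD') (Θ + (-1 : ℂ) • Θ') (hb.add (hb'.smul _)) (by
    rw [map_add, map_smul, h1, neg_one_smul, add_neg_cancel])
  rw [neg_one_smul] at h2
  exact add_neg_eq_zero.1 h2

theorem IsExp.add {v₀ : V} {F F' : Mer V} {Θ Θ' : dualLattice Γ → ℂ} (h : IsExp v₀ F Θ)
    (h' : IsExp v₀ F' Θ') : IsExp v₀ (F + F') (Θ + Θ') := by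
  obtain ⟨hb, D, N, hD, e, a⟩ := h
  obtain ⟨hb', D', N', hD', e', a'⟩ := h'
  refine ⟨hb.add hb', D * D', D' * N + D * N', hD.mul hD', ?_, ?_⟩
  · rw [map_add, map_mul, map_mul, map_mul, ← e, ← e']; ring
  · rw [map_add, map_add, LinearMap.add_apply, shiftAct_mul_apply D D' Θ',
      shiftAct_mul_apply D N', a', mul_comm D D', shiftAct_mul_apply D', shiftAct_mul_apply D', a]

theorem IsExp.charMul {v₀ : V} {F : Mer V} {Θ : dualLattice Γ → ℂ} (h : IsExp v₀ F Θ)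
    (A : CharRing Γ) : IsExp v₀ (evalChar A * F) (shiftAct A Θ) := by
  obtain ⟨hb, D, N, hD, e, a⟩ := h
  refine ⟨hb.shiftAct A, D, A * N, hD, ?_, ?_⟩
  · rw [map_mul, ← e, mul_assoc]
  · rw [← shiftAct_mul_apply, mul_comm, shiftAct_mul_apply, a, ← shiftAct_mul_apply]

theorem IsExp.smul {v₀ : V} {F : Mer V} {Θ : dualLattice Γ → ℂ} (c : ℂ) (h : IsExp v₀ F Θ) :
    IsExp v₀ (c • F) (c • Θ) := by
  obtain ⟨hb, D, N, hD, e, a⟩ := h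
  refine ⟨hb.smul c, D, c • N, hD, ?_, ?_⟩
  · rw [map_smul, ← e, smul_mul_assoc]
  · rw [map_smul, map_smul, a, LinearMap.smul_apply]

/-- The derivation of formal series corresponding to `∂_v`. -/
def seriesDeriv (v : Cx V) (Θ : dualLattice Γ → ℂ) : dualLattice Γ → ℂ :=
  fun lam => pair (lam : StrongDual ℝ V) v * Θ lam

/-- The Leibniz rule for the action of characters on series. -/
theorem exists_charDeriv (v : Cx V) (A : CharRing Γ) : ∃ A' : CharRing Γ,
    evalChar A' = merDeriv v (evalChar A) ∧ ∀ Θ,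
      seriesDeriv v (shiftAct A Θ) = shiftAct A' Θ + shiftAct A (seriesDeriv v Θ) := by
  induction A using AddMonoidAlgebra.induction_linear with
  | zero =>
    refine ⟨0, ?_, fun Θ => ?_⟩
    · rw [map_zero]; exact (map_zero (merDerivₗ v)).symm
    · funext lam; simp [seriesDeriv]
  | add A B hA hB =>
    obtain ⟨A', e, h⟩ := hA
    obtain ⟨B', e', h'⟩ := hB
    refine ⟨A' + B', ?_, fun Θ => ?_⟩
    · rw [map_add, map_add, merDeriv_add, e, e']
    · have : seriesDeriv v (shiftAct (A + B) Θ) =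
          seriesDeriv v (shiftAct A Θ) + seriesDeriv v (shiftAct B Θ) := by
        rw [map_add]
        exact funext fun lam => mul_add _ _ _
      rw [this, h, h', map_add, map_add, LinearMap.add_apply, LinearMap.add_apply]
      abel
  | single ξ c =>
    refine ⟨single ξ (pair (ξ : StrongDual ℝ V) v * c), ?_, fun Θ => funext fun lam => ?_⟩
    · rw [evalChar_single, evalChar_single, merDeriv_smul, merDeriv_toMer, entireDeriv_expForm,
        toMer_smul, smul_smul, mul_comm]
    · simp only [Pi.add_apply, shiftAct_single, seriesDeriv, Submodule.coe_sub, pair_sub]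
      ring

theorem IsExp.merDeriv {v₀ : V} {F : Mer V} {Θ : dualLattice Γ → ℂ} (h : IsExp v₀ F Θ) (v : Cx V) :
    IsExp v₀ (merDeriv v F) (seriesDeriv v Θ) := by
  obtain ⟨⟨B, hB⟩, D, N, hD, e, a⟩ := h
  obtain ⟨D', eD, hD'⟩ := exists_charDeriv v D
  obtain ⟨N', eN, hN'⟩ := exists_charDeriv v N
  refine ⟨⟨B, fun lam hl => hB lam (right_ne_zero_of_mul hl)⟩, D * D, D * N' - D' * N,
    hD.mul hD, ?_, ?_⟩
  · have h1 : JKResidue.merDeriv v F * evalChar D + F * evalChar D' = evalChar N' := by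
      rw [eD, eN, ← e, merDeriv_mul]; ring
    rw [map_sub, map_mul, map_mul, map_mul, ← h1, ← e]; ring
  · have h0 : seriesDeriv v (deltaZero : dualLattice Γ → ℂ) = 0 := by
      funext lam
      by_cases h : lam = 0
      · simp [seriesDeriv, h, pair_zero]
      · simp [seriesDeriv, deltaZero, h]
    have h1 := hD' Θ
    rw [a, hN', h0, map_zero, add_zero] at h1
    rw [shiftAct_mul_apply, ← sub_eq_iff_eq_add'.2 h1, map_sub, map_sub, LinearMap.sub_apply,
      shiftAct_mul_apply, ← shiftAct_mul_apply D D', mul_comm D D', shiftAct_mul_apply D',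
      shiftAct_mul_apply D', a]

end Expansion

/-! ### Geometric series -/

section Geometric

variable {V : Type*} [NormedAddCommGroup V] [NormedSpace ℝ V] {Γ : Submodule ℤ V}

open AddMonoidAlgebra (single)

theorem evalChar_one_sub_single (γ : dualLattice Γ) (u : ℂ) :
    evalChar (1 - single γ u) = toMer (1 - u • expForm (γ : StrongDual ℝ V)) := by
  rw [map_sub, map_one, evalChar_single, toMer_sub, toMer_one, toMer_smul]

theorem one_sub_smul_expForm_ne_zero {γ : StrongDual ℝ V} (hγ : γ ≠ 0) (u : ℂ) :
    (1 - u • expForm γ : Entire V) ≠ 0 := by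
  intro h
  have h1 : ∀ z : Cx V, u * Complex.exp (pair γ z) = 1 := fun z =>
    (sub_eq_zero.1 (congrFun (congrArg Subtype.val h) z)).symm
  obtain ⟨v, hv⟩ : ∃ v, γ v ≠ 0 := by
    by_contra! h
    exact hγ (ContinuousLinearMap.ext h)
  have h2 := h1 0
  have h3 := h1 (ofReal v)
  rw [map_zero, Complex.exp_zero, mul_one] at h2
  rw [h2, one_mul, pair_ofReal, ← Complex.ofReal_exp] at h3
  exact hv (Real.exp_eq_one_iff _ |>.1 (by exact_mod_cast h3))

theorem geom_mul_cancel {γ : StrongDual ℝ V} (hγ : γ ≠ 0) (u : ℂ) :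
    geom γ u * toMer (1 - u • expForm γ) = 1 :=
  inv_mul_cancel₀ (toMer_ne_zero (one_sub_smul_expForm_ne_zero hγ u))

variable {ι : Type*} [Fintype ι]

/-- The exponents `m`, supported on `s`, that contribute to the coefficient of `e^lam`. -/
def expSet (γ : ι → dualLattice Γ) (s : Finset ι) (lam : dualLattice Γ) : Set (ι → ℕ) :=
  {m | (∀ k ∉ s, m k = 0) ∧ ∑ k, m k • γ k = lam}

/-- The coefficients of the product of the geometric series of `u_k e^{γ_k}`, `k ∈ s`. -/
def geomCoeff (γ : ι → dualLattice Γ) (u : ι → ℂ) (s : Finset ι) (lam : dualLattice Γ) : ℂ :=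
  ∑ᶠ m ∈ expSet γ s lam, ∏ k, u k ^ m k

theorem apply_sum_smul (γ : ι → dualLattice Γ) (m : ι → ℕ) (v₀ : V) :
    ((∑ k, m k • γ k : dualLattice Γ) : StrongDual ℝ V) v₀ =
      ∑ k, m k * (γ k : StrongDual ℝ V) v₀ := by
  rw [AddSubmonoidClass.coe_finsetSum, sum_apply]
  exact Finset.sum_congr rfl fun k _ => by simp

theorem finite_expSet {v₀ : V} {γ : ι → dualLattice Γ}
    (hγ : ∀ k, 0 < (γ k : StrongDual ℝ V) v₀) (s : Finset ι) (lam : dualLattice Γ) :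
    (expSet γ s lam).Finite := by
  classical
  refine (Set.Finite.pi' fun k => Set.finite_le_nat
    ⌊(lam : StrongDual ℝ V) v₀ / (γ k : StrongDual ℝ V) v₀⌋₊).subset ?_
  rintro m ⟨-, rfl⟩ k
  refine Nat.le_floor ((le_div_iff₀ (hγ k)).2 ?_)
  rw [apply_sum_smul]
  exact Finset.single_le_sum (f := fun k => (m k : ℝ) * (γ k : StrongDual ℝ V) v₀)
    (fun j _ => mul_nonneg (Nat.cast_nonneg _) (hγ j).le) (Finset.mem_univ k)

theorem boundedBelow_geomCoeff {v₀ : V} {γ : ι → dualLattice Γ}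
    (hγ : ∀ k, 0 < (γ k : StrongDual ℝ V) v₀) (u : ι → ℂ) (s : Finset ι) :
    BoundedBelow v₀ (geomCoeff γ u s) := by
  refine ⟨0, fun lam hl => ?_⟩
  obtain ⟨m, hm⟩ : (expSet γ s lam).Nonempty := by
    by_contra h
    rw [Set.not_nonempty_iff_eq_empty] at h
    exact hl (by rw [geomCoeff, h, finsum_mem_empty])
  rw [← hm.2, apply_sum_smul]
  exact Finset.sum_nonneg fun j _ => mul_nonneg (Nat.cast_nonneg _) (hγ j).le

theorem geomCoeff_empty (γ : ι → dualLattice Γ) (u : ι → ℂ) :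
    geomCoeff γ u ∅ = deltaZero := by
  funext lam
  rw [deltaZero, geomCoeff]
  by_cases h : lam = 0
  · have : expSet γ ∅ lam = {0} := by
      ext m
      constructor
      · intro hm
        exact funext fun k => hm.1 k (Finset.notMem_empty k)
      · rintro rfl
        exact ⟨fun _ _ => rfl, by simp [h]⟩
    rw [if_pos h, this, finsum_mem_singleton]
    simp
  · have : expSet γ ∅ lam = ∅ := by
      refine Set.eq_empty_iff_forall_notMem.2 fun m hm => h ?_
      rw [← hm.2]
      exact Finset.sum_eq_zero fun k _ => by rw [hm.1 k (Finset.notMem_empty k), zero_smul]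
    rw [if_neg h, this, finsum_mem_empty]

/-- Multiplication by `1 - u_k e^{γ_k}` removes the factor `k`: the exponents `m` are split according
to whether `m k = 0`. -/
theorem geomCoeff_insert [DecidableEq ι] {v₀ : V} {γ : ι → dualLattice Γ}
    (hγ : ∀ k, 0 < (γ k : StrongDual ℝ V) v₀) (u : ι → ℂ) {s : Finset ι} {k : ι} (hk : k ∉ s)
    (lam : dualLattice Γ) :
    geomCoeff γ u (insert k s) lam =
      geomCoeff γ u s lam + u k * geomCoeff γ u (insert k s) (lam - γ k) := by
  let e : (ι → ℕ) → (ι → ℕ) := fun m => m + Pi.single k 1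
  have he : Function.Injective e := fun m m' h => add_right_cancel h
  have hsum : ∀ m : ι → ℕ, ∑ j, e m j • γ j = ∑ j, m j • γ j + γ k := fun m => by
    simp only [e, Pi.add_apply, add_smul, Finset.sum_add_distrib]
    congr 1
    rw [Finset.sum_eq_single k (fun j _ hj => by rw [Pi.single_eq_of_ne hj, zero_smul])
      (fun h => absurd (Finset.mem_univ k) h), Pi.single_eq_same, one_smul]
  have hset : expSet γ (insert k s) lam = expSet γ s lam ∪ e '' expSet γ (insert k s) (lam - γ k) := by
    ext m
    constructor
    · rintro ⟨h1, h2⟩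
      rcases Nat.eq_zero_or_pos (m k) with h0 | h0
      · refine Or.inl ⟨fun j hj => ?_, h2⟩
        rcases eq_or_ne j k with rfl | hjk
        · exact h0
        · exact h1 j fun h => (Finset.mem_insert.1 h).elim hjk hj
      · have hm : e (m - Pi.single k 1) = m := by
          funext j
          rcases eq_or_ne j k with rfl | hjk
          · simp only [e, Pi.add_apply, Pi.sub_apply, Pi.single_eq_same]
            omega
          · simp [e, Pi.single_eq_of_ne hjk]
        refine Or.inr ⟨m - Pi.single k 1, ⟨fun j hj => ?_, ?_⟩, hm⟩
        · rw [Pi.sub_apply, h1 j hj, Nat.zero_sub]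
        · rw [eq_sub_iff_add_eq, ← hsum, hm, h2]
    · rintro (⟨h1, h2⟩ | ⟨m, ⟨h1, h2⟩, rfl⟩)
      · exact ⟨fun j hj => h1 j fun h => hj (Finset.mem_insert_of_mem h), h2⟩
      · refine ⟨fun j hj => ?_, ?_⟩
        · have : j ≠ k := fun h => hj (h ▸ Finset.mem_insert_self k s)
          simp [e, h1 j hj, Pi.single_eq_of_ne this]
        · rw [hsum, h2, sub_add_cancel]
  have hdisj : Disjoint (expSet γ s lam) (e '' expSet γ (insert k s) (lam - γ k)) := by
    rw [Set.disjoint_left]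
    rintro _ hm ⟨m, -, rfl⟩
    have := hm.1 k hk
    simp [e] at this
  rw [geomCoeff, hset, finsum_mem_union hdisj (finite_expSet hγ _ _)
    ((finite_expSet hγ _ _).image _), finsum_mem_image he.injOn]
  congr 1
  rw [geomCoeff, ← smul_eq_mul, smul_finsum_mem (finite_expSet hγ _ _)]
  refine finsum_mem_congr rfl fun m _ => ?_
  rw [smul_eq_mul]
  simp only [e, Pi.add_apply, pow_add, Finset.prod_mul_distrib]
  rw [mul_comm]
  congr 1
  rw [Finset.prod_eq_single k (fun j _ hj => by rw [Pi.single_eq_of_ne hj, pow_zero])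
      (fun h => absurd (Finset.mem_univ k) h), Pi.single_eq_same, pow_one]

theorem shiftAct_prod_geomCoeff {v₀ : V} {γ : ι → dualLattice Γ}
    (hγ : ∀ k, 0 < (γ k : StrongDual ℝ V) v₀) (u : ι → ℂ) (s : Finset ι) :
    shiftAct (∏ k ∈ s, (1 - single (γ k) (u k))) (geomCoeff γ u s) = deltaZero := by
  classical
  induction s using Finset.induction_on with
  | empty => rw [Finset.prod_empty, map_one, geomCoeff_empty]; rfl
  | insert k s hk ih =>
    have : shiftAct (1 - single (γ k) (u k)) (geomCoeff γ u (insert k s)) = geomCoeff γ u s := by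
      funext lam
      rw [map_sub, map_one, LinearMap.sub_apply, Pi.sub_apply, shiftAct_single,
        Module.End.one_apply, geomCoeff_insert hγ u hk lam]
      ring
    rw [Finset.prod_insert hk, mul_comm, shiftAct_mul_apply, this, ih]

theorem isExp_prod_geom {v₀ : V} {γ : ι → dualLattice Γ}
    (hγ : ∀ k, 0 < (γ k : StrongDual ℝ V) v₀) (u : ι → ℂ) (s : Finset ι) :
    IsExp v₀ (∏ k ∈ s, geom (γ k : StrongDual ℝ V) (u k)) (geomCoeff γ u s) := by
  refine ⟨boundedBelow_geomCoeff hγ u s, ∏ k ∈ s, (1 - single (γ k) (u k)), 1, ?_, ?_, ?_⟩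
  · exact Finset.prod_induction _ (IsCancellable v₀) (fun _ _ => IsCancellable.mul)
      isCancellable_one fun k _ => isCancellable_one_sub_single (hγ k) _
  · rw [map_prod, ← Finset.prod_mul_distrib, map_one]
    refine Finset.prod_eq_one fun k _ => ?_
    rw [evalChar_one_sub_single]
    refine geom_mul_cancel (fun h => ?_) _
    have := hγ k
    rw [h] at this
    exact lt_irrefl _ this
  · rw [shiftAct_prod_geomCoeff hγ, map_one]; rfl

theorem IsExpansion.isExp {v₀ : V} {Δ : Finset (StrongDual ℝ V)} (hΔ : ∀ α ∈ Δ, α ∈ dualLattice Γ)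
    (hv₀ : ∀ α ∈ Δ, 0 < α v₀) {F : Mer V} {Θ : dualLattice Γ → ℂ} (h : IsExpansion Γ Δ F Θ) :
    IsExp v₀ F Θ := by
  obtain ⟨c, R, u, β, hβ, rfl, hΘ⟩ := h
  let γ : Fin R → dualLattice Γ := fun k => ⟨β k, hΔ _ (hβ k).2⟩
  have hγ : ∀ k, 0 < (γ k : StrongDual ℝ V) v₀ := fun k => hv₀ _ (hβ k).2
  have key := (isExp_prod_geom hγ u Finset.univ).charMul (AddMonoidAlgebra.ofCoeff c)
  rw [evalChar_eq] at key
  convert key using 1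
  funext lam
  rw [hΘ]
  have hlin : ∀ (A : CharRing Γ) (Φ : dualLattice Γ → ℂ),
      shiftAct A Φ lam = A.coeff.sum fun ξ a => a * Φ (lam - ξ) := fun A Φ => by
    induction A using AddMonoidAlgebra.induction_linear with
    | zero => rw [map_zero]; rfl
    | add A B hA hB =>
      rw [map_add, LinearMap.add_apply, Pi.add_apply, hA, hB, AddMonoidAlgebra.coeff_add,
        Finsupp.sum_add_index']
      · simp
      · intro ξ b c; rw [add_mul]
    | single ξ c =>
      rw [shiftAct_single, AddMonoidAlgebra.coeff_single, Finsupp.sum_single_index (zero_mul _)]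
  rw [hlin]
  refine Finset.sum_congr rfl fun ξ _ => ?_
  dsimp only
  rw [geomCoeff, ← smul_eq_mul, smul_finsum_mem (finite_expSet hγ _ _)]
  have hset : {m : Fin R → ℕ | (ξ : StrongDual ℝ V) + ∑ k, m k • β k = lam} =
      expSet γ Finset.univ (lam - ξ) := by
    ext m
    simp only [expSet, Finset.mem_univ, not_true_eq_false, false_imp_iff, implies_true, true_and,
      Set.mem_ofPred_eq]
    rw [eq_sub_iff_add_eq', Subtype.ext_iff, Submodule.coe_add, AddSubmonoidClass.coe_finsetSum]
    rfl
  exact finsum_mem_congr hset fun m _ => rfl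

end Geometric

/-! ### Presentations of exponential fractions -/

section Presentation

variable {V : Type*} [NormedAddCommGroup V] [NormedSpace ℝ V] {Γ : Submodule ℤ V}
  {Δ : Finset (StrongDual ℝ V)}

open AddMonoidAlgebra (single)

/-- Membership in the ring of exponential fractions, with an explicit common denominator. -/
theorem exists_multiset_presentation (hΔ : ∀ α ∈ Δ, α ∈ dualLattice Γ)
    (h0 : (0 : StrongDual ℝ V) ∉ Δ) {F : Mer V} (hF : F ∈ expRing Γ Δ) :
    ∃ (c : CharRing Γ) (s : Multiset (StrongDual ℝ V × ℂ)), (∀ x ∈ s, x.2 ≠ 0 ∧ x.1 ∈ Δ) ∧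
      F = evalChar c * (s.map fun x => geom x.1 x.2).prod := by
  have hden : ∀ s : Multiset (StrongDual ℝ V × ℂ), (∀ x ∈ s, x.2 ≠ 0 ∧ x.1 ∈ Δ) →
      ∃ D : CharRing Γ, evalChar D * (s.map fun x => geom x.1 x.2).prod = 1 := by
    intro s
    induction s using Multiset.induction_on with
    | empty => exact fun _ => ⟨1, by simp⟩
    | cons x s ih =>
      intro h
      obtain ⟨D, hD⟩ := ih fun y hy => h y (Multiset.mem_cons_of_mem hy)
      have hx := (h x (Multiset.mem_cons_self x s)).2
      refine ⟨(1 - single ⟨x.1, hΔ _ hx⟩ x.2) * D, ?_⟩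
      rw [Multiset.map_cons, Multiset.prod_cons, map_mul, evalChar_one_sub_single]
      have := geom_mul_cancel (γ := x.1) (fun h => h0 (h ▸ hx)) x.2
      calc _ = (geom x.1 x.2 * toMer (1 - x.2 • expForm x.1)) *
            (evalChar D * (s.map fun x => geom x.1 x.2).prod) := by ring
        _ = 1 := by rw [this, hD, one_mul]
  induction hF using Algebra.adjoin_induction with
  | mem F hF =>
    rcases hF with ⟨ξ, hξ, rfl⟩ | ⟨α, hα, u, hu, rfl⟩
    · exact ⟨single ⟨ξ, hξ⟩ 1, 0, by simp, by simp [evalChar_single]⟩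
    · exact ⟨1, {(α, u)}, by simp [hu, hα], by simp⟩
  | algebraMap r => exact ⟨algebraMap ℂ _ r, 0, by simp, by rw [AlgHom.commutes]; simp⟩
  | add F G _ _ hF hG =>
    obtain ⟨c, s, hs, rfl⟩ := hF
    obtain ⟨d, t, ht, rfl⟩ := hG
    obtain ⟨D, hD⟩ := hden s hs
    obtain ⟨E, hE⟩ := hden t ht
    refine ⟨c * E + d * D, s + t, fun x hx => (Multiset.mem_add.1 hx).elim (hs x) (ht x), ?_⟩
    rw [Multiset.map_add, Multiset.prod_add, map_add, map_mul, map_mul]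
    linear_combination (-(evalChar c * (s.map fun x => geom x.1 x.2).prod)) * hE -
      (evalChar d * (t.map fun x => geom x.1 x.2).prod) * hD
  | mul F G _ _ hF hG =>
    obtain ⟨c, s, hs, rfl⟩ := hF
    obtain ⟨d, t, ht, rfl⟩ := hG
    refine ⟨c * d, s + t, fun x hx => (Multiset.mem_add.1 hx).elim (hs x) (ht x), ?_⟩
    rw [Multiset.map_add, Multiset.prod_add, map_mul]
    ring

/-- The series `r⁺(F)` is the expansion of `F`, and it comes from a presentation of `F`. -/
theorem isExp_rPlus (hΔ : ∀ α ∈ Δ, α ∈ dualLattice Γ) {v₀ : V}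
    (hv₀ : ∀ α ∈ Δ, 0 < α v₀) {F : Mer V} (hF : F ∈ expRing Γ Δ) :
    IsExp v₀ F (rPlus Γ Δ F) ∧
      ∃ (c : dualLattice Γ →₀ ℂ) (R : ℕ) (u : Fin R → ℂ) (β : Fin R → StrongDual ℝ V),
        (∀ k, u k ≠ 0 ∧ β k ∈ Δ) ∧
        F = toMer (c.sum fun ξ a => a • expForm (ξ : StrongDual ℝ V)) * ∏ k, geom (β k) (u k) := by
  have h0 : (0 : StrongDual ℝ V) ∉ Δ := fun h => lt_irrefl _ (hv₀ 0 h)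
  obtain ⟨c, s, hs, e⟩ := exists_multiset_presentation hΔ h0 hF
  have hpres : ∃ (c : dualLattice Γ →₀ ℂ) (R : ℕ) (u : Fin R → ℂ) (β : Fin R → StrongDual ℝ V),
        (∀ k, u k ≠ 0 ∧ β k ∈ Δ) ∧
        F = toMer (c.sum fun ξ a => a • expForm (ξ : StrongDual ℝ V)) * ∏ k, geom (β k) (u k) := by
    refine ⟨c.coeff, s.toList.length, fun k => (s.toList.get k).2, fun k => (s.toList.get k).1,
      fun k => hs _ (Multiset.mem_toList.1 (List.get_mem _ _)), ?_⟩
    rw [e, evalChar_eq]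
    congr 1
    have : s = Multiset.map s.toList.get Finset.univ.val := by
      rw [Fin.univ_val_map, List.ofFn_get, Multiset.coe_toList]
    conv_lhs => rw [this, Multiset.map_map]
    rfl
  refine ⟨?_, hpres⟩
  obtain ⟨c, R, u, β, hβ, e⟩ := hpres
  have hex : ∃ Θ, IsExpansion Γ Δ F Θ := ⟨_, c, R, u, β, hβ, e, fun lam => rfl⟩
  have : IsExpansion Γ Δ F (rPlus Γ Δ F) := by
    rw [rPlus, dif_pos hex]
    exact hex.choose_spec
  exact this.isExp hΔ hv₀

end Presentation

/-! ### Reduction of exponential fractions -/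

section Reduction

variable {V : Type*} [NormedAddCommGroup V] [NormedSpace ℝ V] {Γ : Submodule ℤ V}

/-- The monomial `u e^γ`. -/
def mon (γ : StrongDual ℝ V) (u : ℂ) : Mer V := u • toMer (expForm γ)

theorem toMer_one_sub_smul (γ : StrongDual ℝ V) (u : ℂ) :
    toMer (1 - u • expForm γ) = 1 - mon γ u := by
  rw [toMer_sub, toMer_one, toMer_smul, mon]

theorem geom_eq (γ : StrongDual ℝ V) (u : ℂ) : geom γ u = (1 - mon γ u)⁻¹ := by
  rw [geom, toMer_one_sub_smul]

theorem one_sub_mon_ne_zero {γ : StrongDual ℝ V} (hγ : γ ≠ 0) (u : ℂ) : 1 - mon γ u ≠ 0 := by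
  rw [← toMer_one_sub_smul]
  exact toMer_ne_zero (one_sub_smul_expForm_ne_zero hγ u)

theorem geom_mul_one_sub {γ : StrongDual ℝ V} (hγ : γ ≠ 0) (u : ℂ) :
    geom γ u * (1 - mon γ u) = 1 := by
  rw [geom_eq, inv_mul_cancel₀ (one_sub_mon_ne_zero hγ u)]

theorem mon_mul (γ γ' : StrongDual ℝ V) (u u' : ℂ) :
    mon γ u * mon γ' u' = mon (γ + γ') (u * u') := by
  rw [mon, mon, mon, expForm_add, toMer_mul, smul_mul_smul_comm]

theorem mon_zero_one : mon (0 : StrongDual ℝ V) 1 = 1 := by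
  rw [mon, expForm_zero, toMer_one, one_smul]

theorem mon_pow (γ : StrongDual ℝ V) (u : ℂ) (n : ℕ) : mon γ u ^ n = mon (n • γ) (u ^ n) := by
  induction n with
  | zero => rw [pow_zero, pow_zero, zero_smul, mon_zero_one]
  | succ n ih => rw [pow_succ, ih, mon_mul, ← succ_nsmul, ← pow_succ]

theorem mon_prod {ι : Type*} (s : Finset ι) (γ : ι → StrongDual ℝ V) (u : ι → ℂ) :
    ∏ k ∈ s, mon (γ k) (u k) = mon (∑ k ∈ s, γ k) (∏ k ∈ s, u k) := by
  classical
  induction s using Finset.induction_on with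
  | empty => rw [Finset.prod_empty, Finset.sum_empty, Finset.prod_empty, mon_zero_one]
  | insert k s hk ih =>
    rw [Finset.prod_insert hk, Finset.sum_insert hk, Finset.prod_insert hk, ih, mon_mul]

theorem expForm_mul_mon (ξ γ : StrongDual ℝ V) (u : ℂ) :
    toMer (expForm ξ) * mon γ u = u • toMer (expForm (ξ + γ)) := by
  rw [mon, expForm_add, toMer_mul, mul_smul_comm]

/-- Passage to a multiple of the exponent: `1 / (1 - y) = ∑_{j < n} y ^ j / (1 - y ^ n)`. -/
theorem geom_eq_sum {γ : StrongDual ℝ V} (hγ : γ ≠ 0) (u : ℂ) {n : ℕ} (hn : n ≠ 0) :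
    geom γ u = ∑ j ∈ Finset.range n, mon (j • γ) (u ^ j) * geom (n • γ) (u ^ n) := by
  have hnγ : n • γ ≠ 0 := by
    rw [← Nat.cast_smul_eq_nsmul ℝ]
    exact smul_ne_zero (Nat.cast_ne_zero.2 hn) hγ
  have h1 := one_sub_mon_ne_zero hγ u
  have h2 := one_sub_mon_ne_zero hnγ (u ^ n)
  rw [← Finset.sum_mul, geom_eq, geom_eq, ← div_eq_mul_inv, eq_div_iff h2, inv_mul_eq_iff_eq_mul₀ h1,
    ← mon_pow]
  simp_rw [← mon_pow]
  exact (mul_neg_geom_sum (mon γ u) n).symm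

/-- Reversal of the exponent: `1 / (1 - y) = -y⁻¹ / (1 - y⁻¹)`. -/
theorem geom_eq_neg {γ : StrongDual ℝ V} (hγ : γ ≠ 0) {u : ℂ} (hu : u ≠ 0) :
    geom γ u = -(mon (-γ) u⁻¹ * geom (-γ) u⁻¹) := by
  have h1 := one_sub_mon_ne_zero hγ u
  have h2 := one_sub_mon_ne_zero (neg_ne_zero.2 hγ) u⁻¹
  have h3 : mon γ u * mon (-γ) u⁻¹ = 1 := by
    rw [mon_mul, add_neg_cancel, mul_inv_cancel₀ hu, mon_zero_one]
  rw [geom_eq, geom_eq, ← div_eq_mul_inv, ← neg_div, eq_div_iff h2, inv_mul_eq_iff_eq_mul₀ h1]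
  linear_combination -h3

theorem merDeriv_geom {γ : StrongDual ℝ V} (hγ : γ ≠ 0) (u : ℂ) (v : Cx V) :
    merDeriv v (geom γ u) = pair γ v • ((geom γ u - 1) * geom γ u) := by
  have h1 := one_sub_mon_ne_zero hγ u
  have h2 : merDeriv v (1 - mon γ u) = -(pair γ v • mon γ u) := by
    rw [← toMer_one_sub_smul, merDeriv_toMer]
    have : entireDeriv v (1 - u • expForm γ) = -(pair γ v • u • expForm γ) := by
      rw [sub_eq_add_neg, ← neg_smul, entireDeriv_add, entireDeriv_one, entireDeriv_smul,
        entireDeriv_expForm, zero_add, neg_smul, smul_comm]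
    rw [this, toMer_neg, toMer_smul, toMer_smul, mon]
  rw [geom_eq, merDeriv_inv v h1, h2, neg_neg, smul_mul_assoc]
  congr 1
  field_simp
  ring

/-- The logarithmic derivative of an exponential fraction. -/
theorem merDeriv_expForm_mul_prod_geom {ι : Type*} (ξ : StrongDual ℝ V) {γ : ι → StrongDual ℝ V}
    (u : ι → ℂ) (v : Cx V) (B : Finset ι) (hγ : ∀ k ∈ B, γ k ≠ 0) :
    merDeriv v (toMer (expForm ξ) * ∏ k ∈ B, geom (γ k) (u k)) =
      pair ξ v • (toMer (expForm ξ) * ∏ k ∈ B, geom (γ k) (u k)) +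
      ∑ j ∈ B, pair (γ j) v • ((geom (γ j) (u j) - 1) *
        (toMer (expForm ξ) * ∏ k ∈ B, geom (γ k) (u k))) := by
  classical
  induction B using Finset.induction_on with
  | empty =>
    rw [Finset.prod_empty, mul_one, merDeriv_toMer, entireDeriv_expForm, toMer_smul,
      Finset.sum_empty, add_zero]
  | insert i B hi ih =>
    have ih := ih fun k hk => hγ k (Finset.mem_insert_of_mem hk)
    rw [Finset.prod_insert hi, Finset.sum_insert hi]
    set E := toMer (expForm ξ) * ∏ k ∈ B, geom (γ k) (u k) with hE
    have e : toMer (expForm ξ) * (geom (γ i) (u i) * ∏ k ∈ B, geom (γ k) (u k)) =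
        geom (γ i) (u i) * E := by rw [hE]; ring
    rw [e, merDeriv_mul, ih, merDeriv_geom (hγ i (Finset.mem_insert_self i B))]
    simp only [mul_add, mul_smul_comm, Finset.mul_sum]
    have e2 : ∀ j, geom (γ i) (u i) * ((geom (γ j) (u j) - 1) * E) =
        (geom (γ j) (u j) - 1) * (geom (γ i) (u i) * E) := fun j => by ring
    simp_rw [e2]
    have e3 : E * ((geom (γ i) (u i) - 1) * geom (γ i) (u i)) =
        (geom (γ i) (u i) - 1) * (geom (γ i) (u i) * E) := by ring
    rw [e3]
    abel

variable {ι : Type*}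

/-- `e^ξ ∏_{k ∈ A} 1 / (1 - u_k e^{γ_k})` lies in `L` for all integral `ξ` such that `x + ξ` lies in the
zonotope `∑_{k ∈ A} [0, 1] γ_k`. -/
def ZonotopeMem (Γ : Submodule ℤ V) (L : Submodule ℂ (Mer V)) (x : StrongDual ℝ V) (A : Finset ι)
    (γ : ι → StrongDual ℝ V) (u : ι → ℂ) : Prop :=
  ∀ ξ ∈ dualLattice Γ, ∀ θ : ι → ℝ, (∀ k ∈ A, 0 ≤ θ k ∧ θ k ≤ 1) →
    x + ξ = ∑ k ∈ A, θ k • γ k → toMer (expForm ξ) * ∏ k ∈ A, geom (γ k) (u k) ∈ L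

variable {L : Submodule ℂ (Mer V)} {x : StrongDual ℝ V}

theorem ZonotopeMem.congr {A : Finset ι} {γ γ' : ι → StrongDual ℝ V} {u u' : ι → ℂ}
    (h : ZonotopeMem Γ L x A γ u) (hγ : ∀ k ∈ A, γ k = γ' k) (hu : ∀ k ∈ A, u k = u' k) :
    ZonotopeMem Γ L x A γ' u' := by
  intro ξ hξ θ hθ e
  have h1 : ∏ k ∈ A, geom (γ' k) (u' k) = ∏ k ∈ A, geom (γ k) (u k) :=
    Finset.prod_congr rfl fun k hk => by rw [hγ k hk, hu k hk]
  rw [h1]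
  refine h ξ hξ θ hθ (e.trans (Finset.sum_congr rfl fun k hk => by rw [hγ k hk]))

section Rescale

variable [DecidableEq ι] {A : Finset ι} {γ : ι → StrongDual ℝ V} {u : ι → ℂ} {k : ι}

theorem prod_geom_update (hk : k ∈ A) (γ : ι → StrongDual ℝ V) (u : ι → ℂ) (γ₀ : StrongDual ℝ V)
    (u₀ : ℂ) : ∏ j ∈ A, geom (Function.update γ k γ₀ j) (Function.update u k u₀ j) =
      geom γ₀ u₀ * ∏ j ∈ A.erase k, geom (γ j) (u j) := by
  rw [← Finset.mul_prod_erase A _ hk, Function.update_self, Function.update_self]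
  congr 1
  refine Finset.prod_congr rfl fun j hj => ?_
  rw [Function.update_of_ne (Finset.ne_of_mem_erase hj), Function.update_of_ne (Finset.ne_of_mem_erase hj)]

theorem sum_smul_update (hk : k ∈ A) (γ : ι → StrongDual ℝ V) (θ : ι → ℝ) (γ₀ : StrongDual ℝ V)
    (t : ℝ) : ∑ j ∈ A, Function.update θ k t j • Function.update γ k γ₀ j =
      t • γ₀ + ∑ j ∈ A.erase k, θ j • γ j := by
  rw [← Finset.add_sum_erase A _ hk, Function.update_self, Function.update_self]
  congr 1
  refine Finset.sum_congr rfl fun j hj => ?_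
  rw [Function.update_of_ne (Finset.ne_of_mem_erase hj), Function.update_of_ne (Finset.ne_of_mem_erase hj)]

theorem update_mem_Icc {θ : ι → ℝ} (hθ : ∀ j ∈ A.erase k, 0 ≤ θ j ∧ θ j ≤ 1) {t : ℝ}
    (ht : 0 ≤ t ∧ t ≤ 1) :
    ∀ j ∈ A, 0 ≤ Function.update θ k t j ∧ Function.update θ k t j ≤ 1 := by
  intro j hj
  rcases eq_or_ne j k with rfl | h
  · rwa [Function.update_self]
  · rw [Function.update_of_ne h]; exact hθ j (Finset.mem_erase.2 ⟨h, hj⟩)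

/-- In `1 / (1 - y) = ∑_{j < n} y ^ j / (1 - y ^ n)` the coefficient `θ` becomes `(θ + j) / n`. -/
theorem ZonotopeMem.of_nsmul (hk : k ∈ A) (hγ : γ k ∈ dualLattice Γ) (hγ0 : γ k ≠ 0) {n : ℕ}
    (hn : n ≠ 0)
    (h : ZonotopeMem Γ L x A (Function.update γ k (n • γ k)) (Function.update u k (u k ^ n))) :
    ZonotopeMem Γ L x A γ u := by
  intro ξ hξ θ hθ e
  rw [← Finset.mul_prod_erase A _ hk, geom_eq_sum hγ0 _ hn, Finset.sum_mul, Finset.mul_sum]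
  refine Submodule.sum_mem _ fun j hj => ?_
  have hn' : (0 : ℝ) < n := Nat.cast_pos.2 (Nat.pos_of_ne_zero hn)
  have key := h (ξ + j • γ k) (add_mem hξ (Submodule.smul_of_tower_mem _ j hγ))
    (Function.update θ k ((θ k + j) / n)) (update_mem_Icc (fun j hj => hθ j (Finset.mem_of_mem_erase hj)) ⟨?_, ?_⟩) ?_
  · rw [prod_geom_update hk] at key
    have e2 : toMer (expForm ξ) * (mon (j • γ k) (u k ^ j) * geom (n • γ k) (u k ^ n) *
        ∏ k ∈ A.erase k, geom (γ k) (u k)) = u k ^ j • (toMer (expForm (ξ + j • γ k)) *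
          (geom (n • γ k) (u k ^ n) * ∏ k ∈ A.erase k, geom (γ k) (u k))) := by
      rw [← smul_mul_assoc, ← expForm_mul_mon]; ring
    rw [e2]
    exact Submodule.smul_mem _ _ key
  · exact div_nonneg (add_nonneg (hθ k hk).1 (Nat.cast_nonneg _)) hn'.le
  · rw [div_le_one hn']
    have h1 : (j : ℝ) + 1 ≤ n := by exact_mod_cast Finset.mem_range.1 hj
    linarith [(hθ k hk).2]
  · rw [sum_smul_update hk, ← add_assoc, e, ← Finset.add_sum_erase A _ hk,
      ← Nat.cast_smul_eq_nsmul ℝ, ← Nat.cast_smul_eq_nsmul ℝ, smul_smul, div_mul_cancel₀ _ hn'.ne',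
      add_smul]
    abel

/-- In `1 / (1 - y) = -y⁻¹ / (1 - y⁻¹)` the coefficient `θ` becomes `1 - θ`. -/
theorem ZonotopeMem.of_neg (hk : k ∈ A) (hγ : γ k ∈ dualLattice Γ) (hγ0 : γ k ≠ 0)
    (hu : u k ≠ 0)
    (h : ZonotopeMem Γ L x A (Function.update γ k (-γ k)) (Function.update u k (u k)⁻¹)) :
    ZonotopeMem Γ L x A γ u := by
  intro ξ hξ θ hθ e
  rw [← Finset.mul_prod_erase A _ hk, geom_eq_neg hγ0 hu]
  have key := h (ξ + -γ k) (add_mem hξ (neg_mem hγ))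
    (Function.update θ k (1 - θ k)) (update_mem_Icc (fun j hj => hθ j (Finset.mem_of_mem_erase hj)) ⟨?_, ?_⟩) ?_
  · rw [prod_geom_update hk] at key
    have e2 : toMer (expForm ξ) * (-(mon (-γ k) (u k)⁻¹ * geom (-γ k) (u k)⁻¹) *
        ∏ k ∈ A.erase k, geom (γ k) (u k)) = (-(u k)⁻¹) • (toMer (expForm (ξ + -γ k)) *
          (geom (-γ k) (u k)⁻¹ * ∏ k ∈ A.erase k, geom (γ k) (u k))) := by
      rw [neg_smul, ← smul_mul_assoc, ← expForm_mul_mon]; ring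
    rw [e2]
    exact Submodule.smul_mem _ _ key
  · linarith [(hθ k hk).2]
  · linarith [(hθ k hk).1]
  · rw [sum_smul_update hk, ← add_assoc, e, ← Finset.add_sum_erase A _ hk]
    module

theorem ZonotopeMem.of_zsmul_update (hk : k ∈ A) (hγ : γ k ∈ dualLattice Γ) (hγ0 : γ k ≠ 0)
    (hu : u k ≠ 0) {d : ℤ} (hd : d ≠ 0)
    (h : ZonotopeMem Γ L x A (Function.update γ k (d • γ k)) (Function.update u k (u k ^ d))) :
    ZonotopeMem Γ L x A γ u := by
  obtain ⟨n, rfl | rfl⟩ := d.eq_nat_or_neg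
  · refine ZonotopeMem.of_nsmul hk hγ hγ0 (n := n) (by exact_mod_cast hd) ?_
    rwa [natCast_zsmul, zpow_natCast] at h
  · have hn : n ≠ 0 := by rintro rfl; exact hd rfl
    refine ZonotopeMem.of_nsmul hk hγ hγ0 hn (ZonotopeMem.of_neg hk ?_ ?_ ?_ ?_)
    · rw [Function.update_self]; exact Submodule.smul_of_tower_mem _ n hγ
    · rw [Function.update_self, ← Nat.cast_smul_eq_nsmul ℝ]
      exact smul_ne_zero (Nat.cast_ne_zero.2 hn) hγ0
    · rw [Function.update_self]; exact pow_ne_zero n hu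
    · rw [Function.update_self, Function.update_self, Function.update_idem, Function.update_idem]
      rwa [neg_smul, natCast_zsmul, zpow_neg, zpow_natCast] at h

/-- All the exponents may be replaced by nonzero integral multiples. -/
theorem ZonotopeMem.of_zsmul {d : ι → ℤ} (hγ : ∀ k ∈ A, γ k ∈ dualLattice Γ)
    (hγ0 : ∀ k ∈ A, γ k ≠ 0) (hu : ∀ k ∈ A, u k ≠ 0) (hd : ∀ k ∈ A, d k ≠ 0)
    (h : ZonotopeMem Γ L x A (fun k => d k • γ k) fun k => u k ^ d k) :
    ZonotopeMem Γ L x A γ u := by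
  have key : ∀ B ⊆ A, ZonotopeMem Γ L x A (fun k => if k ∈ B then d k • γ k else γ k)
      (fun k => if k ∈ B then u k ^ d k else u k) → ZonotopeMem Γ L x A γ u := by
    intro B
    induction B using Finset.induction_on with
    | empty => exact fun _ h => h.congr (fun k _ => by simp) (fun k _ => by simp)
    | insert i B hi ih =>
      intro hB h
      have hiA := hB (Finset.mem_insert_self i B)
      refine ih (fun k hk => hB (Finset.mem_insert_of_mem hk))
        (ZonotopeMem.of_zsmul_update (d := d i) hiA ?_ ?_ ?_ (hd i hiA) (h.congr ?_ ?_))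
      · rw [if_neg hi]; exact hγ i hiA
      · rw [if_neg hi]; exact hγ0 i hiA
      · rw [if_neg hi]; exact hu i hiA
      all_goals
        intro k hk
        rcases eq_or_ne k i with rfl | hki
        · simp [hi]
        · simp [hki]
  exact key A subset_rfl (h.congr (fun k hk => by rw [if_pos hk]) fun k hk => by rw [if_pos hk])

end Rescale

end Reduction

/-! ### Reduction along linear relations -/

section Circuit

variable {V : Type*} [NormedAddCommGroup V] [NormedSpace ℝ V] {Γ : Submodule ℤ V}

/-- Telescoping of `1 - ∏ y_k`, with the factors ordered by increasing `θ_k`: here `S k` is the set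
of the factors that come before `k`. The order keeps the points in the zonotope in the reductions
below. -/
theorem exists_telescoping {ι : Type*} [DecidableEq ι] (θ : ι → ℝ) (K : Finset ι) :
    ∃ S : ι → Finset ι, (∀ k ∈ K, S k ⊆ K ∧ k ∉ S k ∧ (∀ j ∈ S k, θ j ≤ θ k) ∧
      ∀ j ∈ K, j ∉ S k → θ k ≤ θ j) ∧
      ∀ {R : Type _} [CommRing R] (y : ι → R),
        1 - ∏ k ∈ K, y k = ∑ k ∈ K, (∏ j ∈ S k, y j) * (1 - y k) := by
  induction K using Finset.induction_on_max_value θ with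
  | empty => exact ⟨fun _ => ∅, by simp, by simp⟩
  | insert a s ha hmax ih =>
    obtain ⟨S, hS, hy⟩ := ih
    refine ⟨Function.update S a s, fun k hk => ?_, fun y => ?_⟩
    · rcases Finset.mem_insert.1 hk with rfl | hks
      · rw [Function.update_self]
        refine ⟨Finset.subset_insert _ _, ha, hmax, fun j hj hjs => ?_⟩
        rcases Finset.mem_insert.1 hj with rfl | h
        exacts [le_rfl, absurd h hjs]
      · have hka : k ≠ a := fun h => ha (h ▸ hks)
        rw [Function.update_of_ne hka]
        obtain ⟨h1, h2, h3, h4⟩ := hS k hks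
        refine ⟨h1.trans (Finset.subset_insert _ _), h2, h3, fun j hj hjs => ?_⟩
        rcases Finset.mem_insert.1 hj with rfl | h
        exacts [hmax k hks, h4 j h hjs]
    · rw [Finset.sum_insert ha, Function.update_self, Finset.prod_insert ha]
      have : ∑ k ∈ s, (∏ j ∈ Function.update S a s k, y j) * (1 - y k) = 1 - ∏ k ∈ s, y k := by
        rw [hy]
        refine Finset.sum_congr rfl fun k hk => ?_
        rw [Function.update_of_ne (show k ≠ a from fun h => ha (h ▸ hk))]
      rw [this]
      ring

variable {ι : Type*} [DecidableEq ι] {L : Submodule ℂ (Mer V)} {x : StrongDual ℝ V}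
  {A K : Finset ι} {γ : ι → StrongDual ℝ V} {u : ι → ℂ}

theorem sum_indicator_smul {S A : Finset ι} (hS : S ⊆ A) (γ : ι → StrongDual ℝ V) :
    ∑ j ∈ A, (if j ∈ S then (1 : ℝ) else 0) • γ j = ∑ j ∈ S, γ j := by
  simp_rw [ite_smul, one_smul, zero_smul]
  rw [Finset.sum_ite_mem, Finset.inter_eq_right.2 hS]

theorem sum_shift_smul {S K A : Finset ι} (hS : S ⊆ A) (hK : K ⊆ A) (θ : ι → ℝ)
    (γ : ι → StrongDual ℝ V) (c : ℝ) :
    ∑ j ∈ A, (θ j + (if j ∈ S then 1 else 0) - c * (if j ∈ K then 1 else 0)) • γ j =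
      ∑ j ∈ A, θ j • γ j + ∑ j ∈ S, γ j + (-c) • ∑ j ∈ K, γ j := by
  rw [← sum_indicator_smul hS γ, ← sum_indicator_smul hK γ, Finset.smul_sum,
    ← Finset.sum_add_distrib, ← Finset.sum_add_distrib]
  exact Finset.sum_congr rfl fun j _ => by module

/-- Reduction along a relation `∑_K γ_k = 0` for which `∏_K u_k e^{γ_k} ≠ 1`: the number of factors
decreases. -/
theorem ZonotopeMem.of_erase (hKA : K ⊆ A) (hγ : ∀ k ∈ A, γ k ∈ dualLattice Γ)
    (hγ0 : ∀ k ∈ A, γ k ≠ 0) (hK : ∑ k ∈ K, γ k = 0) (hu : ∏ k ∈ K, u k ≠ 1)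
    (h : ∀ k ∈ K, ZonotopeMem Γ L x (A.erase k) γ u) : ZonotopeMem Γ L x A γ u := by
  intro ξ hξ θ hθ e
  obtain ⟨S, hS, hy⟩ := exists_telescoping θ K
  have h1 := hy (fun k => mon (γ k) (u k))
  have hC : (1 - ∏ k ∈ K, u k : ℂ) ≠ 0 := sub_ne_zero.2 hu.symm
  set E := toMer (expForm ξ) * ∏ k ∈ A, geom (γ k) (u k) with hE
  have h2 : (1 - ∏ k ∈ K, u k : ℂ) • E = ∑ k ∈ K, (∏ j ∈ S k, u j) •
      (toMer (expForm (ξ + ∑ j ∈ S k, γ j)) * ∏ j ∈ A.erase k, geom (γ j) (u j)) := by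
    have h3 : (1 - ∏ k ∈ K, u k : ℂ) • E = (1 - ∏ k ∈ K, mon (γ k) (u k)) * E := by
      rw [mon_prod, hK, mon, expForm_zero, toMer_one, sub_smul, one_smul, sub_mul, one_mul,
        smul_one_mul]
    rw [h3, h1, Finset.sum_mul]
    refine Finset.sum_congr rfl fun k hk => ?_
    rw [← smul_mul_assoc, ← expForm_mul_mon, mon_prod, hE, ← Finset.mul_prod_erase A _ (hKA hk)]
    linear_combination (toMer (expForm ξ) * mon (∑ k ∈ S k, γ k) (∏ k ∈ S k, u k) *
      ∏ x ∈ A.erase k, geom (γ x) (u x)) * geom_mul_one_sub (hγ0 k (hKA hk)) (u k)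
  have h4 : (1 - ∏ k ∈ K, u k : ℂ) • E ∈ L := by
    rw [h2]
    refine Submodule.sum_mem _ fun k hk => Submodule.smul_mem _ _ ?_
    obtain ⟨s1, s2, s3, s4⟩ := hS k hk
    have hkA := hKA hk
    -- subtracting `θ k` times the relation removes the coefficient of `k`; the others stay in `[0, 1]`
    refine h k hk _ (add_mem hξ (Submodule.sum_mem _ fun j hj => hγ j (hKA (s1 hj))))
      (fun j => θ j + (if j ∈ S k then 1 else 0) - θ k * (if j ∈ K then 1 else 0)) (fun j hj => ?_) ?_
    · have hjA := Finset.mem_of_mem_erase hj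
      by_cases hjK : j ∈ K
      · by_cases hjS : j ∈ S k
        · have := s3 j hjS
          simp only [hjK, hjS, if_true]
          constructor <;> linarith [hθ j hjA, hθ k hkA]
        · have := s4 j hjK hjS
          simp only [hjK, hjS, if_true, if_false]
          constructor <;> linarith [hθ j hjA, hθ k hkA]
      · have hjS : j ∉ S k := fun h => hjK (s1 h)
        simp only [hjK, hjS, if_false]
        constructor <;> linarith [hθ j hjA]
    · have hzero : (θ k + (if k ∈ S k then 1 else 0) - θ k * (if k ∈ K then 1 else 0)) • γ k = 0 := by
        simp [s2, hk]
      rw [Finset.sum_erase (f := fun j => (θ j + (if j ∈ S k then 1 else 0) -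
        θ k * (if j ∈ K then 1 else 0)) • γ j) _ hzero, sum_shift_smul (s1.trans hKA) hKA, hK,
        smul_zero, add_zero, ← add_assoc, e]
  have := Submodule.smul_mem L (1 - ∏ k ∈ K, u k : ℂ)⁻¹ h4
  rwa [inv_smul_smul₀ hC] at this

/-- Reduction along a relation `∑_K γ_k = 0` for which `∏_K u_k e^{γ_k} = 1`: a factor with index
in `K` is replaced by a copy of the factor with index `k₀`. -/
theorem ZonotopeMem.of_update {k₀ : ι} (hKA : K ⊆ A) (hk₀ : k₀ ∈ K)
    (hγ : ∀ k ∈ A, γ k ∈ dualLattice Γ)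
    (hγ0 : ∀ k ∈ A, γ k ≠ 0) (hK : ∑ k ∈ K, γ k = 0) (hu : ∏ k ∈ K, u k = 1)
    (h : ∀ k ∈ K, k ≠ k₀ → ZonotopeMem Γ L x A (Function.update γ k (γ k₀))
      (Function.update u k (u k₀))) : ZonotopeMem Γ L x A γ u := by
  intro ξ hξ θ hθ e
  obtain ⟨S, hS, hy⟩ := exists_telescoping θ (K.erase k₀)
  have h1 := hy (fun k => mon (γ k) (u k))
  set E := toMer (expForm ξ) * ∏ k ∈ A, geom (γ k) (u k) with hE
  have hprod : mon (γ k₀) (u k₀) * ∏ k ∈ K.erase k₀, mon (γ k) (u k) = 1 := by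
    rw [Finset.mul_prod_erase K (fun k => mon (γ k) (u k)) hk₀, mon_prod, hK, hu, mon_zero_one]
  have hk₀A := hKA hk₀
  have h2 : E = -∑ k ∈ K.erase k₀, (u k₀ * ∏ j ∈ S k, u j) •
      (toMer (expForm (ξ + (γ k₀ + ∑ j ∈ S k, γ j))) * (geom (γ k₀) (u k₀) *
        ∏ j ∈ A.erase k, geom (γ j) (u j))) := by
    have h3 : ∀ k ∈ K.erase k₀, (u k₀ * ∏ j ∈ S k, u j) •
      (toMer (expForm (ξ + (γ k₀ + ∑ j ∈ S k, γ j))) * (geom (γ k₀) (u k₀) *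
        ∏ j ∈ A.erase k, geom (γ j) (u j))) =
        (mon (γ k₀) (u k₀) * geom (γ k₀) (u k₀) * E) *
          ((∏ j ∈ S k, mon (γ j) (u j)) * (1 - mon (γ k) (u k))) := fun k hk => by
      have hkA := hKA (Finset.mem_of_mem_erase hk)
      rw [← smul_mul_assoc, ← expForm_mul_mon, ← mon_mul, mon_prod, hE,
        ← Finset.mul_prod_erase A _ hkA]
      linear_combination (-(toMer (expForm ξ) * mon (γ k₀) (u k₀) *
        mon (∑ k ∈ S k, γ k) (∏ k ∈ S k, u k) * geom (γ k₀) (u k₀) *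
        ∏ x ∈ A.erase k, geom (γ x) (u x))) * geom_mul_one_sub (hγ0 k hkA) (u k)
    rw [Finset.sum_congr rfl h3, ← Finset.mul_sum, ← h1]
    linear_combination (-E) * geom_mul_one_sub (hγ0 k₀ hk₀A) (u k₀) +
      (-(geom (γ k₀) (u k₀) * E)) * hprod
  rw [h2]
  refine Submodule.neg_mem _ (Submodule.sum_mem _ fun k hk => Submodule.smul_mem _ _ ?_)
  obtain ⟨hkne, hkK⟩ := Finset.mem_erase.1 hk
  have hkA := hKA hkK
  obtain ⟨s1, s2, s3, s4⟩ := hS k hk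
  have s1K : S k ⊆ K := s1.trans (Finset.erase_subset _ _)
  have hk₀S : k₀ ∉ S k := fun h => (Finset.mem_erase.1 (s1 h)).1 rfl
  -- the total coefficient `θ k₀ + 1 - θ k` of `γ k₀` is shared equally between the two copies
  set t : ℝ := (θ k₀ + 1 - θ k) / 2 with ht
  have htI : 0 ≤ t ∧ t ≤ 1 := by
    constructor <;> rw [ht] <;> linarith [hθ k₀ hk₀A, hθ k hkA]
  let θ₁ : ι → ℝ := fun j => θ j + (if j ∈ S k then 1 else 0) - θ k * (if j ∈ K then 1 else 0)
  let θ₂ : ι → ℝ := Function.update θ₁ k₀ t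
  have key := h k hkK hkne (ξ + (γ k₀ + ∑ j ∈ S k, γ j))
    (add_mem hξ (add_mem (hγ k₀ hk₀A) (Submodule.sum_mem _ fun j hj => hγ j (hKA (s1K hj)))))
    (Function.update θ₂ k t) (update_mem_Icc ?_ htI) ?_
  · rwa [prod_geom_update hkA] at key
  · intro j hj
    obtain ⟨hjk, hjA⟩ := Finset.mem_erase.1 hj
    rcases eq_or_ne j k₀ with rfl | hjk₀
    · simpa only [θ₂, Function.update_self] using htI
    · simp only [θ₂, Function.update_of_ne hjk₀, θ₁]
      by_cases hjK : j ∈ K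
      · by_cases hjS : j ∈ S k
        · have := s3 j hjS
          simp only [hjK, hjS, if_true]
          constructor <;> linarith [hθ j hjA, hθ k hkA]
        · have := s4 j (Finset.mem_erase.2 ⟨hjk₀, hjK⟩) hjS
          simp only [hjK, hjS, if_true, if_false]
          constructor <;> linarith [hθ j hjA, hθ k hkA]
      · have hjS : j ∉ S k := fun h => hjK (s1K h)
        simp only [hjK, hjS, if_false]
        constructor <;> linarith [hθ j hjA]
  · rw [sum_smul_update hkA]
    have hk₀' : k₀ ∈ A.erase k := Finset.mem_erase.2 ⟨hkne.symm, hk₀A⟩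
    have h5 : ∑ j ∈ A.erase k, θ₂ j • γ j = (t - θ₁ k₀) • γ k₀ + ∑ j ∈ A.erase k, θ₁ j • γ j := by
      rw [← Finset.add_sum_erase _ _ hk₀', ← Finset.add_sum_erase _ (fun j => θ₁ j • γ j) hk₀']
      have : ∑ j ∈ (A.erase k).erase k₀, θ₂ j • γ j = ∑ j ∈ (A.erase k).erase k₀, θ₁ j • γ j :=
        Finset.sum_congr rfl fun j hj => by
          simp only [θ₂, Function.update_of_ne (Finset.ne_of_mem_erase hj)]
      rw [this]
      simp only [θ₂, Function.update_self]
      module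
    have hzero : θ₁ k • γ k = 0 := by simp [θ₁, s2, hkK]
    have h6 : ∑ j ∈ A, θ₁ j • γ j = ∑ j ∈ A, θ j • γ j + ∑ j ∈ S k, γ j := by
      rw [sum_shift_smul (s1K.trans hKA) hKA, hK, smul_zero, add_zero]
    have h7 : θ₁ k₀ = θ k₀ - θ k := by simp [θ₁, hk₀S, hk₀]
    rw [h5, Finset.sum_erase (f := fun j => θ₁ j • γ j) _ hzero, h6, h7, ht, ← e]
    module

end Circuit

/-! ### Bases of the lattice -/

section LatticeBasis

variable {V : Type*} [NormedAddCommGroup V] [NormedSpace ℝ V] [FiniteDimensional ℝ V]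
  (Γ : Submodule ℤ V) [DiscreteTopology Γ] [IsZLattice ℝ Γ]

/-- The index set of a basis of `Γ`. -/
def LatIndex : Type _ :=
  haveI : Module.Free ℤ Γ := ZLattice.module_free ℝ Γ
  Module.Free.ChooseBasisIndex ℤ Γ

instance : Fintype (LatIndex Γ) :=
  haveI : Module.Free ℤ Γ := ZLattice.module_free ℝ Γ
  haveI : Module.Finite ℤ Γ := ZLattice.module_finite ℝ Γ
  inferInstanceAs (Fintype (Module.Free.ChooseBasisIndex ℤ Γ))

/-- A basis of `Γ` over the integers. -/
def intBasis : Module.Basis (LatIndex Γ) ℤ Γ :=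
  haveI : Module.Free ℤ Γ := ZLattice.module_free ℝ Γ
  Module.Free.chooseBasis ℤ Γ

/-- A basis of `Γ`, as a real basis of `V`. -/
def latBasis : Module.Basis (LatIndex Γ) ℝ V := (intBasis Γ).ofZLatticeBasis ℝ Γ

theorem latBasis_apply (j : LatIndex Γ) : latBasis Γ j = intBasis Γ j :=
  (intBasis Γ).ofZLatticeBasis_apply ℝ Γ j

theorem latBasis_mem (j : LatIndex Γ) : latBasis Γ j ∈ Γ := by
  rw [latBasis_apply]; exact (intBasis Γ j).2

variable {Γ}

theorem ext_latBasis {α β : StrongDual ℝ V} (h : ∀ j, α (latBasis Γ j) = β (latBasis Γ j)) : α = β :=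
  ContinuousLinearMap.coe_injective ((latBasis Γ).ext h)

/-- Integral forms that are linearly dependent satisfy a relation with integral coefficients. -/
theorem exists_int_relation {T : Finset (StrongDual ℝ V)} (hT : ∀ α ∈ T, α ∈ dualLattice Γ)
    (h : ¬ LinearIndependent ℝ (fun α : T => (α : StrongDual ℝ V))) :
    ∃ c : StrongDual ℝ V → ℤ, ∑ α ∈ T, c α • α = 0 ∧ ∃ α ∈ T, c α ≠ 0 := by
  classical
  by_contra! hc
  apply h
  choose Z hZ using fun (α : T) (j : LatIndex Γ) => hT α α.2 _ (latBasis_mem Γ j)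
  have h1 : LinearIndependent ℤ Z := by
    rw [Fintype.linearIndependent_iff]
    intro g hg
    have h2 := hc (fun α => if h : α ∈ T then g ⟨α, h⟩ else 0) ?_
    · intro i
      have := h2 i i.2
      rwa [dif_pos i.2] at this
    · rw [← Finset.sum_coe_sort]
      refine ext_latBasis (Γ := Γ) fun j => ?_
      rw [sum_apply]
      have h3 := congrFun hg j
      rw [Finset.sum_apply] at h3
      have h4 : ∀ i : T, ((if h : (i : StrongDual ℝ V) ∈ T then g ⟨i, h⟩ else 0) •
          (i : StrongDual ℝ V)) (latBasis Γ j) = ((g i * Z i j : ℤ) : ℝ) := fun i => by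
        rw [dif_pos i.2, smul_apply, hZ i j, zsmul_eq_mul]
        push_cast
        rfl
      rw [Finset.sum_congr rfl fun i _ => h4 i, ← Int.cast_sum]
      simp only [Pi.smul_apply, smul_eq_mul] at h3
      rw [h3]
      simp
  have h2 := (linearIndependent_algebraMap_comp_iff (S := ℝ)).2 h1
  let f : StrongDual ℝ V →ₗ[ℝ] (LatIndex Γ → ℝ) :=
    { toFun := fun α j => α (latBasis Γ j)
      map_add' := fun _ _ => rfl
      map_smul' := fun _ _ => rfl }
  refine LinearIndependent.of_comp f ?_
  have e : (f ∘ fun α : T => (α : StrongDual ℝ V)) = fun i => ⇑(algebraMap ℤ ℝ) ∘ Z i :=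
    funext fun α => funext fun j => hZ α j
  rw [e]
  exact h2

end LatticeBasis

/-! ### Generic points -/

section Generic

variable {V : Type*} [NormedAddCommGroup V] [NormedSpace ℝ V]
  {Γ : Submodule ℤ V} {Δ : Finset (StrongDual ℝ V)} {L : Submodule ℂ (Mer V)} {x : StrongDual ℝ V}

/-- The point `x` is generic: its translates by the lattice avoid the proper subspaces spanned by
elements of `Δ`. -/
def IsGeneric (Γ : Submodule ℤ V) (Δ : Finset (StrongDual ℝ V)) (x : StrongDual ℝ V) : Prop :=
  ∀ ν : Set (StrongDual ℝ V), ν ⊆ Δ → Submodule.span ℝ ν ≠ ⊤ →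
    ∀ ξ ∈ dualLattice Γ, x + ξ ∉ Submodule.span ℝ ν

/-- The space `L` contains the fractions `e^ξ / ∏_{α ∈ σ} (1 - U_α e^{Mα})` for which `σ` is a basis and
`x + ξ` lies in the open parallelepiped spanned by the `Mα`, `α ∈ σ`. -/
def HasSimpleFractions (Γ : Submodule ℤ V) (Δ : Finset (StrongDual ℝ V)) (L : Submodule ℂ (Mer V))
    (x : StrongDual ℝ V) : Prop :=
  ∀ (σ : Finset (StrongDual ℝ V)) (_ : IsBasisSubset Δ σ) (M : ℤ) (_ : 0 < M)
    (U : StrongDual ℝ V → ℂ) (_ : ∀ α, U α ≠ 0) (ξ : StrongDual ℝ V) (_ : ξ ∈ dualLattice Γ)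
    (s : StrongDual ℝ V → ℝ) (_ : ∀ α ∈ σ, 0 < s α ∧ s α < 1)
    (_ : x + ξ = ∑ α ∈ σ, s α • (M • α)),
    toMer (expForm ξ) * ∏ α ∈ σ, geom (M • α) (U α) ∈ L

theorem zsmul_ne_zero_of {α : StrongDual ℝ V} (hα : α ≠ 0) {m : ℤ} (hm : m ≠ 0) : m • α ≠ 0 := by
  rw [← Int.cast_smul_eq_zsmul ℝ]
  exact smul_ne_zero (Int.cast_ne_zero.2 hm) hα

theorem subset_of_linearIndependent_of_span {T σ : Set (StrongDual ℝ V)}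
    (hT : LinearIndependent ℝ (fun β : T => (β : StrongDual ℝ V))) (hσ : σ ⊆ T)
    (hspan : Submodule.span ℝ σ = ⊤) : T ⊆ σ := by
  intro β hβ
  by_contra h
  have h1 := hT.notMem_span_image (s := {γ : T | (γ : StrongDual ℝ V) ∈ σ}) (x := ⟨β, hβ⟩) h
  have h2 : (fun β : T => (β : StrongDual ℝ V)) '' {γ : T | (γ : StrongDual ℝ V) ∈ σ} = σ :=
    Set.ext fun γ => ⟨by rintro ⟨γ, hγ, rfl⟩; exact hγ, fun hγ => ⟨⟨γ, hσ hγ⟩, hγ, rfl⟩⟩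
  rw [h2, hspan] at h1
  exact h1 Submodule.mem_top

theorem linearIndependent_mono {T σ : Set (StrongDual ℝ V)}
    (hT : LinearIndependent ℝ (fun β : T => (β : StrongDual ℝ V))) (hσ : σ ⊆ T) :
    LinearIndependent ℝ (fun β : σ => (β : StrongDual ℝ V)) :=
  hT.comp (Set.inclusion hσ) (Set.inclusion_injective hσ)

variable [FiniteDimensional ℝ V]

theorem span_erase_ne_top [DecidableEq (StrongDual ℝ V)] {σ : Finset (StrongDual ℝ V)}
    (hσ : IsBasisSubset Δ σ)
    {α : StrongDual ℝ V} (hα : α ∈ σ) :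
    Submodule.span ℝ ((σ.erase α : Finset _) : Set (StrongDual ℝ V)) ≠ ⊤ := by
  intro h
  obtain ⟨v, hv1, hv2⟩ := exists_dual_vector hσ hα
  have := eq_zero_of_span_eq_top h (v := v) fun β hβ =>
    hv2 β (Finset.mem_of_mem_erase hβ) (Finset.ne_of_mem_erase hβ)
  rw [this, map_zero] at hv1
  exact zero_ne_one hv1

variable {ι : Type*} [DecidableEq ι] {A : Finset ι} {α : ι → StrongDual ℝ V}

/-- Multiplicities are created by differentiation: the derivative along a vector dual to `α` multiplies
`E` by a combination of `1` and of the factors `1 / (1 - y_k)` with `α_k = α`. -/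
theorem mem_of_subset_of_deriv (hL : ∀ G ∈ L, ∀ v, merDeriv v G ∈ L)
    {σ : Finset (StrongDual ℝ V)} (hσ : IsBasisSubset Δ σ) {M : ℤ} (hM : 0 < M)
    {U : StrongDual ℝ V → ℂ} {ξ : StrongDual ℝ V} {B A : Finset ι} (hBA : B ⊆ A)
    (hB : ∀ β ∈ σ, ∃ k ∈ B, α k = β) (hA : ∀ k ∈ A, α k ∈ σ)
    (h : toMer (expForm ξ) * ∏ k ∈ B, geom (M • α k) (U (α k)) ∈ L) :
    toMer (expForm ξ) * ∏ k ∈ A, geom (M • α k) (U (α k)) ∈ L := by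
  classical
  have h0 : ∀ β ∈ σ, β ≠ 0 := fun β hβ h =>
    hσ.2.1.ne_zero (⟨β, hβ⟩ : σ) h
  have key : ∀ C ⊆ A, B ⊆ C → toMer (expForm ξ) * ∏ k ∈ C, geom (M • α k) (U (α k)) ∈ L →
      ∀ i ∈ A, i ∉ C →
      toMer (expForm ξ) * ∏ k ∈ insert i C, geom (M • α k) (U (α k)) ∈ L := by
    intro C hC hBC hm i hi hiC
    obtain ⟨v, hv1, hv2⟩ := exists_dual_vector hσ (hA i hi)
    rw [Finset.prod_insert hiC]
    set E := toMer (expForm ξ) * ∏ k ∈ C, geom (M • α k) (U (α k)) with hE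
    set g := geom (M • α i) (U (α i))
    have hd := hL _ hm (ofReal v)
    rw [hE, merDeriv_expForm_mul_prod_geom ξ _ _ C fun k hk =>
      zsmul_ne_zero_of (h0 _ (hA k (hC hk))) hM.ne', ← hE] at hd
    have h1 : ∀ j ∈ C, pair (M • α j) (ofReal v) •
        ((geom (M • α j) (U (α j)) - 1) * E) =
        if α j = α i then (M : ℂ) • ((g - 1) * E) else 0 := fun j hj => by
      split_ifs with h
      · rw [h, pair_zsmul, pair_ofReal, hv1, Complex.ofReal_one, mul_one]
      · rw [pair_zsmul, pair_ofReal, hv2 _ (hA j (hC hj)) h, Complex.ofReal_zero, mul_zero, zero_smul]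
    rw [Finset.sum_congr rfl h1, ← Finset.sum_filter, Finset.sum_const] at hd
    obtain ⟨k, hkB, hk⟩ := hB _ (hA i hi)
    have hcard : ((C.filter fun j => α j = α i).card : ℂ) * M ≠ 0 := by
      refine mul_ne_zero (Nat.cast_ne_zero.2 ?_) (Int.cast_ne_zero.2 hM.ne')
      exact (Finset.card_pos.2 ⟨k, Finset.mem_filter.2 ⟨hBC hkB, hk⟩⟩).ne'
    have h2 := (Submodule.add_mem_iff_right L (Submodule.smul_mem L _ hm)).1 hd
    rw [← Nat.cast_smul_eq_nsmul ℂ, smul_smul, Submodule.smul_mem_iff L hcard, sub_mul, one_mul] at h2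
    have h3 := (Submodule.sub_mem_iff_left L hm).1 h2
    have : toMer (expForm ξ) * (g * ∏ k ∈ C, geom (M • α k) (U (α k))) = g * E := by
      rw [hE]; ring
    rwa [this]
  have key2 : ∀ D ⊆ A \ B, toMer (expForm ξ) * ∏ k ∈ B ∪ D, geom (M • α k) (U (α k)) ∈ L := by
    intro D
    induction D using Finset.induction_on with
    | empty => intro _; rwa [Finset.union_empty]
    | insert i D hi ih =>
      intro hD
      have hiA := Finset.mem_sdiff.1 (hD (Finset.mem_insert_self i D))
      have hDA : D ⊆ A \ B := fun k hk => hD (Finset.mem_insert_of_mem hk)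
      rw [Finset.union_insert]
      refine key (B ∪ D) (Finset.union_subset hBA (hDA.trans Finset.sdiff_subset))
        Finset.subset_union_left (ih hDA) i hiA.1 ?_
      rw [Finset.mem_union, not_or]
      exact ⟨hiA.2, hi⟩
  have := key2 (A \ B) subset_rfl
  rwa [Finset.union_sdiff_of_subset hBA] at this

/-- The case of exponents `M α_k` that are independent up to repetition. The weight of repeated
exponents is first concentrated on as few factors as possible; genericity then gives a basis. -/
theorem IsGeneric.zonotopeMem_of_linearIndependent (hx : IsGeneric Γ Δ x)
    (hΔ : ∀ α ∈ Δ, α ∈ dualLattice Γ) (hL : ∀ G ∈ L, ∀ v, merDeriv v G ∈ L)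
    (hbase : HasSimpleFractions Γ Δ L x) {M : ℤ} (hM : 0 < M) {U : StrongDual ℝ V → ℂ}
    (hU : ∀ α, U α ≠ 0) (hα : ∀ k ∈ A, α k ∈ Δ)
    (hli : LinearIndependent ℝ (fun β : α '' A => (β : StrongDual ℝ V)))
    (ih : ∀ k ∈ A, ZonotopeMem Γ L x (A.erase k) (fun k => M • α k) fun k => U (α k)) :
    ZonotopeMem Γ L x A (fun k => M • α k) fun k => U (α k) := by
  classical
  have hα0 : ∀ k ∈ A, α k ≠ 0 := fun k hk h =>
    hli.ne_zero (⟨α k, Set.mem_image_of_mem α hk⟩ : α '' A) h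
  have hγ : ∀ k ∈ A, M • α k ∈ dualLattice Γ := fun k hk => Submodule.smul_mem _ M (hΔ _ (hα k hk))
  suffices H : ∀ (n : ℕ) (ξ : StrongDual ℝ V) (_ : ξ ∈ dualLattice Γ) (θ : ι → ℝ)
      (_ : ∀ k ∈ A, 0 ≤ θ k ∧ θ k ≤ 1) (_ : (A.filter fun k => θ k ≠ 0).card = n)
      (_ : x + ξ = ∑ k ∈ A, θ k • (M • α k)),
      toMer (expForm ξ) * ∏ k ∈ A, geom (M • α k) (U (α k)) ∈ L from
    fun ξ hξ θ hθ e => H _ ξ hξ θ hθ rfl e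
  intro n
  induction n using Nat.strong_induction_on with
  | _ n ihn =>
  intro ξ hξ θ hθ hn e
  by_cases hinj : ∃ k ∈ A, ∃ l ∈ A, k ≠ l ∧ α k = α l ∧ θ k ≠ 0 ∧ θ l ≠ 0
  · obtain ⟨k, hk, l, hl, hkl, hαkl, hθk, hθl⟩ := hinj
    have hlk : l ∈ A.erase k := Finset.mem_erase.2 ⟨hkl.symm, hl⟩
    -- the weight of `k` is transferred to `l`
    have hcount : ∀ t : ℝ, ((A.filter fun j =>
        Function.update (Function.update θ l t) k 0 j ≠ 0).card < n) := fun t => by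
      rw [← hn]
      refine Finset.card_lt_card ⟨fun j hj => ?_, fun hsub => ?_⟩
      · obtain ⟨hjA, hj⟩ := Finset.mem_filter.1 hj
        refine Finset.mem_filter.2 ⟨hjA, ?_⟩
        rcases eq_or_ne j k with rfl | hjk
        · exact hθk
        rcases eq_or_ne j l with rfl | hjl
        · exact hθl
        rwa [Function.update_of_ne hjk, Function.update_of_ne hjl] at hj
      · have := Finset.mem_filter.1 (hsub (Finset.mem_filter.2 ⟨hk, hθk⟩))
        exact this.2 (Function.update_self _ _ _)
    have hsum : ∀ t : ℝ, ∑ j ∈ A.erase k, Function.update (Function.update θ l t) k 0 j • (M • α j) =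
        x + ξ + (t - θ k - θ l) • (M • α l) := fun t => by
      rw [e, ← Finset.add_sum_erase A _ hk, ← Finset.add_sum_erase _ _ hlk,
        ← Finset.add_sum_erase (A.erase k) (fun j => θ j • (M • α j)) hlk,
        Function.update_of_ne hkl.symm, Function.update_self, hαkl]
      have : ∑ j ∈ (A.erase k).erase l, Function.update (Function.update θ l t) k 0 j • (M • α j) =
          ∑ j ∈ (A.erase k).erase l, θ j • (M • α j) := Finset.sum_congr rfl fun j hj => by
        obtain ⟨h1, h2⟩ := Finset.mem_erase.1 hj
        rw [Function.update_of_ne (Finset.ne_of_mem_erase h2), Function.update_of_ne h1]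
      rw [this]
      module
    have hsumA : ∀ t : ℝ, ∑ j ∈ A, Function.update (Function.update θ l t) k 0 j • (M • α j) =
        x + ξ + (t - θ k - θ l) • (M • α l) := fun t => by
      rw [← hsum, ← Finset.add_sum_erase A _ hk, Function.update_self, zero_smul, zero_add]
    have hIcc : ∀ t : ℝ, 0 ≤ t ∧ t ≤ 1 → ∀ j ∈ A,
        0 ≤ Function.update (Function.update θ l t) k 0 j ∧
        Function.update (Function.update θ l t) k 0 j ≤ 1 := fun t ht =>
      update_mem_Icc (fun j hj => update_mem_Icc (A := A)
        (fun i hi => hθ i (Finset.mem_of_mem_erase hi)) ht j (Finset.mem_of_mem_erase hj))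
        ⟨le_rfl, zero_le_one⟩
    rcases le_or_gt (θ k + θ l) 1 with hle | hgt
    · refine ihn _ (hcount (θ k + θ l)) ξ hξ _
        (hIcc _ ⟨add_nonneg (hθ k hk).1 (hθ l hl).1, hle⟩) rfl ?_
      rw [hsumA]; module
    · -- `y / (1 - y) = 1 / (1 - y) - 1`, applied to the factor `k`
      have ht : 0 ≤ θ k + θ l - 1 ∧ θ k + θ l - 1 ≤ 1 :=
        ⟨by linarith, by linarith [(hθ k hk).2, (hθ l hl).2]⟩
      have hξ' : ξ + -(M • α k) ∈ dualLattice Γ := add_mem hξ (neg_mem (hγ k hk))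
      have m1 := ihn _ (hcount (θ k + θ l - 1)) (ξ + -(M • α k)) hξ' _ (hIcc _ ht) rfl
        (by rw [hsumA, hαkl]; module)
      have m2 := ih k hk (ξ + -(M • α k)) hξ' _ (fun j hj => hIcc _ ht j (Finset.mem_of_mem_erase hj))
        (by rw [hsum, hαkl]; module)
      have e2 : toMer (expForm ξ) * ∏ k ∈ A, geom (M • α k) (U (α k)) =
          (U (α k))⁻¹ • (toMer (expForm (ξ + -(M • α k))) * ∏ k ∈ A, geom (M • α k) (U (α k)) -
            toMer (expForm (ξ + -(M • α k))) * ∏ j ∈ A.erase k, geom (M • α j) (U (α j))) := by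
        have h1 := geom_mul_one_sub (zsmul_ne_zero_of (hα0 k hk) hM.ne') (U (α k))
        have h2 : mon (M • α k) (U (α k)) * mon (-(M • α k)) (U (α k))⁻¹ = 1 := by
          rw [mon_mul, add_neg_cancel, mul_inv_cancel₀ (hU _), mon_zero_one]
        rw [smul_sub, ← smul_mul_assoc, ← smul_mul_assoc, ← expForm_mul_mon,
          ← Finset.mul_prod_erase A _ hk]
        linear_combination (-(toMer (expForm ξ) * geom (M • α k) (U (α k)) *
            ∏ j ∈ A.erase k, geom (M • α j) (U (α j)))) * h2 +
          (-(toMer (expForm ξ) * mon (-(M • α k)) (U (α k))⁻¹ *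
            ∏ j ∈ A.erase k, geom (M • α j) (U (α j)))) * h1
      rw [e2]
      exact Submodule.smul_mem _ _ (Submodule.sub_mem _ m1 m2)
  · -- the factors of nonzero weight have distinct exponents, which form a basis since `x` is generic
    push Not at hinj
    set B := A.filter fun k => θ k ≠ 0 with hB
    have hBA : B ⊆ A := Finset.filter_subset _ _
    have hBinj : Set.InjOn α B := fun k hk l hl h => by
      obtain ⟨hkA, hk0⟩ := Finset.mem_filter.1 hk
      obtain ⟨hlA, hl0⟩ := Finset.mem_filter.1 hl
      by_contra hkl
      exact hl0 (hinj k hkA l hlA hkl h hk0)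
    have eB : x + ξ = ∑ k ∈ B, θ k • (M • α k) := by
      rw [e, hB, Finset.sum_filter]
      refine Finset.sum_congr rfl fun k _ => ?_
      split_ifs with h
      · rfl
      · rw [not_not.1 h, zero_smul]
    set σ := B.image α with hσ
    have hσA : (σ : Set (StrongDual ℝ V)) ⊆ α '' A := by
      rw [hσ, Finset.coe_image]
      exact Set.image_mono hBA
    have hσΔ : σ ⊆ Δ := fun β hβ => by
      obtain ⟨k, hk, rfl⟩ := Finset.mem_image.1 hβ
      exact hα k (hBA hk)
    have hσspan : Submodule.span ℝ (σ : Set (StrongDual ℝ V)) = ⊤ := by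
      by_contra h
      refine hx σ hσΔ h ξ hξ ?_
      rw [eB]
      exact Submodule.sum_mem _ fun k hk => Submodule.smul_mem _ _
        (Submodule.smul_of_tower_mem _ M (Submodule.subset_span (Finset.mem_image_of_mem α hk)))
    have hσb : IsBasisSubset Δ σ := ⟨hσΔ, linearIndependent_mono hli hσA, hσspan⟩
    have hAσ : ∀ k ∈ A, α k ∈ σ := fun k hk =>
      subset_of_linearIndependent_of_span hli hσA hσspan (Set.mem_image_of_mem α hk)
    -- a coefficient `1` would put a translate of `x` in the span of the other exponents
    have hθ1 : ∀ k ∈ B, θ k < 1 := fun k hk => by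
      refine lt_of_le_of_ne (hθ k (hBA hk)).2 fun h1 => ?_
      have hne := span_erase_ne_top hσb (Finset.mem_image_of_mem α hk)
      refine hx _ ((Finset.erase_subset _ _).trans hσΔ) hne (ξ + -(M • α k))
        (add_mem hξ (neg_mem (hγ k (hBA hk)))) ?_
      rw [← add_assoc, eB, ← Finset.add_sum_erase B _ hk, h1, one_smul, add_comm, neg_add_cancel_left]
      refine Submodule.sum_mem _ fun j hj => Submodule.smul_mem _ _
        (Submodule.smul_of_tower_mem _ M (Submodule.subset_span ?_))
      obtain ⟨hjk, hjB⟩ := Finset.mem_erase.1 hj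
      exact Finset.mem_erase.2 ⟨fun h => hjk (hBinj hjB hk h), Finset.mem_image_of_mem α hjB⟩
    refine mem_of_subset_of_deriv hL hσb hM hBA (fun β hβ => ?_) hAσ ?_
    · obtain ⟨k, hk, rfl⟩ := Finset.mem_image.1 hβ
      exact ⟨k, hk, rfl⟩
    · obtain ⟨s, hs⟩ : ∃ s : StrongDual ℝ V → ℝ, ∀ k ∈ B, s (α k) = θ k := by
        refine ⟨fun β => ∑ j ∈ B, if α j = β then θ j else 0, fun k hk => ?_⟩
        dsimp only
        rw [Finset.sum_eq_single k (fun j hj hjk => if_neg fun h => hjk (hBinj hj hk h))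
          (fun h => absurd hk h), if_pos rfl]
      have := hbase σ hσb M hM U hU ξ hξ s (fun β hβ => ?_) ?_
      · rwa [hσ, Finset.prod_image hBinj] at this
      · obtain ⟨k, hk, rfl⟩ := Finset.mem_image.1 hβ
        rw [hs k hk]
        exact ⟨lt_of_le_of_ne (hθ k (hBA hk)).1 (Finset.mem_filter.1 hk).2.symm, hθ1 k hk⟩
      · rw [eB, hσ, Finset.sum_image hBinj]
        exact Finset.sum_congr rfl fun k hk => by rw [hs k hk]

end Generic

/-! ### Reduction to simple fractions -/

section SimpleReduction

variable {V : Type*} [NormedAddCommGroup V] [NormedSpace ℝ V] [FiniteDimensional ℝ V]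
  {Γ : Submodule ℤ V} [DiscreteTopology Γ] [IsZLattice ℝ Γ]
  {Δ : Finset (StrongDual ℝ V)} {L : Submodule ℂ (Mer V)} {x : StrongDual ℝ V}

/-- If a formula that is linear and compatible with differentiation holds for the simple fractions,
then it holds for all the exponential fractions whose exponent lies in the zonotope of the
denominator. The induction is on the sum of the weights of the factors. -/
theorem IsGeneric.zonotopeMem {ι : Type*} [DecidableEq ι] (hx : IsGeneric Γ Δ x)
    (hΔ : ∀ α ∈ Δ, α ∈ dualLattice Γ) (h0 : (0 : StrongDual ℝ V) ∉ Δ)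
    (hL : ∀ G ∈ L, ∀ v, merDeriv v G ∈ L)
    (hbase : HasSimpleFractions Γ Δ L x) (A : Finset ι) (α : ι → StrongDual ℝ V)
    (hα : ∀ k ∈ A, α k ∈ Δ) (m : ι → ℤ) (hm : ∀ k ∈ A, m k ≠ 0) (u : ι → ℂ)
    (hu : ∀ k ∈ A, u k ≠ 0) : ZonotopeMem Γ L x A (fun k => m k • α k) u := by
  classical
  -- a weight on `Δ`; a factor is only replaced by factors of smaller weight
  obtain ⟨w, hw, hw0⟩ : ∃ w : StrongDual ℝ V → ℕ, Set.InjOn w Δ ∧ ∀ α, 0 < w α := by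
    refine ⟨fun α => if h : α ∈ Δ then (Δ.equivFin ⟨α, h⟩ : ℕ) + 1 else 1, fun α h β h' e => ?_,
      fun α => ?_⟩
    · dsimp only at e
      rw [dif_pos (Finset.mem_coe.1 h), dif_pos (Finset.mem_coe.1 h'), Nat.add_right_cancel_iff] at e
      exact congrArg Subtype.val (Δ.equivFin.injective (Fin.val_injective e))
    · dsimp only
      split_ifs <;> omega
  suffices H : ∀ (n : ℕ) (A : Finset ι) (α : ι → StrongDual ℝ V) (_ : ∑ k ∈ A, w (α k) = n)
      (_ : ∀ k ∈ A, α k ∈ Δ) (m : ι → ℤ) (_ : ∀ k ∈ A, m k ≠ 0) (u : ι → ℂ)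
      (_ : ∀ k ∈ A, u k ≠ 0), ZonotopeMem Γ L x A (fun k => m k • α k) u from
    H _ A α rfl hα m hm u hu
  clear hα hm hu u m α A
  intro n
  induction n using Nat.strong_induction_on with
  | _ n ih =>
  intro A α hn hα m hm u hu
  have hα0 : ∀ k ∈ A, α k ≠ 0 := fun k hk h => h0 (h ▸ hα k hk)
  have hγ : ∀ (m : ι → ℤ), ∀ k ∈ A, m k • α k ∈ dualLattice Γ := fun m k hk =>
    Submodule.smul_mem _ _ (hΔ _ (hα k hk))
  have herase : ∀ k ∈ A, ∀ m : ι → ℤ, (∀ k ∈ A, m k ≠ 0) → ∀ u : ι → ℂ, (∀ k ∈ A, u k ≠ 0) →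
      ZonotopeMem Γ L x (A.erase k) (fun k => m k • α k) u := fun k hk m hm u hu => by
    refine ih _ ?_ (A.erase k) α rfl (fun j hj => hα j (Finset.mem_of_mem_erase hj)) m
      (fun j hj => hm j (Finset.mem_of_mem_erase hj)) u
      (fun j hj => hu j (Finset.mem_of_mem_erase hj))
    rw [← hn, ← Finset.add_sum_erase A _ hk]
    have := hw0 (α k)
    omega
  have hprod : ∀ k ∈ A, (∏ j ∈ A.erase k, m j) * m k = ∏ j ∈ A, m j := fun k hk =>
    Finset.prod_erase_mul A m hk
  have hN : ∏ j ∈ A, m j ≠ 0 := Finset.prod_ne_zero_iff.2 hm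
  have hNk : ∀ k ∈ A, ∏ j ∈ A.erase k, m j ≠ 0 := fun k hk =>
    Finset.prod_ne_zero_iff.2 fun j hj => hm j (Finset.mem_of_mem_erase hj)
  set N := ∏ j ∈ A, m j
  by_cases hli : LinearIndependent ℝ (fun β : (A.image α : Finset _) => (β : StrongDual ℝ V))
  · -- all the exponents are made equal to the same multiple of elements of `Δ`
    set M := N * N
    have hM : 0 < M := mul_self_pos.2 hN
    refine ZonotopeMem.of_zsmul (d := fun k => N * ∏ j ∈ A.erase k, m j) (hγ m)
      (fun k hk => zsmul_ne_zero_of (hα0 k hk) (hm k hk)) hu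
      (fun k hk => mul_ne_zero hN (hNk k hk)) ?_
    set u' : ι → ℂ := fun k => u k ^ (N * ∏ j ∈ A.erase k, m j)
    have hu' : ∀ k ∈ A, u' k ≠ 0 := fun k hk => zpow_ne_zero _ (hu k hk)
    have hMα : ∀ k ∈ A, M • α k = (N * ∏ j ∈ A.erase k, m j) • m k • α k := fun k hk => by
      rw [smul_smul, mul_assoc, hprod k hk]
    refine ZonotopeMem.congr ?_ hMα fun _ _ => rfl
    by_cases hsame : ∃ k ∈ A, ∃ l ∈ A, α k = α l ∧ u' k ≠ u' l
    · -- two factors with the same exponent and different constants: after reversal of one of them,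
      -- the relation `γ_k + γ_l = 0` lowers the number of factors
      obtain ⟨k, hk, l, hl, hkl, hukl⟩ := hsame
      have hne : k ≠ l := fun h => hukl (h ▸ rfl)
      have hd : ∀ j, (if j = l then (-1 : ℤ) else 1) ≠ 0 := fun j => by split_ifs <;> decide
      refine ZonotopeMem.of_zsmul (d := fun j => if j = l then (-1 : ℤ) else 1) (hγ fun _ => M)
        (fun k hk => zsmul_ne_zero_of (hα0 k hk) hM.ne') hu' (fun k _ => hd k) ?_
      have hms : ∀ j, (if j = l then (-1 : ℤ) else 1) • M • α j =
          ((if j = l then (-1 : ℤ) else 1) * M) • α j := fun j => smul_smul _ _ _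
      refine ZonotopeMem.of_erase (K := {k, l}) ?_ ?_ ?_ ?_ ?_ ?_
      · intro j hj
        rcases Finset.mem_insert.1 hj with rfl | hj
        · exact hk
        · rwa [Finset.mem_singleton.1 hj]
      · intro j hj
        exact Submodule.smul_mem _ _ (hγ (fun _ => M) j hj)
      · intro j hj
        exact zsmul_ne_zero_of (zsmul_ne_zero_of (hα0 j hj) hM.ne') (hd j)
      · rw [Finset.sum_pair hne, if_neg hne, if_pos rfl, hkl, one_smul, neg_smul, one_smul,
          add_neg_cancel]
      · rw [Finset.prod_pair hne, if_neg hne, if_pos rfl, zpow_one, zpow_neg, zpow_one]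
        intro h
        exact hukl (mul_inv_eq_one₀ (hu' l hl) |>.1 h)
      · intro j hj
        have hjA : j ∈ A := by
          rcases Finset.mem_insert.1 hj with rfl | hj
          · exact hk
          · rwa [Finset.mem_singleton.1 hj]
        exact (herase j hjA (fun j => (if j = l then (-1 : ℤ) else 1) * M)
          (fun j _ => mul_ne_zero (hd j) hM.ne') _ (fun j hj => zpow_ne_zero _ (hu' j hj))).congr
          (fun j _ => (hms j).symm) (fun _ _ => rfl)
    · push Not at hsame
      obtain ⟨U, hU0, hU⟩ : ∃ U : StrongDual ℝ V → ℂ, (∀ β, U β ≠ 0) ∧ ∀ k ∈ A, U (α k) = u' k := by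
        refine ⟨fun β => if h : ∃ k ∈ A, α k = β then u' h.choose else 1, fun β => ?_, fun k hk => ?_⟩
        · dsimp only
          split_ifs with h
          · exact hu' _ h.choose_spec.1
          · exact one_ne_zero
        · have h : ∃ j ∈ A, α j = α k := ⟨k, hk, rfl⟩
          dsimp only
          rw [dif_pos h]
          exact hsame _ h.choose_spec.1 k hk h.choose_spec.2
      refine ZonotopeMem.congr (hx.zonotopeMem_of_linearIndependent hΔ hL hbase hM hU0 hα ?_
        fun k hk => ?_) (fun _ _ => rfl) hU
      · rw [Finset.coe_image.symm]
        exact hli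
      · exact herase k hk (fun _ => M) (fun _ _ => hM.ne') _ fun j _ => hU0 _
  · obtain ⟨c, hc, β, hβ, hcβ⟩ := exists_int_relation (Γ := Γ) (fun γ hγ => by
      obtain ⟨k, hk, rfl⟩ := Finset.mem_image.1 hγ
      exact hΔ _ (hα k hk)) hli
    -- a circuit, with one index for each element of `Δ` that occurs in the relation
    have : Nonempty ι := (Finset.mem_image.1 hβ).nonempty
    choose! rep hrepA hrep using fun (γ : StrongDual ℝ V) (h : γ ∈ A.image α) => Finset.mem_image.1 h
    set T := (A.image α).filter fun γ => c γ ≠ 0 with hT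
    have hTA : ∀ γ ∈ T, γ ∈ A.image α := fun γ h => (Finset.mem_filter.1 h).1
    set K := T.image rep with hK
    have hrepinj : Set.InjOn rep T := fun γ hγ δ hδ h => by
      rw [← hrep γ (hTA γ hγ), ← hrep δ (hTA δ hδ), h]
    have hKA : K ⊆ A := fun k hk => by
      obtain ⟨γ, hγ, rfl⟩ := Finset.mem_image.1 hk
      exact hrepA γ (hTA γ hγ)
    have hcK : ∀ k ∈ K, c (α k) ≠ 0 := fun k hk => by
      obtain ⟨γ, hγ, rfl⟩ := Finset.mem_image.1 hk
      rw [hrep γ (hTA γ hγ)]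
      exact (Finset.mem_filter.1 hγ).2
    have hαK : Set.InjOn α K := fun k hk l hl h => by
      obtain ⟨γ, hγ, rfl⟩ := Finset.mem_image.1 hk
      obtain ⟨δ, hδ, rfl⟩ := Finset.mem_image.1 hl
      rw [hrep γ (hTA γ hγ), hrep δ (hTA δ hδ)] at h
      rw [h]
    have hsumK : ∑ k ∈ K, c (α k) • α k = 0 := by
      rw [hK, Finset.sum_image hrepinj, ← hc, hT, Finset.sum_filter]
      refine Finset.sum_congr rfl fun γ hγ => ?_
      split_ifs with h
      · rw [hrep γ hγ]
      · rw [not_not.1 h, zero_smul]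
    have hKne : K.Nonempty := ⟨rep β, Finset.mem_image_of_mem rep (Finset.mem_filter.2 ⟨hβ, hcβ⟩)⟩
    set d : ι → ℤ := fun k => if k ∈ K then c (α k) * ∏ j ∈ A.erase k, m j else 1 with hd
    have hd0 : ∀ k ∈ A, d k ≠ 0 := fun k hk => by
      simp only [hd]
      split_ifs with h
      · exact mul_ne_zero (hcK k h) (hNk k hk)
      · exact one_ne_zero
    refine ZonotopeMem.of_zsmul (d := d) (hγ m)
      (fun k hk => zsmul_ne_zero_of (hα0 k hk) (hm k hk)) hu hd0 ?_
    set u' : ι → ℂ := fun k => u k ^ d k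
    have hu' : ∀ k ∈ A, u' k ≠ 0 := fun k hk => zpow_ne_zero _ (hu k hk)
    have hdm0 : ∀ k ∈ A, d k * m k ≠ 0 := fun k hk => mul_ne_zero (hd0 k hk) (hm k hk)
    refine ZonotopeMem.congr (γ := fun k => (d k * m k) • α k) ?_
      (fun k _ => (smul_smul _ _ _).symm) fun _ _ => rfl
    have hγ0 : ∀ k ∈ A, (d k * m k) • α k ≠ 0 := fun k hk => zsmul_ne_zero_of (hα0 k hk) (hdm0 k hk)
    have hsum : ∑ k ∈ K, (d k * m k) • α k = 0 := by
      have : ∀ k ∈ K, (d k * m k) • α k = N • (c (α k) • α k) := fun k hk => by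
        simp only [hd]
        rw [if_pos hk, mul_assoc, hprod k (hKA hk), smul_smul, mul_comm]
      rw [Finset.sum_congr rfl this, ← Finset.smul_sum, hsumK, smul_zero]
    by_cases hC : ∏ k ∈ K, u' k = 1
    · obtain ⟨k₀, hk₀, hmin⟩ := Finset.exists_min_image K (fun k => w (α k)) hKne
      refine ZonotopeMem.of_update hKA hk₀ (hγ fun k => d k * m k) hγ0 hsum hC fun k hk hkk₀ => ?_
      have hkA := hKA hk
      have hk₀A := hKA hk₀
      refine (ih _ ?_ A (Function.update α k (α k₀)) rfl ?_
        (Function.update (fun k => d k * m k) k (d k₀ * m k₀)) ?_ (Function.update u' k (u' k₀)) ?_).congr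
        ?_ fun _ _ => rfl
      · rw [← hn, ← Finset.add_sum_erase A _ hkA, ← Finset.add_sum_erase A (fun k => w (α k)) hkA,
          Function.update_self]
        have h1 : ∑ j ∈ A.erase k, w (Function.update α k (α k₀) j) = ∑ j ∈ A.erase k, w (α j) :=
          Finset.sum_congr rfl fun j hj => by rw [Function.update_of_ne (Finset.ne_of_mem_erase hj)]
        have h2 : w (α k₀) < w (α k) := lt_of_le_of_ne (hmin k hk) fun h =>
          hkk₀ (hαK hk hk₀ (hw (hα k hkA) (hα k₀ hk₀A) h.symm))
        rw [h1]
        omega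
      all_goals
        intro j hj
        rcases eq_or_ne j k with rfl | hjk
      · rw [Function.update_self]; exact hα k₀ hk₀A
      · rw [Function.update_of_ne hjk]; exact hα j hj
      · rw [Function.update_self]; exact hdm0 k₀ hk₀A
      · rw [Function.update_of_ne hjk]; exact hdm0 j hj
      · rw [Function.update_self]; exact hu' k₀ hk₀A
      · rw [Function.update_of_ne hjk]; exact hu' j hj
      · rw [Function.update_self, Function.update_self, Function.update_self]
      · rw [Function.update_of_ne hjk, Function.update_of_ne hjk, Function.update_of_ne hjk]
    · exact ZonotopeMem.of_erase hKA (hγ fun k => d k * m k) hγ0 hsum hC fun k hk =>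
        herase k (hKA hk) (fun k => d k * m k) hdm0 u' hu'

end SimpleReduction

/-! ### The torus of poles -/

section Torus

variable {V : Type*} [NormedAddCommGroup V] [NormedSpace ℝ V]

theorem period_add (γ δ : V) : period (γ + δ) = period γ + period δ := by
  rw [period, period, period, ofReal_add, smul_add]

theorem period_zero : period (0 : V) = 0 := by
  have := period_add (0 : V) 0
  rwa [add_zero, left_eq_add] at this

/-- The group `2πiΓ`. -/
def periods (Γ : Submodule ℤ V) : AddSubgroup (Cx V) where
  carrier := {z | ∃ γ ∈ Γ, z = period γ}
  zero_mem' := ⟨0, zero_mem _, period_zero.symm⟩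
  add_mem' := by
    rintro _ _ ⟨γ, hγ, rfl⟩ ⟨δ, hδ, rfl⟩
    exact ⟨γ + δ, add_mem hγ hδ, (period_add γ δ).symm⟩
  neg_mem' := by
    rintro _ ⟨γ, hγ, rfl⟩
    refine ⟨-γ, neg_mem hγ, ?_⟩
    rw [eq_comm, eq_neg_iff_add_eq_zero, ← period_add, neg_add_cancel, period_zero]

variable {Γ : Submodule ℤ V}

theorem exp_pair_period {ξ : StrongDual ℝ V} (hξ : ξ ∈ dualLattice Γ) {γ : V} (hγ : γ ∈ Γ) :
    Complex.exp (pair ξ (period γ)) = 1 := by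
  obtain ⟨k, hk⟩ := hξ γ hγ
  rw [period, map_smul, pair_ofReal, hk, Complex.exp_eq_one_iff]
  refine ⟨k, ?_⟩
  rw [smul_eq_mul]
  push_cast
  ring

/-- The exponential `e^ξ` on the torus `V_ℂ / 2πiΓ`, for `ξ` in the dual lattice. -/
def expQ (Γ : Submodule ℤ V) (ξ : StrongDual ℝ V) (q : Cx V ⧸ periods Γ) : ℂ :=
  Complex.exp (pair ξ q.out)

theorem expQ_mk {ξ : StrongDual ℝ V} (hξ : ξ ∈ dualLattice Γ) (p : Cx V) :
    expQ Γ ξ (p : Cx V ⧸ periods Γ) = Complex.exp (pair ξ p) := by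
  obtain ⟨h, hh⟩ := QuotientAddGroup.mk_out_eq_add (periods Γ) p
  obtain ⟨γ, hγ, e⟩ := h.2
  rw [expQ, hh, e, map_add, Complex.exp_add, exp_pair_period hξ hγ, mul_one]

theorem expQ_add {ξ : StrongDual ℝ V} (hξ : ξ ∈ dualLattice Γ) (q q' : Cx V ⧸ periods Γ) :
    expQ Γ ξ (q + q') = expQ Γ ξ q * expQ Γ ξ q' := by
  induction q using QuotientAddGroup.induction_on with | H p => ?_
  induction q' using QuotientAddGroup.induction_on with | H p' => ?_
  rw [← QuotientAddGroup.mk_add, expQ_mk hξ, expQ_mk hξ, expQ_mk hξ, map_add, Complex.exp_add]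

variable {Δ σ : Finset (StrongDual ℝ V)}

/-- The vectors `v_α` form the dual basis of the basis `M α`, `α ∈ σ`. -/
def IsScaledDual (M : ℤ) (v : σ → V) : Prop :=
  ∀ (t : σ → ℝ) (α : σ), (M • (α : StrongDual ℝ V)) (∑ β, t β • v β) = t α

theorem exists_isScaledDual [FiniteDimensional ℝ V] (hσ : IsBasisSubset Δ σ) {M : ℤ} (hM : 0 < M) :
    ∃ v : σ → V, IsScaledDual M v := by
  choose v hv1 hv2 using fun α : σ => exists_dual_vector hσ α.2
  have hM' : (M : ℝ) ≠ 0 := Int.cast_ne_zero.2 hM.ne'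
  refine ⟨fun β => (M : ℝ)⁻¹ • v β, fun t α => ?_⟩
  rw [smul_apply, zsmul_eq_mul, map_sum, Finset.sum_eq_single α]
  · rw [map_smul, map_smul, hv1, smul_eq_mul, smul_eq_mul]
    field_simp
  · intro β _ hβ
    rw [map_smul, map_smul, hv2 β α α.2 fun h => hβ (Subtype.ext h.symm), smul_zero, smul_zero]
  · exact fun h => absurd (Finset.mem_univ α) h

theorem IsScaledDual.apply_int {M : ℤ} {v : σ → V} (hv : IsScaledDual M v) (l : σ → ℤ) (α : σ) :
    (M • (α : StrongDual ℝ V)) (∑ β, l β • v β) = l α := by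
  simpa only [Int.cast_smul_eq_zsmul] using hv (fun β => l β) α

theorem pair_period (ξ : StrongDual ℝ V) (w : V) :
    pair ξ (period w) = (ξ w : ℂ) * (2 * Real.pi * Complex.I) := by
  rw [period, map_smul, pair_ofReal, smul_eq_mul, mul_comm]

variable (Γ) in
/-- The points `2πi ∑ l_α v_α` of the torus. -/
def torusHom (v : σ → V) : (σ → ℤ) →+ Cx V ⧸ periods Γ where
  toFun l := ((period (∑ α, l α • v α) : Cx V) : Cx V ⧸ periods Γ)
  map_zero' := by
    simp only [Pi.zero_apply, zero_smul, Finset.sum_const_zero, period_zero]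
    rfl
  map_add' l l' := by
    rw [← QuotientAddGroup.mk_add, ← period_add, ← Finset.sum_add_distrib]
    simp only [Pi.add_apply, add_smul]

theorem IsScaledDual.eq_sum (hσ : IsBasisSubset Δ σ) {M : ℤ} (hM : 0 < M) {v : σ → V}
    (hv : IsScaledDual M v) (w : V) :
    w = ∑ α : σ, (M • (α : StrongDual ℝ V)) w • v α := by
  rw [← sub_eq_zero]
  refine eq_zero_of_span_eq_top hσ.2.2 fun β hβ => ?_
  have h1 : (M • β) (w - ∑ α : σ, (M • (α : StrongDual ℝ V)) w • v α) = 0 := by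
    rw [map_sub, hv (fun α => (M • (α : StrongDual ℝ V)) w) ⟨β, hβ⟩, sub_self]
  rw [smul_apply, zsmul_eq_mul] at h1
  exact (mul_eq_zero.1 h1).resolve_left (Int.cast_ne_zero.2 hM.ne')

theorem expQ_torusHom {M : ℤ} {v : σ → V} (hγ : ∀ α ∈ σ, M • α ∈ dualLattice Γ)
    (hv : IsScaledDual M v) (l : σ → ℤ) {α : StrongDual ℝ V} (hα : α ∈ σ) :
    expQ Γ (M • α) (torusHom Γ v l) = 1 := by
  change expQ Γ (M • α) ((period (∑ α, l α • v α) : Cx V) : Cx V ⧸ periods Γ) = 1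
  rw [expQ_mk (hγ α hα), pair_period, hv.apply_int l ⟨α, hα⟩, Complex.exp_eq_one_iff]
  exact ⟨l ⟨α, hα⟩, by push_cast; rfl⟩

/-- The points `2πi ∑ l_α v_α` are all the common zeros of the functions `e^{Mα} - 1`. -/
theorem mem_range_torusHom (hσ : IsBasisSubset Δ σ) {M : ℤ} (hM : 0 < M) {v : σ → V}
    (hγ : ∀ α ∈ σ, M • α ∈ dualLattice Γ)
    (hv : IsScaledDual M v)
    {q : Cx V ⧸ periods Γ} (hq : ∀ α ∈ σ, expQ Γ (M • α) q = 1) : ∃ l, torusHom Γ v l = q := by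
  induction q using QuotientAddGroup.induction_on with | H p => ?_
  have h1 : ∀ α : σ, ∃ l : ℤ, pair (M • (α : StrongDual ℝ V)) p = l * (2 * Real.pi * Complex.I) :=
    fun α => by
      have := hq α α.2
      rwa [expQ_mk (hγ α α.2), Complex.exp_eq_one_iff] at this
  choose l hl using h1
  refine ⟨l, ?_⟩
  change ((period (∑ α, l α • v α) : Cx V) : Cx V ⧸ periods Γ) = p
  congr 1
  refine Cx.ext fun β => ?_
  have h2 : ∀ β ∈ Submodule.span ℝ (σ : Set (StrongDual ℝ V)),
      pair β (period (∑ α, l α • v α)) = pair β p := fun β hβ => by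
    induction hβ using Submodule.span_induction with
    | mem α hα =>
      have h3 : pair (M • α) (period (∑ α, l α • v α)) = pair (M • α) p := by
        rw [hl ⟨α, hα⟩, pair_period, hv.apply_int l ⟨α, hα⟩]
        push_cast
        rfl
      rw [pair_zsmul, pair_zsmul] at h3
      exact mul_left_cancel₀ (Int.cast_ne_zero.2 hM.ne') h3
    | zero => rw [pair_zero, pair_zero]
    | add α β _ _ h1 h2 => rw [pair_add, pair_add, h1, h2]
    | smul c α _ h => rw [pair_smul, pair_smul, h]
  exact h2 β (by rw [hσ.2.2]; trivial)

/-- A point of the torus where the exponentials `e^{Mα}` take given values. -/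
theorem exists_torus_point [FiniteDimensional ℝ V] (hσ : IsBasisSubset Δ σ) {M : ℤ} (hM : 0 < M)
    (hγ : ∀ α ∈ σ, M • α ∈ dualLattice Γ) {U : StrongDual ℝ V → ℂ} (hU : ∀ α, U α ≠ 0) :
    ∃ q : Cx V ⧸ periods Γ, ∀ α ∈ σ, U α * expQ Γ (M • α) q = 1 := by
  obtain ⟨v, hv⟩ := exists_isScaledDual hσ hM
  let c : σ → ℂ := fun β => Complex.log (U β)⁻¹
  refine ⟨(tubePoint (∑ β, (c β).re • v β) (∑ β, (c β).im • v β) : Cx V), fun α hα => ?_⟩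
  rw [expQ_mk (hγ α hα), pair_tubePoint, hv (fun β => (c β).re) ⟨α, hα⟩,
    hv (fun β => (c β).im) ⟨α, hα⟩, mul_comm Complex.I, Complex.re_add_im,
    Complex.exp_log (inv_ne_zero (hU α)), mul_inv_cancel₀ (hU α)]

end Torus

section Index

variable {V : Type*} [NormedAddCommGroup V] [NormedSpace ℝ V] [FiniteDimensional ℝ V]
  {Γ : Submodule ℤ V} [DiscreteTopology Γ] [IsZLattice ℝ Γ] {Δ σ : Finset (StrongDual ℝ V)}

/-- The volume of the parallelepiped spanned by `σ`, as a determinant. -/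
theorem dualVolume_parallelepiped [DecidableEq σ] (e : LatIndex Γ ≃ σ) :
    (dualVolume Γ (parallelepiped (fun α : σ => (α : StrongDual ℝ V)))).toReal =
      |(Matrix.of fun i α : σ => (α : StrongDual ℝ V) (latBasis Γ (e.symm i))).det| := by
  classical
  let b : Module.Basis (LatIndex Γ) ℝ (StrongDual ℝ V) :=
    (latBasis Γ).dualBasis.map LinearMap.toContinuousLinearMap
  have h1 : dualVolume Γ = (b.reindex e).addHaar := by
    rw [Module.Basis.addHaar_reindex]
    rfl
  rw [h1, MeasureTheory.Measure.addHaar_parallelepiped, ENNReal.toReal_ofReal (abs_nonneg _),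
    Module.Basis.det_apply]
  congr 2
  ext i α
  rw [Module.Basis.toMatrix_apply, Module.Basis.repr_reindex_apply]
  simp [b]

/-- The group of the points of the torus where all the `e^{Mα}`, `α ∈ σ`, are `1` has order equal to
the volume of the parallelepiped spanned by the `Mα`. -/
theorem card_range_torusHom (hσ : IsBasisSubset Δ σ) {M : ℤ} (hM : 0 < M) {v : σ → V}
    (hγ : ∀ α ∈ σ, M • α ∈ dualLattice Γ)
    (hv : IsScaledDual M v) :
    (Nat.card (torusHom Γ v).range : ℝ) = (M : ℝ) ^ σ.card *
      (dualVolume Γ (parallelepiped (fun α : σ => (α : StrongDual ℝ V)))).toReal := by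
  classical
  have hcard : Fintype.card (LatIndex Γ) = Fintype.card σ := by
    rw [← Module.finrank_eq_card_basis (latBasis Γ), Fintype.card_coe,
      finrank_eq_card_of_isBasisSubset hσ]
  let e : LatIndex Γ ≃ σ := Fintype.equivOfCardEq hcard
  choose Z hZ using fun (g : Γ) (α : σ) => hγ α α.2 g g.2
  -- the order of the group is the index in `ℤ^σ` of the image of `Γ` under the forms `Mα`
  let ψ : Γ →ₗ[ℤ] (σ → ℤ) := AddMonoidHom.toIntLinearMap
    { toFun := Z
      map_zero' := funext fun α => by
        have := hZ 0 α
        simpa using this.symm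
      map_add' := fun g h => funext fun α => by
        have h1 := hZ (g + h) α
        rw [Submodule.coe_add, map_add, hZ, hZ] at h1
        exact_mod_cast h1.symm }
  have hψ : ∀ (g : Γ) (α : σ), (M • (α : StrongDual ℝ V)) (g : V) = ((ψ g α : ℤ) : ℝ) := hZ
  have hinj : Function.Injective ψ := fun g h hgh => by
    refine Subtype.ext ?_
    rw [hv.eq_sum hσ hM (g : V), hv.eq_sum hσ hM (h : V)]
    refine Finset.sum_congr rfl fun α _ => ?_
    rw [hψ, hψ, hgh]
  have hker : (torusHom Γ v).ker = (LinearMap.range ψ).toAddSubgroup := by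
    ext l
    rw [AddMonoidHom.mem_ker]
    change ((period (∑ α, l α • v α) : Cx V) : Cx V ⧸ periods Γ) = 0 ↔ l ∈ LinearMap.range ψ
    rw [QuotientAddGroup.eq_zero_iff]
    constructor
    · rintro ⟨g, hg, hgl⟩
      refine ⟨⟨g, hg⟩, funext fun α => ?_⟩
      have h1 := congrArg (pair (M • (α : StrongDual ℝ V))) hgl
      rw [pair_period, pair_period, hv.apply_int] at h1
      have h2 := mul_right_cancel₀ Complex.two_pi_I_ne_zero h1
      rw [hψ ⟨g, hg⟩ α] at h2
      exact_mod_cast h2.symm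
    · rintro ⟨g, rfl⟩
      refine ⟨g, g.2, ?_⟩
      conv_rhs => rw [hv.eq_sum hσ hM (g : V)]
      congr 1
      refine Finset.sum_congr rfl fun α _ => ?_
      rw [hψ, Int.cast_smul_eq_zsmul]
  let bN : Module.Basis σ ℤ (LinearMap.range ψ) :=
    ((intBasis Γ).map (LinearEquiv.ofInjective ψ hinj)).reindex e
  have h1 : Nat.card (torusHom Γ v).range =
      ((Pi.basisFun ℤ σ).det ((↑) ∘ bN)).natAbs := by
    rw [Submodule.natAbs_det_basis_change, ← AddSubgroup.index_ker, hker]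
    rfl
  have h2 : (((Pi.basisFun ℤ σ).det ((↑) ∘ bN) : ℤ) : ℝ) = (M : ℝ) ^ σ.card *
      (Matrix.of fun i α : σ => (α : StrongDual ℝ V) (latBasis Γ (e.symm i))).det := by
    rw [← Fintype.card_coe, ← Matrix.det_smul, Module.Basis.det_apply, ← eq_intCast (Int.castRingHom ℝ),
      RingHom.map_det, ← Matrix.det_transpose]
    congr 1
    ext i α
    have : (bN i : σ → ℤ) = ψ (intBasis Γ (e.symm i)) := by simp [bN]
    simp only [RingHom.mapMatrix_apply, Matrix.transpose_apply, Matrix.map_apply, Module.Basis.toMatrix_apply,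
      Function.comp_apply, Pi.basisFun_repr, this, Matrix.smul_apply, Matrix.of_apply, eq_intCast]
    rw [← hψ, latBasis_apply, smul_apply, zsmul_eq_mul, smul_eq_mul]
  rw [h1, Nat.cast_natAbs, Int.cast_abs, h2, abs_mul, dualVolume_parallelepiped e,
    abs_of_pos (pow_pos (Int.cast_pos.2 hM) _)]

end Index

/-! ### The residue formula and simple fractions -/

section Formula

variable {V : Type*} [NormedAddCommGroup V] [NormedSpace ℝ V]

theorem isExp_zero {Γ : Submodule ℤ V} (v₀ : V) :
    IsExp v₀ (0 : Mer V) (0 : dualLattice Γ → ℂ) :=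
  ⟨⟨0, fun _ h => absurd rfl h⟩, 1, 0, isCancellable_one, by rw [map_zero, zero_mul],
    by rw [map_zero, map_zero]; rfl⟩

theorem hasRes_zero (J : Mer V →ₗ[ℂ] ℂ) (Δ : Finset (StrongDual ℝ V)) : HasRes J Δ 0 0 := by
  have h : HasRes J Δ 1 (J (resPart 0 fun z => (1 : Entire V).1 z / (1 : Entire V).1 z)) :=
    ⟨0, 1, 1, by simp, one_ne_zero, by rw [linProd_zero, one_mul, one_mul], rfl⟩
  simpa using h.smul 0

/-- The meromorphic functions `G` that have an expansion, have finitely many poles modulo the periods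
at which `J` of the total residue does not vanish, and for which the sum of these values is the
constant coefficient of the expansion. -/
def formulaSpace (J : Mer V →ₗ[ℂ] ℂ) {Δ : Finset (StrongDual ℝ V)} (h0 : (0 : StrongDual ℝ V) ∉ Δ)
    (Γ : Submodule ℤ V) (v₀ : V) : Submodule ℂ (Mer V) where
  carrier := {G | ∃ (Θ : dualLattice Γ → ℂ) (r : (Cx V ⧸ periods Γ) →₀ ℂ), IsExp v₀ G Θ ∧
    (∀ p : Cx V, HasRes J Δ (reflect p G) (r p)) ∧ Θ 0 = r.sum fun _ a => a}
  zero_mem' := ⟨0, 0, isExp_zero v₀, fun p => by rw [map_zero]; exact hasRes_zero J Δ, by simp⟩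
  add_mem' := by
    rintro F G ⟨Θ, r, h1, h2, h3⟩ ⟨Θ', r', h1', h2', h3'⟩
    refine ⟨Θ + Θ', r + r', h1.add h1', fun p => ?_, ?_⟩
    · rw [map_add]; exact (h2 p).add h0 (h2' p)
    · rw [Pi.add_apply, h3, h3', Finsupp.sum_add_index' (fun _ => rfl) (fun _ _ _ => rfl)]
  smul_mem' := by
    rintro c G ⟨Θ, r, h1, h2, h3⟩
    refine ⟨c • Θ, c • r, h1.smul c, fun p => ?_, ?_⟩
    · rw [reflect_smul]; exact (h2 p).smul c
    · rw [Pi.smul_apply, h3, Finsupp.sum_smul_index fun _ => rfl, Finsupp.smul_sum]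
      rfl

theorem merDeriv_mem_formulaSpace [FiniteDimensional ℝ V] {J : Mer V →ₗ[ℂ] ℂ}
    {Δ : Finset (StrongDual ℝ V)}
    (h0 : (0 : StrongDual ℝ V) ∉ Δ) (hJ : ∀ x ∈ derivSpace Δ, J x = 0) {Γ : Submodule ℤ V} {v₀ : V}
    {G : Mer V} (hG : G ∈ formulaSpace J h0 Γ v₀) (v : Cx V) :
    merDeriv v G ∈ formulaSpace J h0 Γ v₀ := by
  obtain ⟨Θ, r, h1, h2, -⟩ := hG
  refine ⟨seriesDeriv v Θ, 0, h1.merDeriv v, fun p => ?_, ?_⟩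
  · have h := (hasRes_merDeriv h0 hJ (h2 p) v).smul (-1)
    rw [merDeriv_reflect, neg_one_smul, neg_neg] at h
    simpa using h
  · rw [Finsupp.sum_zero_index, seriesDeriv, Submodule.coe_zero, pair_zero, zero_mul]

/-- The quotient `(1 - e^{-Mα}) / α` is entire, with value `M` at the origin. -/
theorem exists_one_sub_exp_eq (α : StrongDual ℝ V) (M : ℤ) :
    ∃ k : Entire V, k.1 0 = M ∧ ∀ z, 1 - Complex.exp (-pair (M • α) z) = pair α z * k.1 z := by
  let f : ℂ → ℂ := fun w => -Complex.exp (-w)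
  have hf : Differentiable ℂ f := by fun_prop
  have hd : Differentiable ℂ (dslope f 0) := by
    rw [← differentiableOn_univ, Complex.differentiableOn_dslope Filter.univ_mem]
    exact hf.differentiableOn
  have h0 : dslope f 0 0 = 1 := by
    rw [dslope_same]
    have : HasDerivAt f 1 0 := by
      have h := ((hasDerivAt_neg (0 : ℂ)).cexp).fun_neg
      refine h.congr_deriv ?_
      rw [neg_zero, Complex.exp_zero, one_mul, neg_neg]
    exact this.deriv
  refine ⟨⟨fun z => M * dslope f 0 (pair (M • α) z), fun z _ => analyticAt_const.mul
    (AnalyticAt.comp (g := dslope f 0) (hd.analyticAt _) ((pair (M • α)).analyticAt z))⟩, ?_,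
    fun z => ?_⟩
  · change (M : ℂ) * dslope f 0 (pair (M • α) 0) = M
    rw [map_zero, h0, mul_one]
  · change _ = pair α z * (M * dslope f 0 (pair (M • α) z))
    have := sub_smul_dslope f 0 (pair (M • α) z)
    rw [sub_zero, smul_eq_mul, pair_zsmul] at this
    rw [pair_zsmul]
    simp only [f, neg_zero, Complex.exp_zero] at this
    linear_combination -this

theorem linProd_val (S : Finset (StrongDual ℝ V)) : linProd S.val = ∏ α ∈ S, linForm α := rfl

theorem entire_prod_apply {ι : Type*} (S : Finset ι) (f : ι → Entire V) (z : Cx V) :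
    (∏ α ∈ S, f α).1 z = ∏ α ∈ S, (f α).1 z := by
  rw [SubmonoidClass.coe_finsetProd, Finset.prod_apply]

theorem expQ_sum_zsmul {Γ : Submodule ℤ V} {ι : Type*} (s : Finset ι) (γ : ι → StrongDual ℝ V) (l : ι → ℤ)
    (q : Cx V ⧸ periods Γ) :
    expQ Γ (∑ k ∈ s, l k • γ k) q = ∏ k ∈ s, expQ Γ (γ k) q ^ l k := by
  rw [expQ, pair_sum, Complex.exp_sum]
  refine Finset.prod_congr rfl fun k _ => ?_
  rw [pair_zsmul, Complex.exp_int_mul]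
  rfl

variable [FiniteDimensional ℝ V] {Δ : Finset (StrongDual ℝ V)} {J : Mer V →ₗ[ℂ] ℂ}

/-- The residues of `e^ξ ∏_σ 1 / (1 - U_α e^{Mα})`: only the points where all the factors have a pole
contribute. -/
theorem hasRes_simple (h0 : (0 : StrongDual ℝ V) ∉ Δ) (hJ : ∀ x ∈ derivSpace Δ, J x = 0)
    {σ : Finset (StrongDual ℝ V)} (hσ : IsBasisSubset Δ σ) {M : ℤ} (hM : 0 < M)
    (U : StrongDual ℝ V → ℂ) (ξ : StrongDual ℝ V) (p : Cx V) :
    HasRes J Δ (reflect p (toMer (expForm ξ) * ∏ α ∈ σ, geom (M • α) (U α)))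
      (open Classical in if ∀ α ∈ σ, U α * Complex.exp (pair (M • α) p) = 1 then
        Complex.exp (pair ξ p) * ((M : ℂ) ^ σ.card)⁻¹ * J (simpleFraction σ) else 0) := by
  classical
  set h : StrongDual ℝ V → Entire V := fun α => entireReflect p (1 - U α • expForm (M • α)) with hh
  have hα0 : ∀ α ∈ σ, α ≠ 0 := fun α hα h => h0 (h ▸ hσ.1 hα)
  have hne : ∀ α ∈ σ, h α ≠ 0 := fun α hα => entireReflect_ne_zero p
    (one_sub_smul_expForm_ne_zero (zsmul_ne_zero_of (hα0 α hα) hM.ne') _)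
  have happ : ∀ α z, (h α).1 z = 1 - U α * Complex.exp (pair (M • α) (p - z)) := fun α z => rfl
  have hG : reflect p (toMer (expForm ξ) * ∏ α ∈ σ, geom (M • α) (U α)) * toMer (∏ α ∈ σ, h α) =
      toMer (entireReflect p (expForm ξ)) := by
    rw [map_mul, reflect_toMer, map_prod, mul_assoc, toMer_prod, ← Finset.prod_mul_distrib,
      Finset.prod_eq_one, mul_one]
    intro α hα
    rw [geom, map_inv₀, reflect_toMer]
    exact inv_mul_cancel₀ (toMer_ne_zero (hne α hα))
  choose k hk0 hk using fun α : StrongDual ℝ V => exists_one_sub_exp_eq α M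
  -- the factors with a pole at `p`
  set S := σ.filter fun α => U α * Complex.exp (pair (M • α) p) = 1 with hS
  have hSσ : S ⊆ σ := Finset.filter_subset _ _
  have hSh : ∀ α ∈ S, h α = linForm α * k α := fun α hα => by
    refine Subtype.ext (funext fun z => ?_)
    change (h α).1 z = pair α z * (k α).1 z
    rw [happ, ← hk, map_sub, sub_eq_add_neg (pair (M • α) p), Complex.exp_add, ← mul_assoc,
      (Finset.mem_filter.1 hα).2, one_mul]
  set b : Entire V := (∏ α ∈ S, k α) * ∏ α ∈ σ \ S, h α with hb
  have hprod : ∏ α ∈ σ, h α = b * linProd S.val := by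
    rw [← Finset.prod_sdiff hSσ, Finset.prod_congr rfl hSh, Finset.prod_mul_distrib, linProd_val, hb]
    ring
  have hM0 : (M : ℂ) ≠ 0 := Int.cast_ne_zero.2 hM.ne'
  have hb0 : b.1 0 ≠ 0 := by
    change (∏ α ∈ S, k α).1 0 * (∏ α ∈ σ \ S, h α).1 0 ≠ 0
    rw [entire_prod_apply, entire_prod_apply]
    refine mul_ne_zero (Finset.prod_ne_zero_iff.2 fun α _ => ?_)
      (Finset.prod_ne_zero_iff.2 fun α hα => ?_)
    · rw [hk0]; exact hM0
    · obtain ⟨hα, hαS⟩ := Finset.mem_sdiff.1 hα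
      rw [happ, sub_zero]
      intro h
      exact hαS (Finset.mem_filter.2 ⟨hα, (sub_eq_zero.1 h).symm⟩)
  rw [hprod] at hG
  split_ifs with hall
  · have hSeq : S = σ := Finset.filter_true_of_mem hall
    rw [hSeq] at hG
    have hr := hasRes_of_isBasisSubset (J := J) hσ hb0 hG
    have e1 : b.1 0 = (M : ℂ) ^ σ.card := by
      rw [hb, hSeq, Finset.sdiff_self, Finset.prod_empty, mul_one, entire_prod_apply,
        Finset.prod_congr rfl fun α _ => hk0 α, Finset.prod_const]
    have e2 : (entireReflect p (expForm ξ)).1 0 = Complex.exp (pair ξ p) := by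
      rw [entireReflect_apply, sub_zero]; rfl
    rwa [e1, e2, div_eq_mul_inv] at hr
  · refine hasRes_zero_of_degenerate h0 hJ (s := S.val) (fun α hα => hσ.1 (hSσ hα)) (fun hsp => ?_)
      hb0 hG
    push Not at hall
    obtain ⟨α, hα, hne⟩ := hall
    refine span_erase_ne_top hσ hα (top_le_iff.1 (hsp.ge.trans (Submodule.span_mono fun β hβ => ?_)))
    refine Finset.mem_coe.2 (Finset.mem_erase.2 ⟨?_, hSσ hβ⟩)
    rintro rfl
    exact hne (Finset.mem_filter.1 hβ).2

end Formula

section Simple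

variable {V : Type*} [NormedAddCommGroup V] [NormedSpace ℝ V] [FiniteDimensional ℝ V]
  {Γ : Submodule ℤ V} [DiscreteTopology Γ] [IsZLattice ℝ Γ] {Δ : Finset (StrongDual ℝ V)}
  {J : Mer V →ₗ[ℂ] ℂ}

instance : (dualVolume Γ).IsAddHaarMeasure := by
  unfold dualVolume
  infer_instance

theorem dualVolume_parallelepiped_pos {σ : Finset (StrongDual ℝ V)} (hσ : IsBasisSubset Δ σ) :
    0 < (dualVolume Γ (parallelepiped (fun α : σ => (α : StrongDual ℝ V)))).toReal := by
  have hb : (fun α : σ => (α : StrongDual ℝ V)) = basisOfSubset hσ :=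
    funext fun α => (basisOfSubset_apply hσ α).symm
  rw [hb]
  exact ENNReal.toReal_pos
    (MeasureTheory.Measure.measure_pos_of_nonempty_interior (dualVolume Γ)
      (basisOfSubset hσ).parallelepiped.interior_nonempty).ne'
    (basisOfSubset hσ).parallelepiped.isCompact.measure_lt_top.ne

/-- The points of the torus where `U_α e^{Mα} = 1` for all `α ∈ σ`: their number, and the sums of
characters over them. -/
theorem exists_torus_finset {σ : Finset (StrongDual ℝ V)} (hσ : IsBasisSubset Δ σ)
    {M : ℤ} (hM : 0 < M) (hγ : ∀ α ∈ σ, M • α ∈ dualLattice Γ) {U : StrongDual ℝ V → ℂ}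
    (hU : ∀ α, U α ≠ 0) :
    ∃ T : Finset (Cx V ⧸ periods Γ), (∀ q, q ∈ T ↔ ∀ α ∈ σ, U α * expQ Γ (M • α) q = 1) ∧
      (T.card : ℝ) = (M : ℝ) ^ σ.card *
        (dualVolume Γ (parallelepiped (fun α : σ => (α : StrongDual ℝ V)))).toReal ∧
      ∀ ξ ∈ dualLattice Γ, (¬ ∃ l : σ → ℤ, ξ = ∑ α, l α • (M • (α : StrongDual ℝ V))) →
        ∑ q ∈ T, expQ Γ ξ q = 0 := by
  classical
  obtain ⟨v, hv⟩ := exists_isScaledDual hσ hM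
  obtain ⟨q₀, hq₀⟩ := exists_torus_point hσ hM hγ hU
  have hcard := card_range_torusHom hσ hM hγ hv
  have hpos := dualVolume_parallelepiped_pos (Γ := Γ) hσ
  have hfin : Finite (torusHom Γ v).range := by
    refine Nat.finite_of_card_ne_zero fun h => ?_
    rw [h, Nat.cast_zero] at hcard
    exact (mul_pos (pow_pos (Int.cast_pos.2 hM) _) hpos).ne hcard
  have hfin' : ((torusHom Γ v).range : Set (Cx V ⧸ periods Γ)).Finite := Set.toFinite _
  refine ⟨hfin'.toFinset.image (fun q => q + q₀), fun q => ?_, ?_, fun ξ hξ hn => ?_⟩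
  · rw [Finset.mem_image]
    constructor
    · rintro ⟨q, hq, rfl⟩ α hα
      obtain ⟨l, rfl⟩ := hfin'.mem_toFinset.1 hq
      rw [expQ_add (hγ α hα), expQ_torusHom hγ hv l hα, one_mul, hq₀ α hα]
    · intro hq
      obtain ⟨l, hl⟩ := mem_range_torusHom hσ hM hγ hv (q := q - q₀) fun α hα => by
        have h1 := hq α hα
        rw [← sub_add_cancel q q₀, expQ_add (hγ α hα), mul_left_comm, hq₀ α hα, mul_one] at h1
        exact h1
      exact ⟨q - q₀, hfin'.mem_toFinset.2 ⟨l, hl⟩, sub_add_cancel q q₀⟩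
  · rw [Finset.card_image_of_injective _ (add_left_injective q₀), ← hcard]
    exact congrArg _ (Nat.card_eq_card_finite_toFinset hfin').symm
  · -- translation by a point `w` with `e^ξ(w) ≠ 1` multiplies the sum by `e^ξ(w)`
    rw [Finset.sum_image (add_left_injective q₀).injOn]
    obtain ⟨β, hβ⟩ : ∃ β : σ, ∀ k : ℤ, ξ (v β) ≠ k := by
      by_contra! hall
      choose l hl using hall
      refine hn ⟨l, ContinuousLinearMap.ext fun w => ?_⟩
      conv_lhs => rw [hv.eq_sum hσ hM w]
      rw [map_sum, sum_apply]
      refine Finset.sum_congr rfl fun α _ => ?_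
      rw [map_smul, hl, smul_apply, smul_apply, zsmul_eq_mul, zsmul_eq_mul, smul_apply,
        zsmul_eq_mul, smul_eq_mul, mul_comm]
    set w := torusHom Γ v (Pi.single β 1)
    have hw : expQ Γ ξ w ≠ 1 := by
      have : w = ((period (v β) : Cx V) : Cx V ⧸ periods Γ) := by
        change ((period (∑ α, (Pi.single β 1 : σ → ℤ) α • v α) : Cx V) : Cx V ⧸ periods Γ) = _
        congr 2
        rw [Finset.sum_eq_single β (fun α _ h => by rw [Pi.single_eq_of_ne h, zero_smul])
          (fun h => absurd (Finset.mem_univ β) h), Pi.single_eq_same, one_smul]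
      rw [this, expQ_mk hξ, pair_period, Ne, Complex.exp_eq_one_iff]
      rintro ⟨k, hk⟩
      have := mul_right_cancel₀ Complex.two_pi_I_ne_zero hk
      exact hβ k (by exact_mod_cast this)
    have hshift : ∑ q ∈ hfin'.toFinset, expQ Γ ξ (q + q₀) =
        expQ Γ ξ w * ∑ q ∈ hfin'.toFinset, expQ Γ ξ (q + q₀) := by
      rw [Finset.mul_sum]
      refine (Finset.sum_bij (fun q _ => w + q) (fun q hq => ?_) (fun _ _ _ _ h => add_left_cancel h)
        (fun q hq => ⟨q - w, ?_, add_sub_cancel w q⟩) fun q _ => ?_).symm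
      · rw [Set.Finite.mem_toFinset] at hq ⊢
        exact add_mem ⟨_, rfl⟩ hq
      · rw [Set.Finite.mem_toFinset] at hq ⊢
        exact sub_mem hq ⟨_, rfl⟩
      · rw [add_assoc, expQ_add hξ w]
    have : (1 - expQ Γ ξ w) * ∑ q ∈ hfin'.toFinset, expQ Γ ξ (q + q₀) = 0 := by
      rw [sub_mul, one_mul, ← hshift, sub_self]
    exact (mul_eq_zero.1 this).resolve_left (sub_ne_zero.2 hw.symm)

/-- The formula for simple fractions, by orthogonality of characters on the finite set of poles. -/
theorem hasSimpleFractions_formulaSpace (h0 : (0 : StrongDual ℝ V) ∉ Δ)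
    (hΔ : ∀ α ∈ Δ, α ∈ dualLattice Γ) {v₀ : V} (hv₀ : ∀ α ∈ Δ, 0 < α v₀)
    (hJ : ∀ x ∈ derivSpace Δ, J x = 0) {x : StrongDual ℝ V}
    (hJσ : ∀ σ, IsBasisSubset Δ σ → J (simpleFraction σ) = (open Classical in if x ∈ cone σ then
        (((dualVolume Γ (parallelepiped (fun α : σ => (α : StrongDual ℝ V)))).toReal : ℂ))⁻¹
        else 0)) : HasSimpleFractions Γ Δ (formulaSpace J h0 Γ v₀) x := by
  classical
  intro σ hσ M hM U hU ξ hξ s hs hx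
  have hγ : ∀ α ∈ σ, M • α ∈ dualLattice Γ := fun α hα =>
    Submodule.smul_mem _ M (hΔ _ (hσ.1 hα))
  obtain ⟨T, hT, hTcard, hTsum⟩ := exists_torus_finset hσ hM hγ hU
  let γ : σ → dualLattice Γ := fun α => ⟨M • (α : StrongDual ℝ V), hγ α α.2⟩
  have hγv : ∀ α, 0 < (γ α : StrongDual ℝ V) v₀ := fun α => by
    change 0 < (M • (α : StrongDual ℝ V)) v₀
    rw [smul_apply, zsmul_eq_mul]
    exact mul_pos (Int.cast_pos.2 hM) (hv₀ _ (hσ.1 α.2))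
  have hexp := (isExp_prod_geom hγv (fun α : σ => U α) Finset.univ).charMul
    (AddMonoidAlgebra.single ⟨ξ, hξ⟩ 1)
  rw [evalChar_single, one_smul] at hexp
  change IsExp v₀ (toMer (expForm ξ) * ∏ α : σ, geom (M • (α : StrongDual ℝ V)) (U α)) _ at hexp
  rw [Finset.prod_coe_sort σ fun α => geom (M • α) (U α)] at hexp
  set w := ((M : ℂ) ^ σ.card)⁻¹ * J (simpleFraction σ) with hw
  refine ⟨_, Finsupp.indicator T fun q _ => expQ Γ ξ q * w, hexp, fun p => ?_, ?_⟩
  · convert hasRes_simple h0 hJ hσ hM U ξ p using 1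
    rw [Finsupp.indicator_apply]
    have hiff : ((p : Cx V ⧸ periods Γ) ∈ T) ↔
        ∀ α ∈ σ, U α * Complex.exp (pair (M • α) p) = 1 := by
      rw [hT]
      exact forall₂_congr fun α hα => by rw [expQ_mk (hγ α hα)]
    by_cases h : (p : Cx V ⧸ periods Γ) ∈ T
    · rw [dif_pos h, if_pos (hiff.1 h), expQ_mk hξ, hw, mul_assoc]
    · rw [dif_neg h, if_neg fun h' => h (hiff.2 h')]
  · rw [shiftAct_single, one_mul, zero_sub, Finsupp.sum_indicator_index _ fun _ _ => rfl]
    have hrepr : ∀ t : σ → ℝ, ∀ α, (basisOfSubset hσ).repr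
        (∑ β : σ, t β • (M • (β : StrongDual ℝ V))) α = M * t α := fun t α => by
      have : ∑ β : σ, t β • (M • (β : StrongDual ℝ V)) =
          ∑ β : σ, (M * t β) • basisOfSubset hσ β :=
        Finset.sum_congr rfl fun β _ => by
          rw [basisOfSubset_apply, ← Int.cast_smul_eq_zsmul ℝ, smul_smul, mul_comm]
      rw [this, Module.Basis.repr_sum_self]
    have hMR : (0 : ℝ) < M := Int.cast_pos.2 hM
    have hcoe : ∀ m : σ → ℕ, ((∑ k, m k • γ k : dualLattice Γ) : StrongDual ℝ V) =
        ∑ k : σ, (m k : ℤ) • (M • (k : StrongDual ℝ V)) := fun m => by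
      rw [AddSubmonoidClass.coe_finsetSum]
      exact Finset.sum_congr rfl fun k _ => (natCast_zsmul _ _).symm
    -- only the exponents in the lattice spanned by the `Mα` contribute, on both sides
    by_cases hl : ∃ l : σ → ℤ, ξ = ∑ α, l α • (M • (α : StrongDual ℝ V))
    · obtain ⟨l, hl⟩ := hl
      have hmem : ∀ m : σ → ℕ, m ∈ expSet γ Finset.univ (-⟨ξ, hξ⟩) ↔ ∀ α, (m α : ℤ) = -l α := by
        intro m
        have h1 : m ∈ expSet γ Finset.univ (-⟨ξ, hξ⟩) ↔ ∑ k, m k • γ k = -⟨ξ, hξ⟩ :=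
          ⟨fun h => h.2, fun h => ⟨fun k hk => absurd (Finset.mem_univ k) hk, h⟩⟩
        rw [h1, ← Subtype.coe_inj, hcoe, Submodule.coe_neg]
        change _ = -ξ ↔ _
        constructor
        · intro h α
          have h2 : ∑ k : σ, ((m k : ℝ) + l k) • (M • (k : StrongDual ℝ V)) = 0 := by
            simp only [add_smul, Finset.sum_add_distrib]
            rw [eq_neg_iff_add_eq_zero, hl] at h
            simpa only [← Int.cast_smul_eq_zsmul ℝ, Int.cast_natCast] using h
          have h3 := hrepr (fun k => (m k : ℝ) + l k) α
          rw [h2, map_zero] at h3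
          have h4 := (mul_eq_zero.1 h3.symm).resolve_left hMR.ne'
          have h5 : ((m α : ℤ) : ℝ) + l α = 0 := h4
          exact eq_neg_of_add_eq_zero_left (by exact_mod_cast h5)
        · intro h
          rw [hl, ← Finset.sum_neg_distrib]
          exact Finset.sum_congr rfl fun k _ => by rw [h, neg_smul]
      -- the coefficients of `x` in the basis `Mα` are `s_α - l_α`, with `0 < s_α < 1`
      have hcone : x ∈ cone σ ↔ ∀ α, l α ≤ 0 := by
        have hx' : x = ∑ α : σ, (s α - l α) • (M • (α : StrongDual ℝ V)) := by
          rw [eq_sub_of_add_eq hx, hl, ← Finset.sum_coe_sort σ fun α => s α • (M • α),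
            ← Finset.sum_sub_distrib]
          exact Finset.sum_congr rfl fun k _ => by
            rw [← Int.cast_smul_eq_zsmul ℝ (l k)]; module
        rw [mem_cone_iff_repr hσ, hx']
        refine forall_congr' fun α => ?_
        rw [hrepr fun α => s α - l α, mul_nonneg_iff_of_pos_left hMR, sub_nonneg]
        constructor
        · intro h
          have : (l α : ℝ) < 1 := h.trans_lt (hs α α.2).2
          exact Int.lt_add_one_iff.1 (by exact_mod_cast this)
        · intro h
          exact (Int.cast_nonpos.2 h).trans (hs α α.2).1.le
      have hW : ∀ q ∈ T, expQ Γ ξ q = ∏ α : σ, U α ^ (-l α) := fun q hq => by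
        rw [hl, expQ_sum_zsmul]
        refine Finset.prod_congr rfl fun α _ => ?_
        rw [eq_inv_of_mul_eq_one_right ((hT q).1 hq α α.2), inv_zpow, zpow_neg]
      rw [Finset.sum_congr rfl fun q hq => by rw [hW q hq], Finset.sum_const, nsmul_eq_mul, geomCoeff]
      have hTc : (T.card : ℂ) = (M : ℂ) ^ σ.card * ((dualVolume Γ (parallelepiped
          (fun α : σ => (α : StrongDual ℝ V)))).toReal : ℂ) := by
        exact_mod_cast congrArg (fun r : ℝ => (r : ℂ)) hTcard
      have hvol := (dualVolume_parallelepiped_pos (Γ := Γ) hσ).ne'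
      have hM0 : (M : ℂ) ≠ 0 := Int.cast_ne_zero.2 hM.ne'
      by_cases hneg : ∀ α, l α ≤ 0
      · have hset : expSet γ Finset.univ (-⟨ξ, hξ⟩) = {fun α => (-l α).toNat} := by
          ext m
          rw [hmem, Set.mem_singleton_iff]
          constructor
          · exact fun h => funext fun α => by rw [← h α, Int.toNat_natCast]
          · rintro rfl α
            exact Int.toNat_of_nonneg (neg_nonneg.2 (hneg α))
        rw [hset, finsum_mem_singleton, hw, hJσ σ hσ, if_pos (hcone.2 hneg), hTc]
        have : ∏ α : σ, U α ^ (-l α).toNat = ∏ α : σ, U α ^ (-l α) :=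
          Finset.prod_congr rfl fun α _ => by
            rw [← zpow_natCast, Int.toNat_of_nonneg (neg_nonneg.2 (hneg α))]
        rw [this]
        have hvol' := Complex.ofReal_ne_zero.2 hvol
        field_simp
      · have hset : expSet γ Finset.univ (-⟨ξ, hξ⟩) = ∅ := by
          refine Set.eq_empty_iff_forall_notMem.2 fun m hm => hneg fun α => ?_
          have := (hmem m).1 hm α
          lia
        rw [hset, finsum_mem_empty, hw, hJσ σ hσ, if_neg fun h => hneg (hcone.1 h)]
        simp
    · rw [← Finset.sum_mul, hTsum ξ hξ hl, zero_mul, geomCoeff]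
      have hset : expSet γ Finset.univ (-⟨ξ, hξ⟩) = ∅ := by
        refine Set.eq_empty_iff_forall_notMem.2 fun m hm => hl ⟨fun k => -(m k : ℤ), ?_⟩
        have h1 := congrArg (fun y : dualLattice Γ => (y : StrongDual ℝ V)) hm.2
        simp only [hcoe] at h1
        change _ = -ξ at h1
        rw [← neg_eq_iff_eq_neg] at h1
        rw [← h1, ← Finset.sum_neg_distrib]
        exact Finset.sum_congr rfl fun k _ => (neg_smul _ _).symm
      rw [hset, finsum_mem_empty]

end Simple

/-! ### Big chambers and generic points -/

section Chamber

variable {V : Type*} [NormedAddCommGroup V] [NormedSpace ℝ V] {Δ : Finset (StrongDual ℝ V)} {v₀ : V}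

theorem isClosed_cone {ν : Finset (StrongDual ℝ V)} (hν : ∀ α ∈ ν, 0 < α v₀) :
    IsClosed (cone ν) := by
  rw [← closure_subset_iff_isClosed]
  intro x hx
  -- The part of the cone below a given level of `v₀` lies in a compact part of the cone.
  let K : Set (StrongDual ℝ V) := (fun t : ν → ℝ => ∑ α, t α • (α : StrongDual ℝ V)) ''
    Set.univ.pi fun α => Set.Icc 0 ((x v₀ + 1) / (α : StrongDual ℝ V) v₀)
  have hK : IsCompact K :=
    (isCompact_univ_pi fun α => isCompact_Icc).image (by fun_prop)
  have hKc : K ⊆ cone ν := by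
    rintro _ ⟨t, ht, rfl⟩
    classical
    refine ⟨fun α => if h : α ∈ ν then t ⟨α, h⟩ else 0, fun α => ?_, ?_⟩
    · dsimp only
      split_ifs with h
      exacts [(ht ⟨α, h⟩ trivial).1, le_rfl]
    · rw [← Finset.sum_coe_sort ν]
      exact Finset.sum_congr rfl fun α _ => by dsimp only; rw [dif_pos α.2]
  have hU : IsOpen {y : StrongDual ℝ V | y v₀ < x v₀ + 1} :=
    isOpen_lt (by fun_prop) continuous_const
  refine hKc (hK.isClosed.closure_subset_iff.2 ?_
    (hU.inter_closure ⟨show x v₀ < x v₀ + 1 from lt_add_one _, hx⟩))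
  rintro y ⟨hy, t, ht, rfl⟩
  refine ⟨fun α => t α, fun α _ => ⟨ht α, ?_⟩, Finset.sum_coe_sort ν fun α => t α • α⟩
  rw [le_div_iff₀ (hν α α.2)]
  refine le_trans ?_ (le_of_lt hy)
  rw [sum_apply]
  exact Finset.single_le_sum (f := fun α : StrongDual ℝ V => (t α • α) v₀)
    (fun β hβ => mul_nonneg (ht β) (hν β hβ).le) α.2

theorem isClosed_singularSet (hv₀ : ∀ α ∈ Δ, 0 < α v₀) : IsClosed (singularSet Δ) := by
  classical
  have : singularSet Δ = ⋃ ν ∈ (Δ.powerset.filter fun ν => ν.card < Module.finrank ℝ V : Finset _),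
      cone ν := by
    ext x
    simp only [singularSet, Set.mem_ofPred_eq, Finset.mem_filter, Finset.mem_powerset,
      Set.mem_iUnion, exists_prop, and_assoc]
  rw [this]
  refine isClosed_biUnion_finset fun ν hν => isClosed_cone fun α hα => hv₀ α ?_
  exact Finset.mem_powerset.1 (Finset.mem_filter.1 hν).1 hα

variable {c : Set (StrongDual ℝ V)}

theorem IsBigChamber.nonempty (hc : IsBigChamber Δ c) : c.Nonempty := by
  obtain ⟨x, hx, rfl⟩ := hc
  exact ⟨x, mem_connectedComponentIn hx⟩

theorem IsBigChamber.isOpen (hv₀ : ∀ α ∈ Δ, 0 < α v₀) (hc : IsBigChamber Δ c) : IsOpen c := by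
  obtain ⟨x, -, rfl⟩ := hc
  exact (isClosed_singularSet hv₀).isOpen_compl.connectedComponentIn

/-- A big chamber is contained in a simplicial cone as soon as it meets it: it does not meet the
boundary of the cone. -/
theorem IsBigChamber.mem_cone_iff [FiniteDimensional ℝ V] (hv₀ : ∀ α ∈ Δ, 0 < α v₀)
    (hc : IsBigChamber Δ c) {σ : Finset (StrongDual ℝ V)} (hσ : IsBasisSubset Δ σ)
    {x : StrongDual ℝ V} (hx : x ∈ c) : x ∈ cone σ ↔ c ⊆ cone σ := by
  classical
  refine ⟨fun hxσ => ?_, fun h => h hx⟩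
  set b := basisOfSubset hσ
  have hsub : c ⊆ (singularSet Δ)ᶜ := by
    obtain ⟨y, -, rfl⟩ := hc
    exact connectedComponentIn_subset _ _
  have hconn : IsPreconnected c := by
    obtain ⟨y, -, rfl⟩ := hc
    exact isPreconnected_connectedComponentIn
  let U : Set (StrongDual ℝ V) := ⋂ α, {y | 0 < b.repr y α}
  have hU : IsOpen U := isOpen_iInter_of_finite fun α =>
    isOpen_lt continuous_const (b.coord α).continuous_of_finiteDimensional
  have hUσ : U ⊆ cone σ := fun y hy =>
    (mem_cone_iff_repr hσ y).2 fun α => (Set.mem_iInter.1 hy α : 0 < b.repr y α).le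
  have key : ∀ y ∈ c, y ∈ cone σ → y ∈ U := by
    intro y hy hyσ
    refine Set.mem_iInter.2 fun α => ?_
    refine lt_of_le_of_ne ((mem_cone_iff_repr hσ y).1 hyσ α) fun h => hsub hy ?_
    refine ⟨σ.erase α, (Finset.erase_subset _ _).trans hσ.1, ?_, ?_⟩
    · rw [finrank_eq_card_of_isBasisSubset hσ]
      exact Finset.card_erase_lt_of_mem α.2
    · obtain ⟨t, ht, e⟩ := hyσ
      refine ⟨t, ht, ?_⟩
      have hα : b.repr y α = t α := by
        have : y = ∑ β : σ, t β • b β := by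
          rw [e, ← Finset.sum_coe_sort σ]
          exact Finset.sum_congr rfl fun β _ => by rw [basisOfSubset_apply]
        rw [this, b.repr_sum_self (fun β : σ => t β)]
      rw [e, ← Finset.add_sum_erase σ (fun β => t β • β) α.2, ← hα, ← h, zero_smul, zero_add]
  refine (hconn.subset_left_of_subset_union hU
    (isClosed_cone fun α hα => hv₀ α (hσ.1 hα)).isOpen_compl
    (Set.disjoint_compl_right_iff_subset.2 hUσ) (fun y hy => ?_) ⟨x, hx, key x hx hxσ⟩).trans hUσ
  by_cases h : y ∈ cone σ
  · exact Or.inl (key y hy h)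
  · exact Or.inr h

end Chamber

section Generic

variable {V : Type*} [NormedAddCommGroup V] [NormedSpace ℝ V] [FiniteDimensional ℝ V]
  {Γ : Submodule ℤ V} [DiscreteTopology Γ] [IsZLattice ℝ Γ]

theorem countable_dualLattice : (dualLattice Γ : Set (StrongDual ℝ V)).Countable := by
  choose Z hZ using fun (α : dualLattice Γ) (j : LatIndex Γ) => α.2 _ (latBasis_mem Γ j)
  refine Set.countable_coe_iff.1 (Function.Injective.countable (f := Z) fun α β h => ?_)
  exact Subtype.ext (ext_latBasis fun j => by rw [hZ, hZ, h])

/-- The points that are not generic lie on countably many translates of hyperplanes. -/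
theorem exists_isGeneric (Δ : Finset (StrongDual ℝ V)) {O : Set (StrongDual ℝ V)} (hO : IsOpen O)
    (hne : O.Nonempty) : ∃ x ∈ O, IsGeneric Γ Δ x := by
  set N : Set (StrongDual ℝ V) := ⋃ ν ∈ {ν : Set (StrongDual ℝ V) | ν ⊆ Δ},
    ⋃ ξ ∈ (dualLattice Γ : Set (StrongDual ℝ V)),
      {x | Submodule.span ℝ ν ≠ ⊤ ∧ x + ξ ∈ Submodule.span ℝ ν} with hN
  have h0 : dualVolume Γ N = 0 := by
    refine (MeasureTheory.measure_biUnion_null_iff Δ.finite_toSet.finite_subsets.countable).2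
      fun ν _ => (MeasureTheory.measure_biUnion_null_iff countable_dualLattice).2 fun ξ _ => ?_
    by_cases h : Submodule.span ℝ ν = ⊤
    · simp [h]
    · refine MeasureTheory.measure_mono_null ?_ (addHaar_hyperplane (dualVolume Γ) _ h (-ξ))
      rintro x ⟨-, hx⟩
      rwa [Set.mem_ofPred_eq, sub_neg_eq_add]
  by_contra! hall
  refine (hO.measure_pos (dualVolume Γ) hne).ne' (MeasureTheory.measure_mono_null (fun x hx => ?_) h0)
  have := hall x hx
  rw [IsGeneric] at this
  push Not at this
  obtain ⟨ν, hν, hs, ξ, hξ, hm⟩ := this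
  exact Set.mem_biUnion (show ν ∈ {ν : Set (StrongDual ℝ V) | ν ⊆ Δ} from hν)
    (Set.mem_biUnion (show ξ ∈ (dualLattice Γ : Set (StrongDual ℝ V)) from hξ) ⟨hs, hm⟩)

end Generic

/-! ### Growth along rays -/

section Growth

open Filter Topology

theorem tendsto_exp_mul_of_neg {e : ℝ} (he : e < 0) :
    Tendsto (fun s : ℝ => (Real.exp (s * e) : ℂ)) atTop (𝓝 0) := by
  rw [← Complex.ofReal_zero]
  exact (Complex.continuous_ofReal.tendsto 0).comp
    (Real.tendsto_exp_atBot.comp (tendsto_id.atTop_mul_const_of_neg he))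

/-- The leading term of an exponential sum with a unique largest exponent. -/
theorem tendsto_exp_sum {ι : Type*} {S : Finset ι} (a : ι → ℂ) (e : ι → ℝ) {i : ι} (hi : i ∈ S)
    (he : ∀ j ∈ S, j ≠ i → e j < e i) :
    Tendsto (fun s : ℝ => (Real.exp (s * -e i) : ℂ) * ∑ j ∈ S, a j * (Real.exp (s * e j) : ℂ))
      atTop (𝓝 (a i)) := by
  classical
  have h : ∀ s : ℝ, (Real.exp (s * -e i) : ℂ) * ∑ j ∈ S, a j * (Real.exp (s * e j) : ℂ) =
      a i + ∑ j ∈ S.erase i, a j * (Real.exp (s * (e j - e i)) : ℂ) := fun s => by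
    have h1 : ∀ j, (Real.exp (s * -e i) : ℂ) * (a j * (Real.exp (s * e j) : ℂ)) =
        a j * (Real.exp (s * (e j - e i)) : ℂ) := fun j => by
      rw [mul_left_comm, ← Complex.ofReal_mul, ← Real.exp_add]
      congr 4
      ring
    rw [Finset.mul_sum, ← Finset.add_sum_erase S _ hi, h1, sub_self, mul_zero, Real.exp_zero,
      Complex.ofReal_one, mul_one]
    exact congrArg _ (Finset.sum_congr rfl fun j _ => h1 j)
  have h2 : Tendsto (fun s : ℝ => a i + ∑ j ∈ S.erase i, a j * (Real.exp (s * (e j - e i)) : ℂ))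
      atTop (𝓝 (a i + ∑ j ∈ S.erase i, a j * 0)) :=
    tendsto_const_nhds.add (tendsto_finsetSum _ fun j hj => (tendsto_exp_mul_of_neg
      (sub_neg.2 (he j (Finset.mem_of_mem_erase hj) (Finset.ne_of_mem_erase hj)))).const_mul _)
  simp only [mul_zero, Finset.sum_const_zero, add_zero] at h2
  exact h2.congr fun s => (h s).symm

/-- The growth of a factor of the denominator. -/
theorem exists_tendsto_one_sub_exp {w : ℂ} (hw : w ≠ 0) {b : ℝ} (hb : b ≠ 0) :
    ∃ l : ℂ, l ≠ 0 ∧ Tendsto (fun s : ℝ => (Real.exp (s * -max b 0) : ℂ) *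
      (1 - w * (Real.exp (s * b) : ℂ))) atTop (𝓝 l) := by
  rcases hb.lt_or_gt with h | h
  · refine ⟨1, one_ne_zero, ?_⟩
    have h1 := ((tendsto_exp_mul_of_neg h).const_mul w).const_sub 1
    rw [mul_zero, sub_zero] at h1
    refine h1.congr fun s => ?_
    rw [max_eq_right h.le, neg_zero, mul_zero, Real.exp_zero, Complex.ofReal_one, one_mul]
  · refine ⟨-w, neg_ne_zero.2 hw, ?_⟩
    have h1 := (tendsto_exp_mul_of_neg (neg_neg_of_pos h)).sub_const w
    rw [zero_sub] at h1
    refine h1.congr fun s => ?_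
    rw [max_eq_left h.le, mul_sub, mul_one, mul_left_comm, ← Complex.ofReal_mul, ← Real.exp_add,
      ← mul_add, neg_add_cancel, mul_zero, Real.exp_zero, Complex.ofReal_one, mul_one]

variable {V : Type*} [NormedAddCommGroup V] [NormedSpace ℝ V]

/-- A quotient of exponential sums that is bounded along a ray has non-positive growth exponent
there. -/
theorem growth_le_of_mem_box {Γ : Submodule ℤ V} {c : dualLattice Γ →₀ ℂ} {R : ℕ} {u : Fin R → ℂ}
    {β : Fin R → StrongDual ℝ V} (hu : ∀ k, u k ≠ 0) {z₀ : Cx V} {μ : StrongDual ℝ V}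
    (hμ : μ ∈ box z₀ (toMer (c.sum fun ξ a => a • expForm (ξ : StrongDual ℝ V)) *
      ∏ k, geom (β k) (u k))) {v : V} (hβ : ∀ k, β k v ≠ 0) {ξ : dualLattice Γ}
    (hξ : ξ ∈ c.support)
    (hmax : ∀ η ∈ c.support, η ≠ ξ → (η : StrongDual ℝ V) v < (ξ : StrongDual ℝ V) v) :
    (μ + ξ) v ≤ ∑ k, max (β k v) 0 := by
  set z : ℝ → Cx V := fun s => z₀ + (s : ℂ) • ofReal v with hz
  have hexp : ∀ (η : StrongDual ℝ V) (s : ℝ), (expForm η).1 (z s) =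
      Complex.exp (pair η z₀) * (Real.exp (s * η v) : ℂ) := fun η s => by
    change Complex.exp (pair η (z s)) = _
    rw [hz, map_add, map_smul, pair_ofReal, Complex.exp_add, Complex.ofReal_exp, Complex.ofReal_mul,
      smul_eq_mul]
  set N : Entire V := c.sum fun ξ a => a • expForm (ξ : StrongDual ℝ V) with hN
  have hNz : ∀ s, N.1 (z s) = ∑ η ∈ c.support,
      (c η * Complex.exp (pair (η : StrongDual ℝ V) z₀)) *
        (Real.exp (s * (η : StrongDual ℝ V) v) : ℂ) := fun s => by
    rw [hN, Finsupp.sum, AddSubmonoidClass.coe_finsetSum, Finset.sum_apply]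
    refine Finset.sum_congr rfl fun η _ => ?_
    rw [mul_assoc, ← hexp]
    rfl
  have hNlim := tendsto_exp_sum (fun η : dualLattice Γ => c η * Complex.exp (pair (η : StrongDual ℝ V) z₀))
    (fun η => (η : StrongDual ℝ V) v) hξ hmax
  choose l hl0 hl using fun k => exists_tendsto_one_sub_exp
    (mul_ne_zero (hu k) (Complex.exp_ne_zero (pair (β k) z₀))) (hβ k)
  have hD : ∀ k s, (1 - u k • expForm (β k)).1 (z s) =
      1 - u k * Complex.exp (pair (β k) z₀) * (Real.exp (s * β k v) : ℂ) := fun k s => by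
    rw [mul_assoc, ← hexp]
    rfl
  have hval : ∀ᶠ s in atTop, valueAt (toMer N * ∏ k, geom (β k) (u k)) (z s) =
      N.1 (z s) * ∏ k, ((1 - u k • expForm (β k)).1 (z s))⁻¹ := by
    have : ∀ᶠ s in atTop, ∀ k, (1 - u k • expForm (β k)).1 (z s) ≠ 0 := by
      refine eventually_all.2 fun k => ?_
      filter_upwards [(hl k).eventually_ne (hl0 k)] with s hs
      rw [hD]
      exact right_ne_zero_of_mul hs
    filter_upwards [this] with s hs
    exact ((hasValueAt_toMer N _).mul (hasValueAt_finset_prod _ fun k _ =>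
      hasValueAt_inv_toMer (hs k))).valueAt_eq
  by_contra! hlt
  set E : ℝ := (μ + ξ) v - ∑ k, max (β k v) 0 with hE
  have hEpos : 0 < E := sub_pos.2 hlt
  have hlim := hNlim.mul (tendsto_finsetProd Finset.univ fun k _ => (hl k).inv₀ (hl0 k))
  have hlim0 : c ξ * Complex.exp (pair (ξ : StrongDual ℝ V) z₀) * ∏ k, (l k)⁻¹ ≠ 0 :=
    mul_ne_zero (mul_ne_zero (Finsupp.mem_support_iff.1 hξ) (Complex.exp_ne_zero _))
      (Finset.prod_ne_zero_iff.2 fun k _ => inv_ne_zero (hl0 k))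
  have hgrow : Tendsto (fun s : ℝ => Real.exp (s * E)) atTop atTop :=
    Real.tendsto_exp_atTop.comp (tendsto_id.atTop_mul_const hEpos)
  have hinf := hgrow.atTop_mul_pos (norm_pos_iff.2 hlim0) hlim.norm
  obtain ⟨C, hC⟩ := (hμ v).bound
  obtain ⟨s, ⟨h1, h2⟩, h3⟩ := ((hval.and hC).and (hinf.eventually_gt_atTop C)).exists
  refine absurd h2 (not_le.2 ?_)
  rw [norm_one, mul_one]
  refine h3.trans_le (le_of_eq ?_)
  change _ = ‖(Real.exp (s * μ v) : ℂ) * valueAt _ (z s)‖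
  rw [h1, ← Complex.norm_of_nonneg (Real.exp_pos (s * E)).le, ← norm_mul, hNz]
  congr 1
  have hk : ∀ k, ((Real.exp (s * -max (β k v) 0) : ℂ) *
      (1 - u k * Complex.exp (pair (β k) z₀) * (Real.exp (s * β k v) : ℂ)))⁻¹ =
      (Real.exp (s * max (β k v) 0) : ℂ) * ((1 - u k • expForm (β k)).1 (z s))⁻¹ := fun k => by
    rw [mul_inv, ← hD, ← Complex.ofReal_inv, ← Real.exp_neg, mul_neg, neg_neg]
  rw [Finset.prod_congr rfl fun k _ => hk k, Finset.prod_mul_distrib, ← Complex.ofReal_prod,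
    ← Real.exp_sum, ← Finset.mul_sum]
  have hexpo : Real.exp (s * μ v) = Real.exp (s * E) * Real.exp (s * -(ξ : StrongDual ℝ V) v) *
      Real.exp (s * ∑ k, max (β k v) 0) := by
    rw [← Real.exp_add, ← Real.exp_add, hE, add_apply]
    congr 1
    ring
  rw [hexpo]
  push_cast
  ring

end Growth

section Zonotope

variable {V : Type*} [NormedAddCommGroup V] [NormedSpace ℝ V] [FiniteDimensional ℝ V]

theorem exists_forall_apply_ne_zero (A : Finset (StrongDual ℝ V)) (hA : (0 : StrongDual ℝ V) ∉ A)
    {O : Set V} (hO : IsOpen O) (hne : O.Nonempty) : ∃ v ∈ O, ∀ α ∈ A, α v ≠ 0 := by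
  let _ : MeasurableSpace V := borel V
  have : BorelSpace V := ⟨rfl⟩
  let ρ : MeasureTheory.Measure V := MeasureTheory.Measure.addHaar
  have h0 : ρ (⋃ α ∈ A, {v | α v = 0}) = 0 := by
    refine (MeasureTheory.measure_biUnion_null_iff A.countable_toSet).2 fun α hα => ?_
    have h : LinearMap.ker (α : V →ₗ[ℝ] ℝ) ≠ ⊤ := fun h => hA (by
      have : α = 0 := ContinuousLinearMap.coe_injective (LinearMap.ker_eq_top.1 h)
      exact this ▸ hα)
    refine MeasureTheory.measure_mono_null ?_ (addHaar_hyperplane ρ _ h 0)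
    intro v hv
    rw [Set.mem_ofPred_eq, sub_zero]
    exact hv
  by_contra! hall
  refine (hO.measure_pos ρ hne).ne' (MeasureTheory.measure_mono_null (fun v hv => ?_) h0)
  obtain ⟨α, hα, h⟩ := hall v hv
  exact Set.mem_biUnion (show α ∈ (A : Set _) from hα) h

/-- A point that is not separated from a zonotope by a linear form lies in it. -/
theorem mem_zonotope {ι : Type*} [Fintype ι] {β : ι → StrongDual ℝ V} {x : StrongDual ℝ V}
    (hx : ∀ v, x v ≤ ∑ k, max (β k v) 0) :
    ∃ θ : ι → ℝ, (∀ k, 0 ≤ θ k ∧ θ k ≤ 1) ∧ x = ∑ k, θ k • β k := by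
  let T : (ι → ℝ) →L[ℝ] StrongDual ℝ V :=
    ∑ k, (ContinuousLinearMap.proj (R := ℝ) (φ := fun _ : ι => ℝ) k).smulRight (β k)
  have hT : ∀ θ, T θ = ∑ k, θ k • β k := fun θ => by
    simp [T]
  let K : Set (StrongDual ℝ V) := T '' Set.Icc 0 1
  have hK : IsCompact K := isCompact_Icc.image T.continuous
  have hKc : Convex ℝ K := (convex_Icc (0 : ι → ℝ) 1).linear_image T.toLinearMap
  by_cases hxK : x ∈ K
  · obtain ⟨θ, hθ, rfl⟩ := hxK
    exact ⟨θ, fun k => ⟨hθ.1 k, hθ.2 k⟩, hT θ⟩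
  · exfalso
    -- on the vertex where `v` is largest, its value is `∑ max (β k v) 0`
    obtain ⟨f, r, h1, h2⟩ := geometric_hahn_banach_closed_point hKc hK.isClosed hxK
    obtain ⟨v, hv⟩ : ∃ v : V, ∀ α : StrongDual ℝ V, f α = α v := by
      let g : Module.Dual ℝ (Module.Dual ℝ V) :=
        (f : StrongDual ℝ V →ₗ[ℝ] ℝ).comp (LinearMap.toContinuousLinearMap (E := V) (F' := ℝ)).toLinearMap
      obtain ⟨v, hv⟩ := (Module.evalEquiv ℝ V).surjective g
      refine ⟨v, fun α => ?_⟩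
      have := LinearMap.congr_fun hv (α : V →ₗ[ℝ] ℝ)
      exact this.symm
    classical
    refine absurd (hx v) (not_le.2 ?_)
    rw [← hv]
    refine lt_of_eq_of_lt ?_ ((h1 _ ⟨fun k => if 0 ≤ β k v then 1 else 0, ⟨fun k => ?_, fun k => ?_⟩,
      rfl⟩).trans h2)
    · rw [hv, hT, sum_apply]
      refine Finset.sum_congr rfl fun k _ => ?_
      rw [smul_apply, smul_eq_mul, ite_mul, one_mul, zero_mul]
      split_ifs with h
      exacts [max_eq_left h, max_eq_right (not_le.1 h).le]
    · dsimp only; split_ifs <;> simp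
    · dsimp only; split_ifs <;> simp

/-- The exponents of the numerator of `F`, moved by an element of `Box(F)`, lie in the zonotope of
the denominator. -/
theorem mem_zonotope_of_mem_box {Γ : Submodule ℤ V} {c : dualLattice Γ →₀ ℂ} {R : ℕ}
    {u : Fin R → ℂ} {β : Fin R → StrongDual ℝ V} (hu : ∀ k, u k ≠ 0) (hβ : ∀ k, β k ≠ 0)
    {z₀ : Cx V} {μ : StrongDual ℝ V}
    (hμ : μ ∈ box z₀ (toMer (c.sum fun ξ a => a • expForm (ξ : StrongDual ℝ V)) *
      ∏ k, geom (β k) (u k))) {ξ : dualLattice Γ} (hξ : ξ ∈ c.support) :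
    ∃ θ : Fin R → ℝ, (∀ k, 0 ≤ θ k ∧ θ k ≤ 1) ∧ μ + ξ = ∑ k, θ k • β k := by
  classical
  refine mem_zonotope fun v => ?_
  by_contra! hv
  let O : Set V := {w | ∑ k, max (β k w) 0 < (μ + ξ : StrongDual ℝ V) w}
  have hO : IsOpen O := isOpen_lt
    (continuous_finsetSum _ fun k _ => (β k).continuous.max continuous_const)
    (μ + ξ : StrongDual ℝ V).continuous
  -- the violated inequality is an open condition, so `v` may be moved off the zeros of these forms
  let A : Finset (StrongDual ℝ V) := Finset.univ.image β ∪
    ((c.support ×ˢ c.support).filter fun p => p.1 ≠ p.2).image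
      fun p => (p.1 : StrongDual ℝ V) - p.2
  have hA : (0 : StrongDual ℝ V) ∉ A := by
    intro h
    rcases Finset.mem_union.1 h with h | h
    · obtain ⟨k, -, hk⟩ := Finset.mem_image.1 h
      exact hβ k hk
    · obtain ⟨p, hp, he⟩ := Finset.mem_image.1 h
      exact (Finset.mem_filter.1 hp).2 (Subtype.ext (sub_eq_zero.1 he))
  obtain ⟨w, hw, hne⟩ := exists_forall_apply_ne_zero A hA hO ⟨v, hv⟩
  obtain ⟨η, hη, hmax⟩ := c.support.exists_max_image (fun η => (η : StrongDual ℝ V) w) ⟨ξ, hξ⟩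
  have h1 := growth_le_of_mem_box hu hμ (v := w)
    (fun k => hne _ (Finset.mem_union_left _ (Finset.mem_image_of_mem _ (Finset.mem_univ k)))) hη
    fun η' h' hn => lt_of_le_of_ne (hmax η' h') fun e => by
      refine hne ((η' : StrongDual ℝ V) - η) (Finset.mem_union_right _ (Finset.mem_image.2
        ⟨(η', η), Finset.mem_filter.2 ⟨Finset.mem_product.2 ⟨h', hη⟩, hn⟩, rfl⟩)) ?_
      rw [sub_apply, e, sub_self]
  have h2 : ∑ k, max (β k w) 0 < (μ + ξ : StrongDual ℝ V) w := hw
  have h3 := hmax ξ hξ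
  rw [add_apply] at h1 h2
  linarith

end Zonotope

end

end JKResidue

open JKResidue

theorem mainTheorem1 {V : Type*} [NormedAddCommGroup V] [NormedSpace ℝ V] [FiniteDimensional ℝ V]
    (Γ : Submodule ℤ V) [DiscreteTopology Γ] [IsZLattice ℝ Γ]
    (Δ : Finset (StrongDual ℝ V)) (hΔ : ∀ α ∈ Δ, α ∈ JKResidue.dualLattice Γ)
    (hhalf : ∃ v : V, ∀ α ∈ Δ, 0 < α v)
    (hspan : Submodule.span ℝ (Δ : Set (StrongDual ℝ V)) = ⊤)
    (F : JKResidue.Mer V) (hF : F ∈ JKResidue.expRing Γ Δ)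
    (z₀ : JKResidue.Cx V) (hz₀ : ¬ JKResidue.IsPole F z₀)
    (P : Finset (JKResidue.Cx V)) (hP : JKResidue.IsReducedPoles Γ Δ F P)
    (lam : JKResidue.dualLattice Γ)
    (c : Set (StrongDual ℝ V)) (hc : JKResidue.IsBigChamber Δ c)
    (hmeet : (((fun μ => (lam : StrongDual ℝ V) + μ) '' interior (JKResidue.box z₀ F)) ∩ c).Nonempty) :
    JKResidue.rPlus Γ Δ F lam =
      JKResidue.jeffreyKirwan (JKResidue.dualVolume Γ) Δ c
        (JKResidue.residueTransform Δ F P (lam : StrongDual ℝ V)) := by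
  classical
  obtain ⟨v₀, hv₀⟩ := hhalf
  have h0 : (0 : StrongDual ℝ V) ∉ Δ := fun h => lt_irrefl _ (hv₀ 0 h)
  have hco := hc.isOpen hv₀
  obtain ⟨hexp, b, R, u, β, huβ, hFe⟩ := isExp_rPlus hΔ hv₀ hF
  -- the admissible points form an open set, which contains a generic point
  obtain ⟨_, ⟨⟨μ, hμ, rfl⟩, hxc⟩, hgen⟩ := exists_isGeneric (Γ := Γ) Δ
    ((isOpenMap_add_left (lam : StrongDual ℝ V) _ isOpen_interior).inter hco) hmeet
  obtain ⟨J, hJ, hJσ, hJK⟩ := exists_jeffreyKirwan_extension (dualVolume Γ) hv₀ hco hc.nonempty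
    fun σ hσ x hx => hc.mem_cone_iff hv₀ hσ hx
  have hbase : HasSimpleFractions Γ Δ (formulaSpace J h0 Γ v₀) ((lam : StrongDual ℝ V) + μ) :=
    hasSimpleFractions_formulaSpace h0 hΔ hv₀ hJ fun σ hσ => by
      rw [hJσ σ hσ]
      exact if_congr (hc.mem_cone_iff hv₀ hσ hxc).symm rfl rfl
  -- the formula holds for all fractions whose exponent, moved by the generic point, lies in the
  -- zonotope of the denominator; `hmem` sums this over the numerator of `F`
  have hzon := hgen.zonotopeMem hΔ h0 (fun G hG v => merDeriv_mem_formulaSpace h0 hJ hG v) hbase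
    Finset.univ β (fun k _ => (huβ k).2) (fun _ => 1) (fun _ _ => one_ne_zero) u
    fun k _ => (huβ k).1
  have hmem : toMer (expForm (-(lam : StrongDual ℝ V))) * F ∈ formulaSpace J h0 Γ v₀ := by
    have hbox := interior_subset hμ
    rw [hFe] at hbox
    rw [hFe, Finsupp.sum, toMer_sum, Finset.sum_mul, Finset.mul_sum]
    refine Submodule.sum_mem _ fun ξ hξ => ?_
    obtain ⟨θ, hθ, e⟩ := mem_zonotope_of_mem_box (fun k => (huβ k).1)
      (fun k h => h0 (h ▸ (huβ k).2)) hbox hξ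
    have h := hzon (-(lam : StrongDual ℝ V) + ξ) (add_mem (neg_mem lam.2) ξ.2) θ (fun k _ => hθ k) (by
      simp only [one_smul]
      rw [← e]
      abel)
    simp only [one_smul] at h
    rw [expForm_add, toMer_mul] at h
    rw [toMer_smul, smul_mul_assoc, mul_smul_comm, ← mul_assoc]
    exact Submodule.smul_mem _ _ h
  obtain ⟨Θ, r, h1, h2, h3⟩ := hmem
  have hΘ : Θ 0 = rPlus Γ Δ F lam := by
    have h := hexp.charMul (AddMonoidAlgebra.single (-lam) 1)
    rw [evalChar_single, one_smul] at h
    rw [h1.unique h, shiftAct_single, one_mul, zero_sub, neg_neg]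
  have hshift : ∀ p, toMer (expFormShift (lam : StrongDual ℝ V) p) * reflect p F =
      reflect p (toMer (expForm (-(lam : StrongDual ℝ V))) * F) := fun p => by
    rw [map_mul, reflect_toMer]
    congr 2
    refine Subtype.ext (funext fun z => congrArg Complex.exp ?_)
    rw [pair_neg, ← map_neg, neg_sub]
  have hres : ∀ p : Cx V, J (totalResidue Δ (reflect p (toMer (expForm (-(lam : StrongDual ℝ V))) * F)) :
      Mer V) = r p := fun p => (h2 p).totalResidue_eq h0 hJ
  -- the points of the torus with nonzero residue are represented exactly once in `P`
  have hcov : r.support ⊆ P.image (QuotientAddGroup.mk (s := periods Γ)) := fun q hq => by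
    induction q using QuotientAddGroup.induction_on with | H q => ?_
    obtain ⟨p, hp, γ, hγ, e⟩ := hP.covers q (expForm (-(lam : StrongDual ℝ V))) fun h => by
      rw [mul_comm] at h
      exact Finsupp.mem_support_iff.1 hq (by rw [← hres, h, Submodule.coe_zero, map_zero])
    refine Finset.mem_image.2 ⟨p, hp, QuotientAddGroup.eq.2 ⟨γ, hγ, ?_⟩⟩
    rw [← e, neg_add_eq_sub]
  have hinj : Set.InjOn (QuotientAddGroup.mk (s := periods Γ)) (P : Set (Cx V)) := fun p hp q hq e => by
    obtain ⟨γ, hγ, h⟩ := QuotientAddGroup.eq.1 e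
    refine (hP.inequivalent q hq p hp ⟨γ, hγ, ?_⟩).symm
    rw [← h, neg_add_eq_sub]
  rw [← hΘ, h3, hJK, residueTransform, AddSubmonoidClass.coe_finsetSum, map_sum,
    Finsupp.sum_of_support_subset r hcov _ fun _ _ => rfl, Finset.sum_image hinj]
  exact Finset.sum_congr rfl fun p _ => by rw [hshift, hres]
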